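/- **Setting.** A *2-complex* is a compact Hausdorff space $X$ in which every point $x$ has a closed neighborhood homeomorphic, with $x$ as cone point, to the cone over a finite graph $\Gamma_x$. The point $x$ is *generic* if $\Gamma_x$ is homeomorphic to a circle, a *boundary point* if $\Gamma_x$ is homeomorphic to a segment, a *ridge point* if $\Gamma_x$ is homeomorphic to the graph $\theta_n$ with two vertices joined by $n\ge 3$ edges, and *singular* otherwise; $\mathrm{Int}(X)$ is the set of generic points and $\mathrm{rid}(X)$ the set of ridge points. Near a ridge point, $X$ is a union of $n\geq 3$ half-planes (the *branches*) with a common boundary line. An *oriented link* in $X$ is a finite family of oriented closed curves in $\mathrm{Int}(X)\cup \mathrm{rid}(X)$ whose only crossings (with themselves and with each other) are finitely many double transversal crossings in $\mathrm{Int}(X)$, which cross the ridge transversally from one branch to a different one, and such that every crossing is provided with two dots in opposite ones of the four adjacent areas. The *sign* of a crossing is $+1$ if the dots lie in the area between the two outgoing half-branches and in the area between the two incoming ones, and it is $-1$ if they lie in the other two areas. The *mirror image* $L^{\mathrm{mir}}$ of $L$ is obtained by moving, at every crossing, the dots to the other two areas; $-L$ is $L$ with the orientation of all components reversed. For an oriented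 2-component link $L$, let $\mathrm{lk}(L)=\sum_c \mathrm{sign}(c)\in\mathbb Z$, where $c$ runs over all crossings of the two components with each other. The *oriented basic moves* keep the orientations of the components. They are: * $M_1^{\pm}$: in a disc in $\mathrm{Int}(X)$, add to an arc a kink whose crossing has sign $\pm1$. * $M_2$, $M_3$: the second and third Reidemeister moves in a disc in $\mathrm{Int}(X)$, where a dotted crossing is read as an over/under-crossing by the rule that the overpassing line, when it is rotated counterclockwise to the underpassing line, sweeps the dotted areas. * $M_4$: push an arc lying in one branch across the ridge into another branch. * $M_5^{\pm}$: push a crossing of two strands, which both pass from one branch into another, across the ridge; the sign in $M_5^\pm$ distinguishes the two positions of the dots. * $M_6$: replace a strand passing from one branch into another one by a strand that passes from the first branch into a third one and from there into the second one. * $M_7$: if $x$ is a singular point with cone neighborhood $C(\Gamma_x)$, $S\subset\Gamma_x$ is an embedded circle, and the link meets the disc $D=C(S)$ along an embedded arc with endpoints in $\partial D=S$, replace this arc by another embedded arc in $D\setminus\{x\}$ with the same endpoints and transversal to $\mathrm{rid}(X)\cap D$. Two oriented links are *isotopic* if they are related by a finite sequence of ambient isotopies in $X$, oriented basic moves and their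 inverses. A link $L$ in $X$ is a *local link modeled on* an oriented link $\ell\subset\mathbb R^3$ if it is obtained by transporting a dotted planar diagram of $\ell$ along an embedding $\mathbb R^2\hookrightarrow\mathrm{Int}(X)$. For $\ell=\ell_1\cup\ell_2\subset\mathbb{R}^3$, $\mathrm{lk}(\ell_i,\ell_j)$ is the usual linking number, i.e. the sum of the classical signs of those crossings of a diagram of $\ell$ at which $\ell_i$ passes over $\ell_j$. **Statement.** Let $X$ be a 2-complex and let $L$ be an oriented 2-component link in $X$. 1. $\mathrm{lk}(L)$ is invariant under ambient isotopies in $X$ and under all oriented basic moves $M_1^{\pm}, M_2, M_3, M_4, M_5^{\pm}, M_6, M_7$. Hence it depends only on the isotopy class of $L$. (It does not depend on the numbering or on the parametrization of the components either.) 2. $\mathrm{lk}(L)$ is congruent modulo $2$ to the number of crossings of the two components with each other. 3. $\mathrm{lk}(L^{\mathrm{mir}})=-\mathrm{lk}(L)$ and $\mathrm{lk}(-L)=\mathrm{lk}(L)$. 4. If $L$ is a local link modeled on an oriented link $\ell=\ell_1\cup\ell_2\subset\mathbb R^3$, then $\mathrm{lk}(L)=\mathrm{lk}(\ell_1,\ell_2)+\mathrm{lk}(\ell_2,\ell_1)=2\,\mathrm{lk}(\ell_1,\ell_2)=2\,\mathrm{lk}(\ell_2,\ell_1)$.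 5. If $\mathrm{lk}(L)$ is odd, then $L$ is not isotopic to a local link. -/

import Mathlib

open Set Filter Topology

noncomputable section

namespace TwoComplexLinks

/-! ### Finite graphs, cones and 2-complexes -/

/-- A finite graph; multiple edges and loops are allowed. -/
structure FiniteGraph where
  V : Type
  E : Type
  finV : Finite V
  finE : Finite E
  src : E → V
  tgt : E → V

instance (Γ : FiniteGraph) : TopologicalSpace Γ.V := ⊥

instance (Γ : FiniteGraph) : TopologicalSpace Γ.E := ⊥

/-- The ends of each edge `e × [0,1]` are glued to the end vertices of `e`. -/
inductive FiniteGraph.Glue (Γ : FiniteGraph) :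
    Γ.V ⊕ (Γ.E × unitInterval) → Γ.V ⊕ (Γ.E × unitInterval) → Prop
  | src (e : Γ.E) : FiniteGraph.Glue Γ (Sum.inr (e, 0)) (Sum.inl (Γ.src e))
  | tgt (e : Γ.E) : FiniteGraph.Glue Γ (Sum.inr (e, 1)) (Sum.inl (Γ.tgt e))

/-- The underlying topological space of a finite graph. -/
def FiniteGraph.Space (Γ : FiniteGraph) : Type := Quot Γ.Glue

instance (Γ : FiniteGraph) : TopologicalSpace Γ.Space :=
  inferInstanceAs (TopologicalSpace (Quot Γ.Glue))

/-- The graph with two vertices and `n` edges connecting them. -/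
def theta (n : ℕ) : FiniteGraph where
  V := Bool
  E := Fin n
  finV := inferInstance
  finE := inferInstance
  src _ := false
  tgt _ := true

/-- `Y × {0}` is contracted to the cone point. -/
inductive ConeGlue (Y : Type) : Unit ⊕ (Y × unitInterval) → Unit ⊕ (Y × unitInterval) → Prop
  | apex (y : Y) : ConeGlue Y (Sum.inr (y, 0)) (Sum.inl ())

/-- The cone over `Y`. -/
def Cone (Y : Type) : Type := Quot (ConeGlue Y)

instance (Y : Type) [TopologicalSpace Y] : TopologicalSpace (Cone Y) :=
  inferInstanceAs (TopologicalSpace (Quot (ConeGlue Y)))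

/-- The cone point. -/
def Cone.apex (Y : Type) : Cone Y := Quot.mk _ (Sum.inl ())

/-- The point of the cone over `Y` represented by `(y, t)`. -/
def Cone.mk {Y : Type} (y : Y) (t : unitInterval) : Cone Y := Quot.mk _ (Sum.inr (y, t))

/-- `h` is a homeomorphism of the cone over `Y` onto a closed neighborhood of `x` that carries
the cone point to `x`. -/
def IsConeNbhd {X : Type*} [TopologicalSpace X] {Y : Type} [TopologicalSpace Y]
    (x : X) (h : Cone Y → X) : Prop :=
  IsClosedEmbedding h ∧ h (Cone.apex Y) = x ∧ range h ∈ 𝓝 x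

/-- A 2-complex: a compact Hausdorff space in which every point has a closed neighborhood that is
the cone over a finite graph with that point as cone point. -/
class IsTwoComplex (X : Type*) [TopologicalSpace X] : Prop extends CompactSpace X, T2Space X where
  exists_cone : ∀ x : X, ∃ (Γ : FiniteGraph) (h : Cone Γ.Space → X), IsConeNbhd x h

/-- The interior of `X`: the set of generic points. -/
def genericPoints (X : Type*) [TopologicalSpace X] : Set X :=
  {x | ∃ h : Cone Circle → X, IsConeNbhd x h}

/-- The boundary points of `X`. -/
def boundaryPoints (X : Type*) [TopologicalSpace X] : Set X :=
  {x | ∃ h : Cone unitInterval → X, IsConeNbhd x h}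

/-- The ridge points of `X`. -/
def ridgePoints (X : Type*) [TopologicalSpace X] : Set X :=
  {x | ∃ n : ℕ, 3 ≤ n ∧ ∃ h : Cone (theta n).Space → X, IsConeNbhd x h}

/-- The singular points of `X`. -/
def singularPoints (X : Type*) [TopologicalSpace X] : Set X :=
  (genericPoints X ∪ boundaryPoints X ∪ ridgePoints X)ᶜ

/-- The union of `n` half-planes having the same boundary line. The point `(u, w)` has position
`u` along the line, and its distance from the line in the `i`-th half-plane is `w i`. -/
def Book (n : ℕ) : Type :=
  {q : ℝ × (Fin n → ℝ) // (∀ i, 0 ≤ q.2 i) ∧ ∀ i j, i ≠ j → q.2 i = 0 ∨ q.2 j = 0}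

instance (n : ℕ) : TopologicalSpace (Book n) := inferInstanceAs (TopologicalSpace (Subtype _))

/-- The position along the ridge. -/
def Book.pos {n : ℕ} (q : Book n) : ℝ := q.1.1

/-- The distance from the ridge in the `i`-th half-plane (zero if `q` is not in it). -/
def Book.dist {n : ℕ} (q : Book n) (i : Fin n) : ℝ := q.1.2 i

/-! ### Oriented links -/

/-- `g` passes through the origin along the first coordinate axis, in the positive direction,
at time `0`. -/
def RunsRight (g : ℝ → ℝ × ℝ) : Prop :=
  (∀ᶠ u in 𝓝[>] (0 : ℝ), 0 < (g u).1 ∧ (g u).2 = 0) ∧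
    ∀ᶠ u in 𝓝[<] (0 : ℝ), (g u).1 < 0 ∧ (g u).2 = 0

/-- `g` passes through the origin along the second coordinate axis, in the positive direction,
at time `0`. -/
def RunsUp (g : ℝ → ℝ × ℝ) : Prop :=
  (∀ᶠ u in 𝓝[>] (0 : ℝ), (g u).1 = 0 ∧ 0 < (g u).2) ∧
    ∀ᶠ u in 𝓝[<] (0 : ℝ), (g u).1 = 0 ∧ (g u).2 < 0

variable {X : Type*} [TopologicalSpace X]

/-- `φ` is a chart of `X` centered at `α 0 = β 0` that takes the branch `α` to the first axis and
the branch `β` to the second axis, both in the positive direction. -/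
structure IsCrossingChart (φ : OpenPartialHomeomorph X (ℝ × ℝ)) (α β : ℝ → X) : Prop where
  mem_source : α 0 ∈ φ.source
  eq_center : α 0 = β 0
  map_center : φ (α 0) = 0
  right : RunsRight fun u => φ (α u)
  up : RunsUp fun u => φ (β u)

/-- Near its point at time `0`, the path `α` runs perpendicularly to the ridge, from one branch of
`X` into a different one. -/
def CrossesRidge (α : ℝ → X) : Prop :=
  ∃ (m : ℕ) (ψ : OpenPartialHomeomorph X (Book m)) (a b : Fin m),
    3 ≤ m ∧ a ≠ b ∧ α 0 ∈ ψ.source ∧ (ψ (α 0)).pos = 0 ∧ (∀ i, (ψ (α 0)).dist i = 0) ∧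
    (∀ᶠ u in 𝓝[<] (0 : ℝ), (ψ (α u)).pos = 0 ∧ 0 < (ψ (α u)).dist a) ∧
    ∀ᶠ u in 𝓝[>] (0 : ℝ), (ψ (α u)).pos = 0 ∧ 0 < (ψ (α u)).dist b

/-- Two sets have the same germ at `c`. -/
def SameGerm {Y : Type*} [TopologicalSpace Y] (c : Y) (A B : Set Y) : Prop :=
  ∀ᶠ y in 𝓝 c, y ∈ A ↔ y ∈ B

/-- The two families of opposite quadrants of the plane. -/
def evenQuadrants : Set (ℝ × ℝ) := {p | 0 < p.1 * p.2}

def oddQuadrants : Set (ℝ × ℝ) := {p | p.1 * p.2 < 0}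

/-- An oriented link with `n` components in `X`. The components are parametrized by
`ℝ / ℤ`. The dots are recorded by the set `dotted`, of which only the germs at the crossings
matter: near a crossing `dotted` is the union of the two opposite areas that carry the dots. -/
structure OrientedLink (X : Type*) [TopologicalSpace X] (n : ℕ) where
  curve : Fin n → C(AddCircle (1 : ℝ), X)
  dotted : Set X
  mem_interior_or_ridge : ∀ i p, curve i p ∈ genericPoints X ∪ ridgePoints X
  finite_crossings : {c : (Fin n × AddCircle (1 : ℝ)) × (Fin n × AddCircle (1 : ℝ)) |
    c.1 ≠ c.2 ∧ curve c.1.1 c.1.2 = curve c.2.1 c.2.2}.Finite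
  double : ∀ P Q R : Fin n × AddCircle (1 : ℝ), curve P.1 P.2 = curve Q.1 Q.2 →
    curve Q.1 Q.2 = curve R.1 R.2 → P = Q ∨ Q = R ∨ P = R
  crossing_mem : ∀ P Q : Fin n × AddCircle (1 : ℝ), P ≠ Q → curve P.1 P.2 = curve Q.1 Q.2 →
    curve P.1 P.2 ∈ genericPoints X
  crossing : ∀ P Q : Fin n × AddCircle (1 : ℝ), P ≠ Q → curve P.1 P.2 = curve Q.1 Q.2 →
    ∃ φ : OpenPartialHomeomorph X (ℝ × ℝ),
      IsCrossingChart φ (fun u => curve P.1 (P.2 + (u : ℝ))) (fun u => curve Q.1 (Q.2 + (u : ℝ))) ∧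
      (SameGerm (curve P.1 P.2) dotted (φ ⁻¹' evenQuadrants) ∨
        SameGerm (curve P.1 P.2) dotted (φ ⁻¹' oddQuadrants))
  ridge : ∀ i p, curve i p ∈ ridgePoints X → CrossesRidge fun u => curve i (p + (u : ℝ))

namespace OrientedLink

variable {n : ℕ}

/-- The point with parameter `P.2` on the component `P.1`. -/
def pt (L : OrientedLink X n) (P : Fin n × AddCircle (1 : ℝ)) : X := L.curve P.1 P.2

/-- The oriented branch of `L` at `P`. -/
def branch (L : OrientedLink X n) (P : Fin n × AddCircle (1 : ℝ)) (u : ℝ) : X :=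
  L.curve P.1 (P.2 + (u : AddCircle (1 : ℝ)))

/-- The crossings of `L`, as points of `X`. -/
def crossingPoints (L : OrientedLink X n) : Set X :=
  {c | ∃ P Q, P ≠ Q ∧ L.pt P = c ∧ L.pt Q = c}

open Classical in
/-- The sign of the crossing of the branches at `P` and `Q`. It is `1` if the dots lie in
the area between the two outgoing half-branches and in the area between the two incoming ones, and
it is `-1` if they lie in the other two areas. -/
def sign (L : OrientedLink X n) (P Q : Fin n × AddCircle (1 : ℝ)) : ℤ :=
  if ∃ φ : OpenPartialHomeomorph X (ℝ × ℝ), IsCrossingChart φ (L.branch P) (L.branch Q) ∧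
    SameGerm (L.pt P) L.dotted (φ ⁻¹' evenQuadrants) then 1 else -1

/-- The crossings of the component `0` with the component `1` of a 2-component link. -/
def mixedCrossings (L : OrientedLink X 2) : Set (AddCircle (1 : ℝ) × AddCircle (1 : ℝ)) :=
  {c | L.pt (0, c.1) = L.pt (1, c.2)}

theorem finite_mixedCrossings (L : OrientedLink X 2) : L.mixedCrossings.Finite := by
  refine Set.Finite.of_finite_image (f := fun c => (((0 : Fin 2), c.1), ((1 : Fin 2), c.2)))
    (L.finite_crossings.subset ?_) ?_
  · rintro _ ⟨c, hc, rfl⟩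
    exact ⟨by simp, hc⟩
  · rintro ⟨a, b⟩ _ ⟨c, d⟩ _ h
    simpa using h

/-- The linking number of an oriented 2-component link in `X`. -/
def lk (L : OrientedLink X 2) : ℤ :=
  ∑ c ∈ L.finite_mixedCrossings.toFinset, L.sign (0, c.1) (1, c.2)

end OrientedLink

/-! ### Mirror image and orientation reversal -/

theorem exists_direction (p : ℝ × ℝ) (σ τ : ℝ)
    (h : ∀ ε : ℝ, 0 < ε → 0 < (p.1 + ε * σ) * (p.2 + ε * τ)) :
    ¬ ∀ᶠ w in 𝓝 p, w ∉ evenQuadrants := by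
  intro hw
  have hc : Tendsto (fun ε : ℝ => (p.1 + ε * σ, p.2 + ε * τ)) (𝓝[>] 0) (𝓝 p) := by
    have : Continuous fun ε : ℝ => (p.1 + ε * σ, p.2 + ε * τ) := by fun_prop
    simpa using (this.tendsto 0).mono_left nhdsWithin_le_nhds
  obtain ⟨ε, h1, h2⟩ := ((hc.eventually hw).and self_mem_nhdsWithin).exists
  exact h1 (h ε h2)

theorem forall_notMem_even_iff (p : ℝ × ℝ) :
    (∀ᶠ w in 𝓝 p, w ∉ evenQuadrants) ↔ p ∈ oddQuadrants := by
  constructor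
  · intro h
    by_contra hp
    have hp' : 0 ≤ p.1 * p.2 := not_lt.mp hp
    rcases mul_nonneg_iff.mp hp' with ⟨h1, h2⟩ | ⟨h1, h2⟩
    · exact exists_direction p 1 1 (fun ε hε => mul_pos (by linarith) (by linarith)) h
    · exact exists_direction p (-1) (-1)
        (fun ε hε => mul_pos_of_neg_of_neg (by linarith) (by linarith)) h
  · intro hp
    have ho : IsOpen {q : ℝ × ℝ | q.1 * q.2 < 0} :=
      isOpen_lt (by fun_prop) continuous_const
    filter_upwards [ho.mem_nhds hp] with w hw
    exact not_lt.mpr (le_of_lt hw)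

theorem forall_notMem_odd_iff (p : ℝ × ℝ) :
    (∀ᶠ w in 𝓝 p, w ∉ oddQuadrants) ↔ p ∈ evenQuadrants := by
  have key : ∀ w : ℝ × ℝ, w ∈ oddQuadrants ↔ ((-w.1, w.2) : ℝ × ℝ) ∈ evenQuadrants := by
    intro w
    simp [oddQuadrants, evenQuadrants]
  let e : ℝ × ℝ ≃ₜ ℝ × ℝ := (Homeomorph.neg ℝ).prodCongr (Homeomorph.refl ℝ)
  have h2 := forall_notMem_even_iff (e p)
  rw [← e.map_nhds_eq, eventually_map] at h2
  have h3 : e p ∈ oddQuadrants ↔ p ∈ evenQuadrants := by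
    rw [key]
    simp [e]
  rw [← h3, ← h2]
  simp only [key]
  rfl

theorem sameGerm_interior_compl {φ : OpenPartialHomeomorph X (ℝ × ℝ)} {c : X}
    (hc : c ∈ φ.source) {D : Set X} {A B : Set (ℝ × ℝ)}
    (hAB : ∀ p, (∀ᶠ w in 𝓝 p, w ∉ A) ↔ p ∈ B) (h : SameGerm c D (φ ⁻¹' A)) :
    SameGerm c (interior Dᶜ) (φ ⁻¹' B) := by
  filter_upwards [eventually_eventually_nhds.mpr h, φ.open_source.mem_nhds hc] with y hy hys
  rw [mem_preimage, ← hAB, mem_interior_iff_mem_nhds, ← φ.map_nhds_eq hys, eventually_map]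
  constructor
  · intro h1
    filter_upwards [h1, hy] with z hz hz' hzA
    exact hz (hz'.mpr hzA)
  · intro h1
    filter_upwards [h1, hy] with z hz hz' hzD
    exact hz (hz'.mp hzD)

theorem RunsRight.reverse {g : ℝ → ℝ × ℝ} (h : RunsRight g) : RunsRight fun u => -g (-u) := by
  have h1 : Tendsto (fun u : ℝ => -u) (𝓝[>] 0) (𝓝[<] 0) := by
    simpa using tendsto_neg_nhdsGT (a := (0 : ℝ))
  have h2 : Tendsto (fun u : ℝ => -u) (𝓝[<] 0) (𝓝[>] 0) := by
    simpa using tendsto_neg_nhdsLT (a := (0 : ℝ))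
  refine ⟨(h1.eventually h.2).mono ?_, (h2.eventually h.1).mono ?_⟩
  all_goals
    rintro u ⟨hu, hv⟩
    simp [hu, hv]

theorem RunsUp.reverse {g : ℝ → ℝ × ℝ} (h : RunsUp g) : RunsUp fun u => -g (-u) := by
  have h1 : Tendsto (fun u : ℝ => -u) (𝓝[>] 0) (𝓝[<] 0) := by
    simpa using tendsto_neg_nhdsGT (a := (0 : ℝ))
  have h2 : Tendsto (fun u : ℝ => -u) (𝓝[<] 0) (𝓝[>] 0) := by
    simpa using tendsto_neg_nhdsLT (a := (0 : ℝ))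
  refine ⟨(h1.eventually h.2).mono ?_, (h2.eventually h.1).mono ?_⟩
  all_goals
    rintro u ⟨hu, hv⟩
    simp [hu, hv]

theorem IsCrossingChart.reverse {φ : OpenPartialHomeomorph X (ℝ × ℝ)} {α β : ℝ → X}
    (h : IsCrossingChart φ α β) :
    IsCrossingChart (φ.transHomeomorph (Homeomorph.neg (ℝ × ℝ)))
      (fun u => α (-u)) (fun u => β (-u)) where
  mem_source := by simpa using h.mem_source
  eq_center := by simpa using h.eq_center
  map_center := by simpa using h.map_center
  right := by simpa using h.right.reverse
  up := by simpa using h.up.reverse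

theorem CrossesRidge.reverse {α : ℝ → X} (h : CrossesRidge α) :
    CrossesRidge fun u => α (-u) := by
  obtain ⟨m, ψ, a, b, hm, hab, hs, hp, hd, hl, hr⟩ := h
  have h1 : Tendsto (fun u : ℝ => -u) (𝓝[>] 0) (𝓝[<] 0) := by
    simpa using tendsto_neg_nhdsGT (a := (0 : ℝ))
  have h2 : Tendsto (fun u : ℝ => -u) (𝓝[<] 0) (𝓝[>] 0) := by
    simpa using tendsto_neg_nhdsLT (a := (0 : ℝ))
  exact ⟨m, ψ, b, a, hm, hab.symm, by simpa using hs, by simpa using hp, by simpa using hd,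
    h2.eventually hr, h1.eventually hl⟩

namespace OrientedLink

variable {n : ℕ}

/-- The mirror image: at every crossing the dots move to the other two areas. -/
def mirror (L : OrientedLink X n) : OrientedLink X n where
  curve := L.curve
  dotted := interior L.dottedᶜ
  mem_interior_or_ridge := L.mem_interior_or_ridge
  finite_crossings := L.finite_crossings
  double := L.double
  crossing_mem := L.crossing_mem
  crossing P Q hPQ h := by
    obtain ⟨φ, hφ, hd⟩ := L.crossing P Q hPQ h
    have hs : L.curve P.1 P.2 ∈ φ.source := by simpa using hφ.mem_source
    refine ⟨φ, hφ, ?_⟩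
    rcases hd with hd | hd
    · exact Or.inr (sameGerm_interior_compl hs forall_notMem_even_iff hd)
    · exact Or.inl (sameGerm_interior_compl hs forall_notMem_odd_iff hd)
  ridge := L.ridge

/-- The parameter of the reversed link that corresponds to `P`. -/
def negParam (P : Fin n × AddCircle (1 : ℝ)) : Fin n × AddCircle (1 : ℝ) := (P.1, -P.2)

theorem negParam_injective : Function.Injective (negParam (n := n)) := by
  rintro ⟨i, p⟩ ⟨j, q⟩ h
  simpa [negParam] using h

/-- The link `-L`: the same link with opposite orientation of all components. -/
def reverse (L : OrientedLink X n) : OrientedLink X n where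
  curve i := (L.curve i).comp ⟨fun p => -p, continuous_neg⟩
  dotted := L.dotted
  mem_interior_or_ridge i p := L.mem_interior_or_ridge i (-p)
  finite_crossings := by
    refine (L.finite_crossings.preimage (f := fun c => (negParam c.1, negParam c.2)) ?_).subset ?_
    · rintro ⟨a, b⟩ _ ⟨c, d⟩ _ h
      simp only [Prod.mk.injEq] at h
      exact Prod.ext (negParam_injective h.1) (negParam_injective h.2)
    · rintro ⟨a, b⟩ ⟨h1, h2⟩
      exact ⟨fun h => h1 (negParam_injective h), h2⟩
  double P Q R h1 h2 := by
    rcases L.double (negParam P) (negParam Q) (negParam R) h1 h2 with h | h | h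
    · exact Or.inl (negParam_injective h)
    · exact Or.inr (Or.inl (negParam_injective h))
    · exact Or.inr (Or.inr (negParam_injective h))
  crossing_mem P Q hPQ h :=
    L.crossing_mem (negParam P) (negParam Q) (fun h' => hPQ (negParam_injective h')) h
  crossing P Q hPQ h := by
    obtain ⟨φ, hφ, hd⟩ :=
      L.crossing (negParam P) (negParam Q) (fun h' => hPQ (negParam_injective h')) h
    refine ⟨φ.transHomeomorph (Homeomorph.neg (ℝ × ℝ)), ?_, ?_⟩
    · have := hφ.reverse
      simp only [negParam, AddCircle.coe_neg] at this
      simpa [neg_add, add_comm] using this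
    · simpa [SameGerm, negParam, evenQuadrants, oddQuadrants] using hd
  ridge i p h := by
    have := (L.ridge i (-p) h).reverse
    simp only [AddCircle.coe_neg] at this
    simpa [neg_add, add_comm] using this

end OrientedLink

/-! ### Isotopy -/

section Moves

variable {n : ℕ}

/-- `L'` is the same oriented link as `L`, up to the numbering of the components, their
orientation-preserving parametrization, and the choice of the set representing the dots. -/
def SameLink (L L' : OrientedLink X n) : Prop :=
  (∃ (σ : Equiv.Perm (Fin n)) (H : Fin n → ℝ ≃o ℝ), (∀ i u, H i (u + 1) = H i u + 1) ∧
    ∀ (i : Fin n) (u : ℝ), L'.curve (σ i) (u : AddCircle (1 : ℝ)) = L.curve i (H i u : ℝ)) ∧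
  ∀ c ∈ L.crossingPoints, SameGerm c L'.dotted L.dotted

/-- `L'` is the image of `L` under the final homeomorphism of an ambient isotopy of `X`. -/
def AmbientIsotopic (L L' : OrientedLink X n) : Prop :=
  ∃ H : unitInterval → X ≃ₜ X, Continuous (fun z : unitInterval × X => H z.1 z.2) ∧
    (∀ x, H 0 x = x) ∧ (∀ i p, L'.curve i p = H 1 (L.curve i p)) ∧
    ∀ c ∈ L'.crossingPoints, SameGerm c L'.dotted (H 1 '' L.dotted)

/-- A dotted picture formed by `k` arcs in a model space; the arcs are parametrized by `[-1,1]`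
and the set `dotted` is only used near the crossings of the arcs. -/
structure Picture (M : Type) (k : ℕ) where
  arc : Fin k → ℝ → M
  dotted : Set M

/-- `e` draws the picture `T` in `X` in such a way that it is the part of `L` lying in `e '' K`;
the `j`-th arc is the part of `L` with parameters `s j τ`, where `τ` runs over `[-1,1]`. -/
structure PicturedBy {M : Type} [TopologicalSpace M] {k : ℕ} (e : M → X) (K : Set M)
    (T : Picture M k) (s : Fin k → ℝ → Fin n × AddCircle (1 : ℝ)) (L : OrientedLink X n) :
    Prop where
  pt_eq : ∀ j, ∀ τ ∈ Icc (-1 : ℝ) 1, L.pt (s j τ) = e (T.arc j τ)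
  mem : ∀ P, L.pt P ∈ e '' K → ∃ j, ∃ τ ∈ Icc (-1 : ℝ) 1, P = s j τ
  dotted : ∀ q ∈ K, e q ∈ L.crossingPoints → SameGerm q (e ⁻¹' L.dotted) T.dotted

/-- `L'` is obtained from `L` by replacing the picture `T` in `e '' K` by the picture `T'`, with
the same orientation of the arcs, and leaving the rest of the link unchanged. The sign of `r j`
says in which direction the link runs along the `j`-th arc. -/
def Replaces {M : Type} [TopologicalSpace M] {k : ℕ} (e : M → X) (K : Set M)
    (T T' : Picture M k) (L L' : OrientedLink X n) : Prop :=
  ∃ (i : Fin k → Fin n) (a : Fin k → AddCircle (1 : ℝ)) (r : Fin k → ℝ)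
    (s : Fin k → ℝ → Fin n × AddCircle (1 : ℝ)),
    (∀ j τ, s j τ = (i j, a j + ((r j * τ : ℝ) : AddCircle (1 : ℝ)))) ∧
    (∀ j, ∀ τ ∈ Icc (-1 : ℝ) 1, ∀ j', ∀ τ' ∈ Icc (-1 : ℝ) 1, s j τ = s j' τ' → j = j' ∧ τ = τ') ∧
    PicturedBy e K T s L ∧ PicturedBy e K T' s L' ∧
    (∀ P, (¬ ∃ j, ∃ τ ∈ Icc (-1 : ℝ) 1, P = s j τ) → L'.pt P = L.pt P) ∧
    ∀ c ∈ L.crossingPoints, c ∉ e '' K → SameGerm c L'.dotted L.dotted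

/-- A coordinate disc in the interior of `X`. -/
def IsInteriorDisc (e : ℝ × ℝ → X) : Prop :=
  IsOpenEmbedding e ∧ range e ⊆ genericPoints X

/-- An arc without crossings. -/
def pictureM1 : Picture (ℝ × ℝ) 1 where
  arc _ τ := (τ, -τ ^ 2)
  dotted := ∅

/-- An arc with one kink, crossing itself at the origin. Near the origin the arc
is the curve `x ^ 2 = y ^ 2 * (1 - y) / 2`. The dots are on the left and on the right of the
crossing if `positive` is true, and above and below it otherwise. -/
def pictureM1' (positive : Bool) : Picture (ℝ × ℝ) 1 where
  arc _ τ := (τ * (2 * τ ^ 2 - 1), 1 - 2 * τ ^ 2)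
  dotted := if positive then {q | q.2 ^ 2 * (1 - q.2) / 2 < q.1 ^ 2}
    else {q | q.1 ^ 2 < q.2 ^ 2 * (1 - q.2) / 2}

/-- The move `M1⁺` adds a kink whose crossing is positive, and `M1⁻` adds a kink whose crossing is
negative. -/
def MoveM1 (positive : Bool) (L L' : OrientedLink X n) : Prop :=
  ∃ e : ℝ × ℝ → X, IsInteriorDisc e ∧
    Replaces e (Icc (-1, -1) (1, 1)) pictureM1 (pictureM1' positive) L L'

/-- Two disjoint arcs. -/
def pictureM2 : Picture (ℝ × ℝ) 2 where
  arc := ![fun τ => (τ, 0), fun τ => (τ, 1 / 2)]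
  dotted := ∅

/-- Two arcs forming a bigon; the bigon carries a dot at its left vertex but not at its right
vertex. -/
def pictureM2' : Picture (ℝ × ℝ) 2 where
  arc := ![fun τ => (τ, 0), fun τ => (τ, |τ| - 1 / 2)]
  dotted := {q | 0 < q.1 * q.2 * (q.2 - |q.1| + 1 / 2)}

/-- The move `M2` creates two crossings such that one strand lies above the other one at
both of them. -/
def MoveM2 (L L' : OrientedLink X n) : Prop :=
  ∃ e : ℝ × ℝ → X, IsInteriorDisc e ∧ Replaces e (Icc (-1, -1) (1, 1)) pictureM2 pictureM2' L L'

/-- Three arcs, pairwise crossing at one point: the diagonals `y = x`, `y = -x` and the graph of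
`y = κ * (1 - |x|) / 2`, where `κ = 1` or `κ = -1`. The numbers `a`, `b`, `c` say which areas are
dotted at the crossings of the graph with `y = x`, of the graph with `y = -x`, and of the two
diagonals; these crossings are at `x = κ / 3`, `x = -κ / 3` and `x = 0`. -/
def pictureM3 (κ a b c : ℝ) : Picture (ℝ × ℝ) 3 where
  arc := ![fun τ => (τ, κ * (1 - |τ|) / 2), fun τ => (τ, τ), fun τ => (τ, -τ)]
  dotted := {q |
    (1 / 6 < κ * q.1 ∧ 0 < a * ((q.2 - κ * (1 - |q.1|) / 2) * (q.2 - q.1))) ∨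
    (κ * q.1 < -(1 / 6) ∧ 0 < b * ((q.2 - κ * (1 - |q.1|) / 2) * (q.2 + q.1))) ∨
    (|q.1| < 1 / 6 ∧ 0 < c * ((q.2 - q.1) * (q.2 + q.1)))}

/-- The move `M3` pushes a strand over a crossing of two other strands; the directions of the
dotted areas at the three crossings do not change. The condition on `a`, `b`, `c` says that
the dots define a top, a middle and a bottom strand, i.e. that the triangle formed
by the strands carries one or two dots. -/
def MoveM3 (L L' : OrientedLink X n) : Prop :=
  ∃ (e : ℝ × ℝ → X) (a b c : ℝ), IsInteriorDisc e ∧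
    (a = 1 ∨ a = -1) ∧ (b = 1 ∨ b = -1) ∧ (c = a ∨ c = b) ∧
    Replaces e (Icc (-1, -1) (1, 1)) (pictureM3 1 a b c) (pictureM3 (-1) a b c) L L'

/-- The plane formed by the half-planes `0` (where `y ≥ 0`) and `1` (where `y ≤ 0`) of a book. -/
def Book.plane (k : ℕ) (p : ℝ × ℝ) : Book (k + 3) :=
  ⟨(p.1, fun i => if i = 0 then max p.2 0 else if i = 1 then max (-p.2) 0 else 0), by
    refine ⟨fun i => ?_, fun i j hij => ?_⟩
    · dsimp only
      split_ifs <;> simp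
    · rcases le_total p.2 0 with h | h
      · have : max p.2 0 = 0 := max_eq_right h
        by_cases hi : i = 1
        · subst hi
          by_cases hj : j = 0 <;> simp [hj, this, Ne.symm hij]
        · left
          simp [this, hi]
      · have : max (-p.2) 0 = 0 := max_eq_right (by linarith)
        by_cases hi : i = 0
        · subst hi
          by_cases hj : j = 1 <;> simp [hj, this, Ne.symm hij]
        · left
          simp [this, hi]⟩

/-- The part of the half-planes with numbers in `s` at distance at most `1` from the ridge and with
`|pos| ≤ 1`. -/
def Book.box {m : ℕ} (s : Set (Fin m)) : Set (Book m) :=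
  {q | |q.pos| ≤ 1 ∧ (∀ i, q.dist i ≤ 1) ∧ ∀ i, i ∉ s → q.dist i = 0}

/-- The move `M4` pushes an arc lying in one branch of `X` across the ridge into another branch. -/
def MoveM4 (L L' : OrientedLink X n) : Prop :=
  ∃ (k : ℕ) (e : Book (k + 3) → X), IsOpenEmbedding e ∧
    Replaces (k := 1) e (Book.box {0, 1})
      { arc := fun _ τ => Book.plane k (τ, 1 / 2), dotted := ∅ }
      { arc := fun _ τ => Book.plane k (τ, |τ| - 1 / 2), dotted := ∅ } L L'

/-- Two strands that cross the ridge and meet at one point, whose ordinate in the union of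
two branches is `κ / 3`, where `κ = 1` or `κ = -1`. The strands are the curves
`x = y - κ * (1 - |y|) / 2` and `x = -(y - κ * (1 - |y|) / 2)`. The dots are on the left and on the
right of the crossing if `side` is true, and otherwise above and below it. -/
def pictureM5 (k : ℕ) (κ : ℝ) (side : Bool) : Picture (Book (k + 3)) 2 where
  arc := ![fun τ => Book.plane k (τ - κ * (1 - |τ|) / 2, τ),
    fun τ => Book.plane k (-(τ - κ * (1 - |τ|) / 2), τ)]
  dotted := Book.plane k '' (if side then
      {p | |p.2 - κ * (1 - |p.2|) / 2| < |p.1|} else {p | |p.1| < |p.2 - κ * (1 - |p.2|) / 2|})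

/-- The moves `M5⁺` and `M5⁻` push a crossing across the ridge. They differ in the position of the
dots. -/
def MoveM5 (side : Bool) (L L' : OrientedLink X n) : Prop :=
  ∃ (k : ℕ) (e : Book (k + 3) → X), IsOpenEmbedding e ∧
    Replaces e (Book.box {0, 1}) (pictureM5 k 1 side) (pictureM5 k (-1) side) L L'

/-- A path from the half-plane `0` of a book through the half-plane `2` to the half-plane `1`,
crossing the ridge at the positions `-1/2` and `1/2`. -/
def Book.detour (k : ℕ) (τ : ℝ) : Book (k + 3) :=
  ⟨(τ, fun i => if i = 0 then max (-τ - 1 / 2) 0 else if i = 1 then max (τ - 1 / 2) 0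
    else if i = 2 then max (1 / 2 - |τ|) 0 else 0), by
    refine ⟨fun i => ?_, fun i j hij => ?_⟩
    · dsimp only
      split_ifs <;> simp
    · have h0 : max (-τ - 1 / 2) 0 = 0 ∨ max (τ - 1 / 2) 0 = 0 := by
        rcases le_total τ 0 with h | h
        · exact Or.inr (max_eq_right (by linarith))
        · exact Or.inl (max_eq_right (by linarith))
      have h1 : max (-τ - 1 / 2) 0 = 0 ∨ max (1 / 2 - |τ|) 0 = 0 := by
        rcases le_total (-τ - 1 / 2) 0 with h | h
        · exact Or.inl (max_eq_right h)
        · exact Or.inr (max_eq_right (by have := neg_abs_le τ; linarith))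
      have h2 : max (τ - 1 / 2) 0 = 0 ∨ max (1 / 2 - |τ|) 0 = 0 := by
        rcases le_total (τ - 1 / 2) 0 with h | h
        · exact Or.inl (max_eq_right h)
        · exact Or.inr (max_eq_right (by have := le_abs_self τ; linarith))
      dsimp only
      split_ifs <;> grind⟩

/-- The move `M6` pushes a strand that crosses the ridge from one branch into another one
through a third branch. -/
def MoveM6 (L L' : OrientedLink X n) : Prop :=
  ∃ (k : ℕ) (e : Book (k + 3) → X), IsOpenEmbedding e ∧
    Replaces (k := 1) e (Book.box {0, 1, 2})
      { arc := fun _ τ => Book.plane k (τ, -τ / 2), dotted := ∅ }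
      { arc := fun _ τ => Book.detour k τ, dotted := ∅ } L L'

/-- The disc formed by the cone over a circle `j` embedded in a graph, in a cone neighborhood
`h`. -/
def coneDisc {Y : Type} (h : Cone Y → X) (j : Circle → Y) : Set X :=
  {x | ∃ z t, x = h (Cone.mk (j z) t)}

/-- The boundary circle of that disc. -/
def coneDiscBoundary {Y : Type} (h : Cone Y → X) (j : Circle → Y) : Set X :=
  {x | ∃ z, x = h (Cone.mk (j z) 1)}

/-- `L` meets the set `D` along an embedded arc with endpoints in `B`, and this arc is the part of
the `i`-th component with parameters in `[a,b]`. -/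
def MeetsAlongArc (D B : Set X) (i : Fin n) (a b : ℝ) (L : OrientedLink X n) : Prop :=
  (∀ P, L.pt P ∈ D ↔ ∃ u ∈ Icc a b, P = (i, (u : AddCircle (1 : ℝ)))) ∧
    InjOn (fun u : ℝ => L.pt (i, (u : AddCircle (1 : ℝ)))) (Icc a b) ∧
    L.pt (i, (a : AddCircle (1 : ℝ))) ∈ B ∧ L.pt (i, (b : AddCircle (1 : ℝ))) ∈ B

/-- The move `M7` replaces an arc in a disc centered at a singular point by another arc
with the same endpoints. (As `L'` is a link, the new arc avoids the singular point and
is transversal to the ridge.) -/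
def MoveM7 (L L' : OrientedLink X n) : Prop :=
  ∃ x ∈ singularPoints X, ∃ (Γ : FiniteGraph) (h : Cone Γ.Space → X) (j : Circle → Γ.Space)
    (i : Fin n) (a b : ℝ), IsConeNbhd x h ∧ IsEmbedding j ∧ a < b ∧
    MeetsAlongArc (coneDisc h j) (coneDiscBoundary h j) i a b L ∧
    MeetsAlongArc (coneDisc h j) (coneDiscBoundary h j) i a b L' ∧
    (∀ P, (¬ ∃ u ∈ Ioo a b, P = (i, (u : AddCircle (1 : ℝ)))) → L'.pt P = L.pt P) ∧
    ∀ c ∈ L.crossingPoints, SameGerm c L'.dotted L.dotted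

/-- The oriented basic moves. -/
inductive BasicMove (L L' : OrientedLink X n) : Prop
  | M1_pos (h : MoveM1 true L L')
  | M1_neg (h : MoveM1 false L L')
  | M2 (h : MoveM2 L L')
  | M3 (h : MoveM3 L L')
  | M4 (h : MoveM4 L L')
  | M5_pos (h : MoveM5 true L L')
  | M5_neg (h : MoveM5 false L L')
  | M6 (h : MoveM6 L L')
  | M7 (h : MoveM7 L L')

/-- Isotopy of oriented links: the equivalence relation generated by ambient isotopies
and the oriented basic moves. -/
def Isotopic : OrientedLink X n → OrientedLink X n → Prop :=
  Relation.EqvGen fun L L' => SameLink L L' ∨ AmbientIsotopic L L' ∨ BasicMove L L'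

end Moves

/-! ### Classical links and local links -/

/-- The determinant of a pair of vectors in the plane. -/
def det2 (v w : ℝ × ℝ) : ℝ := v.1 * w.2 - v.2 * w.1

/-- The velocity at `p` of the projection of a closed curve in `ℝ² × ℝ` to the plane. -/
def planeVelocity (γ : C(AddCircle (1 : ℝ), (ℝ × ℝ) × ℝ)) (p : AddCircle (1 : ℝ)) : ℝ × ℝ :=
  deriv (fun u : ℝ => (γ (p + (u : AddCircle (1 : ℝ)))).1) 0

/-- An oriented `n`-component link in `ℝ³ = ℝ² × ℝ` in general position: the
components are disjoint closed curves embedded in `ℝ³`, continuously differentiable with an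
immersed projection to the plane, and the only crossings of the projection are finitely many double
transversal crossings. Together with the heights at the crossings, the projection is a link
diagram. -/
structure ClassicalLink (n : ℕ) where
  curve : Fin n → C(AddCircle (1 : ℝ), (ℝ × ℝ) × ℝ)
  smooth : ∀ i, ContDiff ℝ 1 fun u : ℝ => curve i (u : AddCircle (1 : ℝ))
  immersed : ∀ i p, planeVelocity (curve i) p ≠ 0
  embedded : ∀ P Q : Fin n × AddCircle (1 : ℝ), curve P.1 P.2 = curve Q.1 Q.2 → P = Q
  finite_crossings : {c : (Fin n × AddCircle (1 : ℝ)) × (Fin n × AddCircle (1 : ℝ)) |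
    c.1 ≠ c.2 ∧ (curve c.1.1 c.1.2).1 = (curve c.2.1 c.2.2).1}.Finite
  double : ∀ P Q R : Fin n × AddCircle (1 : ℝ), (curve P.1 P.2).1 = (curve Q.1 Q.2).1 →
    (curve Q.1 Q.2).1 = (curve R.1 R.2).1 → P = Q ∨ Q = R ∨ P = R
  transversal : ∀ P Q : Fin n × AddCircle (1 : ℝ), P ≠ Q →
    (curve P.1 P.2).1 = (curve Q.1 Q.2).1 →
    det2 (planeVelocity (curve P.1) P.2) (planeVelocity (curve Q.1) Q.2) ≠ 0

namespace ClassicalLink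

variable {n : ℕ}

/-- The branch of `ℓ` at `P` passes over the branch of `ℓ` at `Q`. -/
def Over (ℓ : ClassicalLink n) (P Q : Fin n × AddCircle (1 : ℝ)) : Prop :=
  (ℓ.curve P.1 P.2).1 = (ℓ.curve Q.1 Q.2).1 ∧ (ℓ.curve Q.1 Q.2).2 < (ℓ.curve P.1 P.2).2

/-- The direction of the projection of `ℓ` at `P`. -/
def velocity (ℓ : ClassicalLink n) (P : Fin n × AddCircle (1 : ℝ)) : ℝ × ℝ :=
  planeVelocity (ℓ.curve P.1) P.2

theorem finite_over (ℓ : ClassicalLink n) (i j : Fin n) :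
    {c : AddCircle (1 : ℝ) × AddCircle (1 : ℝ) | ℓ.Over (i, c.1) (j, c.2)}.Finite := by
  refine Set.Finite.of_finite_image (f := fun c => ((i, c.1), (j, c.2)))
    (ℓ.finite_crossings.subset ?_) ?_
  · rintro _ ⟨c, ⟨h1, h2⟩, rfl⟩
    refine ⟨fun h => ?_, h1⟩
    dsimp only at h
    rw [h] at h2
    exact lt_irrefl _ h2
  · rintro ⟨a, b⟩ _ ⟨c, d⟩ _ h
    simpa using h

/-- The linking number of the `i`-th and the `j`-th component of a link in `ℝ³` (`i ≠ j`): the sum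
of the signs of the crossings where the `i`-th component passes over the `j`-th one. -/
def lk (ℓ : ClassicalLink n) (i j : Fin n) : ℤ :=
  ∑ c ∈ (ℓ.finite_over i j).toFinset,
    (SignType.sign (det2 (ℓ.velocity (i, c.1)) (ℓ.velocity (j, c.2))) : ℤ)

end ClassicalLink

/-- `L` is the local link obtained by drawing the dotted diagram of `ℓ` in the interior of `X`
along the embedding `f` of the plane. At every crossing, the dotted areas are those that are swept
by the overpassing line when it is rotated counterclockwise to the underpassing line. -/
structure IsLocalLinkModeledOn {n : ℕ} (L : OrientedLink X n) (ℓ : ClassicalLink n)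
    (f : ℝ × ℝ → X) : Prop where
  embedding : IsEmbedding f
  range_subset : range f ⊆ genericPoints X
  curve_eq : ∀ i p, L.curve i p = f (ℓ.curve i p).1
  dotted : ∀ P Q, ℓ.Over P Q → ∀ d : ℝ × ℝ,
    0 < det2 (ℓ.velocity P) d * det2 d (ℓ.velocity Q) * det2 (ℓ.velocity P) (ℓ.velocity Q) →
    ∀ᶠ ε in 𝓝[>] (0 : ℝ), f ((ℓ.curve P.1 P.2).1 + ε • d) ∈ L.dotted

/-- `L` is a local link. -/
def IsLocal {n : ℕ} (L : OrientedLink X n) : Prop :=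
  ∃ (ℓ : ClassicalLink n) (f : ℝ × ℝ → X), IsLocalLinkModeledOn L ℓ f

end TwoComplexLinks

end

noncomputable section

namespace TwoComplexLinks

variable {X : Type*} [TopologicalSpace X] {n : ℕ}

/-! ### Planar germs preserving the coordinate axes -/

/-! The sign of a crossing is local: it depends only on the germs of the two oriented branches and
on the germ of the dotted areas. It is well defined because a continuous injective planar germ that
preserves both oriented axes preserves each pair of opposite quadrants (`quadrants_of_axes`). No
smoothness is needed: such a germ cannot send a point off an axis onto that axis, and half-discs are
connected. The consequence used throughout is `sign_of_parametrization`: the sign can be read off in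
any injective continuous parametrization whose axes follow the branches, from dotted points close to
the origin.

For invariance, a move changes the link only for parameters in a closed set `A`, and no crossing has
one parameter inside `A` and the other outside. The crossings outside contribute the same before and
after, so only the contribution of `A` has to be compared (`lk_sub_lk_eq`, `Replaces.lk_eq`). In M1,
M4, M6 and M7 a single strand is involved, so `A` contains no crossing of different components. M2
creates two crossings of opposite signs, and in M3 and M5 every crossing keeps its sign. Ambient
isotopies and reparametrizations carry charts and dots along.

Parity holds because every sign is odd. The mirror image exchanges the two pairs of quadrants at
each crossing; reversing all components amounts to rotating each chart by a half turn, which fixes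
both pairs.

For a local link, the sign of a crossing is the classical sign, the determinant being taken with the
upper strand first. Grouping crossings by the upper component gives `lk 0 1 + lk 1 0`. These two
numbers agree because two closed plane curves have algebraic intersection number zero
(`sum_sign_intersections_eq_zero`), which is proved by pulling back a bump form concentrated at the
origin under the difference of the curves and integrating over the torus. Hence local links have
even linking number, and an odd value obstructs locality. -/

theorem RunsRight.swap {g : ℝ → ℝ × ℝ} (h : RunsRight g) : RunsUp fun u => (g u).swap :=
  ⟨h.1.mono fun _ h => ⟨h.2, h.1⟩, h.2.mono fun _ h => ⟨h.2, h.1⟩⟩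

theorem RunsUp.swap {g : ℝ → ℝ × ℝ} (h : RunsUp g) : RunsRight fun u => (g u).swap :=
  ⟨h.1.mono fun _ h => ⟨h.2, h.1⟩, h.2.mono fun _ h => ⟨h.2, h.1⟩⟩

theorem eventually_nhds_of_sides {p : ℝ → Prop} (h0 : p 0) (hl : ∀ᶠ u in 𝓝[<] (0 : ℝ), p u)
    (hr : ∀ᶠ u in 𝓝[>] (0 : ℝ), p u) : ∀ᶠ u in 𝓝 (0 : ℝ), p u := by
  rw [← nhdsNE_sup_pure, ← nhdsLT_sup_nhdsGT]
  simp only [eventually_sup]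
  exact ⟨⟨hl, hr⟩, h0⟩

theorem exists_Ioo_of_eventually {p : ℝ → Prop} (h : ∀ᶠ u in 𝓝 (0 : ℝ), p u) :
    ∃ δ > 0, ∀ u, |u| < δ → p u := by
  obtain ⟨δ, hδ, h⟩ := Metric.eventually_nhds_iff.mp h
  exact ⟨δ, hδ, fun u hu => h (by simpa using hu)⟩

/-- A path running right covers the positive half-axis near the origin. -/
theorem RunsRight.covers {g : ℝ → ℝ × ℝ} (h : RunsRight g) (h0 : g 0 = 0)
    (hc : ∀ᶠ u in 𝓝 (0 : ℝ), ContinuousAt g u) {p : ℝ → Prop} (hp : ∀ᶠ u in 𝓝[>] (0 : ℝ), p u) :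
    ∀ᶠ x in 𝓝[>] (0 : ℝ), ∃ u, 0 < u ∧ p u ∧ g u = (x, 0) := by
  have hall := (h.1.and hp).and (hc.filter_mono nhdsWithin_le_nhds)
  obtain ⟨δ, hδ, hall⟩ := (mem_nhdsGT_iff_exists_Ioc_subset).mp hall
  rw [mem_Ioi] at hδ
  have hd := hall ⟨hδ, le_rfl⟩
  have hcon : ContinuousOn (fun u => (g u).1) (Icc 0 δ) := by
    intro u hu
    rcases eq_or_lt_of_le hu.1 with rfl | hu0
    · exact (continuous_fst.continuousAt.comp hc.self_of_nhds).continuousWithinAt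
    · exact (continuous_fst.continuousAt.comp (hall ⟨hu0, hu.2⟩).2).continuousWithinAt
  -- On `(0, δ]` the second coordinate vanishes, so covering the half-axis is a question about the
  -- first coordinate alone, which takes all values between `0` and its value at `δ`.
  have him := intermediate_value_Icc hδ.le hcon
  filter_upwards [Ioo_mem_nhdsGT hd.1.1.1] with x hx
  obtain ⟨u, hu, hux⟩ := him ⟨by simpa [h0] using hx.1.le, hx.2.le⟩
  have hu0 : 0 < u := by
    rcases eq_or_lt_of_le hu.1 with rfl | h'
    · simp [h0] at hux
      exact absurd hux hx.1.ne
    · exact h'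
  have := hall ⟨hu0, hu.2⟩
  exact ⟨u, hu0, this.1.2, Prod.ext hux this.1.1.2⟩

theorem RunsRight.covers_left {g : ℝ → ℝ × ℝ} (h : RunsRight g) (h0 : g 0 = 0)
    (hc : ∀ᶠ u in 𝓝 (0 : ℝ), ContinuousAt g u) {p : ℝ → Prop} (hp : ∀ᶠ u in 𝓝[<] (0 : ℝ), p u) :
    ∀ᶠ x in 𝓝[<] (0 : ℝ), ∃ u, u < 0 ∧ p u ∧ g u = (x, 0) := by
  have h1 : Tendsto (fun u : ℝ => -u) (𝓝[>] 0) (𝓝[<] 0) := by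
    simpa using tendsto_neg_nhdsGT (a := (0 : ℝ))
  have h2 : Tendsto (fun u : ℝ => -u) (𝓝[<] 0) (𝓝[>] 0) := by
    simpa using tendsto_neg_nhdsLT (a := (0 : ℝ))
  have hn : Tendsto (fun u : ℝ => -u) (𝓝 0) (𝓝 0) := by
    simpa using (continuous_neg (G := ℝ)).tendsto 0
  have := h.reverse.covers (p := fun u => p (-u)) (by simp [h0])
    ((hn.eventually hc).mono fun u hu => (hu.comp (f := fun u : ℝ => -u)
      continuous_neg.continuousAt).neg) (h1.eventually hp)
  filter_upwards [h2.eventually this] with x ⟨u, hu, hpu, he⟩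
  refine ⟨-u, by linarith, hpu, ?_⟩
  rw [neg_eq_iff_eq_neg.mp he]
  simp

/-- A planar germ that is continuous and injective and preserves the oriented axes preserves the
sign of the first coordinate. -/
theorem sign_fst_of_axes {T : ℝ × ℝ → ℝ × ℝ} {N : Set (ℝ × ℝ)} (hN : N ∈ 𝓝 (0 : ℝ × ℝ))
    (hc : ContinuousOn T N) (hi : InjOn T N) (h0 : T 0 = 0)
    (hr : RunsRight fun u => T (u, 0)) (hu : RunsUp fun u => T (0, u)) :
    ∀ᶠ q in 𝓝 (0 : ℝ × ℝ), (0 < q.1 → 0 < (T q).1) ∧ (q.1 < 0 → (T q).1 < 0) := by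
  have hcat : ∀ᶠ q in 𝓝 (0 : ℝ × ℝ), ContinuousAt T q ∧ q ∈ N := by
    filter_upwards [eventually_mem_nhds_iff.mpr hN] with q hq
    exact ⟨hc.continuousAt hq, mem_of_mem_nhds hq⟩
  have hi0 : Tendsto (fun u : ℝ => ((0 : ℝ), u)) (𝓝 0) (𝓝 (0 : ℝ × ℝ)) := by
    have : Continuous (fun u : ℝ => ((0 : ℝ), u)) := by fun_prop
    exact this.tendsto 0
  -- The image of the vertical axis fills the vertical axis near the origin.
  have hcov : ∀ᶠ y in 𝓝 (0 : ℝ), ∃ u, ((0 : ℝ), u) ∈ N ∧ T (0, u) = (0, y) := by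
    have hg := hu.swap
    have hgc : ∀ᶠ u in 𝓝 (0 : ℝ), ContinuousAt (fun u : ℝ => (T (0, u)).swap) u := by
      filter_upwards [hi0.eventually hcat] with u hu
      have h1 : ContinuousAt (fun u : ℝ => T (0, u)) u :=
        ContinuousAt.comp (g := T) (f := fun u : ℝ => ((0 : ℝ), u)) hu.1 (by fun_prop)
      exact continuous_swap.continuousAt.comp h1
    have hp : ∀ᶠ u in 𝓝 (0 : ℝ), ((0 : ℝ), u) ∈ N := (hi0.eventually hcat).mono fun u h => h.2
    have h00 : (T (0, 0)).swap = 0 := by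
      have : T (0, 0) = 0 := h0
      rw [this]; rfl
    refine eventually_nhds_of_sides ⟨0, mem_of_mem_nhds hN, h0⟩ ?_ ?_
    · filter_upwards [hg.covers_left h00 hgc (hp.filter_mono nhdsWithin_le_nhds)]
        with y ⟨u, _, hu, he⟩
      exact ⟨u, hu, by rw [← Prod.swap_swap (T (0, u)), he]; rfl⟩
    · filter_upwards [hg.covers h00 hgc (hp.filter_mono nhdsWithin_le_nhds)]
        with y ⟨u, _, hu, he⟩
      exact ⟨u, hu, by rw [← Prod.swap_swap (T (0, u)), he]; rfl⟩
  have hT2 : Tendsto (fun q => (T q).2) (𝓝 0) (𝓝 0) := by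
    have : ContinuousAt T 0 := hcat.self_of_nhds.1
    have h := continuous_snd.continuousAt.comp this
    simpa [ContinuousAt, Function.comp_def, h0] using h
  -- Injectivity enters here: a point sent to the vertical axis has the same image as some point of
  -- that axis, hence equals it.
  have hne : ∀ᶠ q in 𝓝 (0 : ℝ × ℝ), (T q).1 = 0 → q.1 = 0 := by
    filter_upwards [hT2.eventually hcov, hcat] with q ⟨u, hu, he⟩ hq h1
    have : T q = T (0, u) := by rw [he]; exact Prod.ext h1 rfl
    rw [hi hq.2 hu this]
  have hr' := exists_Ioo_of_eventually (eventually_nhds_of_sides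
    (p := fun u => (0 < u → 0 < (T (u, 0)).1) ∧ (u < 0 → (T (u, 0)).1 < 0)) (by simp)
    (by
      filter_upwards [hr.2, self_mem_nhdsWithin] with u h hu
      exact ⟨fun h' => absurd h' (not_lt.mpr (le_of_lt hu)), fun _ => h.1⟩)
    (by
      filter_upwards [hr.1, self_mem_nhdsWithin] with u h hu
      exact ⟨fun _ => h.1, fun h' => absurd h' (not_lt.mpr (le_of_lt hu))⟩))
  obtain ⟨δ₁, hδ₁, hδ₁'⟩ := hr'
  obtain ⟨δ₂, hδ₂, hδ₂'⟩ := Metric.eventually_nhds_iff_ball.mp (hne.and hcat)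
  set δ := min δ₁ δ₂
  have hδ : 0 < δ := lt_min hδ₁ hδ₂
  -- Applied to the two open half-discs: the first coordinate of `T` maps each onto an interval that
  -- misses `0`, so one point of the horizontal axis, `(δ / 2, 0)` or `(-(δ / 2), 0)`, decides the
  -- sign on the whole half-disc.
  have hconvex : ∀ I : Set (ℝ × ℝ), Convex ℝ I → I ⊆ Metric.ball 0 δ → (∀ q ∈ I, q.1 ≠ 0) →
      IsPreconnected ((fun q => (T q).1) '' I) ∧ (0 : ℝ) ∉ (fun q => (T q).1) '' I := by
    intro I hI hIs hIn
    have hsub : ∀ q ∈ I, q ∈ Metric.ball (0 : ℝ × ℝ) δ₂ := fun q hq =>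
      Metric.ball_subset_ball (min_le_right _ _) (hIs hq)
    refine ⟨hI.isPreconnected.image _ fun q hq => ?_, ?_⟩
    · exact (continuous_fst.continuousAt.comp (hδ₂' q (hsub q hq)).2.1).continuousWithinAt
    · rintro ⟨q, hq, h⟩
      exact hIn q hq ((hδ₂' q (hsub q hq)).1 h)
  have hfst : IsLinearMap ℝ (fun q : ℝ × ℝ => q.1) := ⟨fun _ _ => rfl, fun _ _ => rfl⟩
  have hmem : ∀ u : ℝ, |u| < δ → ((u, 0) : ℝ × ℝ) ∈ Metric.ball (0 : ℝ × ℝ) δ := by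
    intro u hu
    simp [Prod.norm_def, hu]
  filter_upwards [Metric.ball_mem_nhds (0 : ℝ × ℝ) hδ] with q hq
  constructor
  · intro hq1
    obtain ⟨h1, h2⟩ := hconvex ({q | 0 < q.1} ∩ Metric.ball 0 δ)
      ((convex_halfSpace_gt hfst 0).inter (convex_ball 0 δ)) inter_subset_right
      (fun q hq => ne_of_gt hq.1)
    have hδ2 : |δ / 2| < δ := by rw [abs_of_pos (by linarith)]; linarith
    have hpos := (hδ₁' (δ / 2) (hδ2.trans_le (min_le_left _ _))).1 (by linarith)
    by_contra hneg
    exact h2 (h1.Icc_subset ⟨q, ⟨hq1, hq⟩, rfl⟩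
      ⟨(δ / 2, 0), ⟨by simp; linarith, hmem _ hδ2⟩, rfl⟩ ⟨not_lt.mp hneg, hpos.le⟩)
  · intro hq1
    obtain ⟨h1, h2⟩ := hconvex ({q | q.1 < 0} ∩ Metric.ball 0 δ)
      ((convex_halfSpace_lt hfst 0).inter (convex_ball 0 δ)) inter_subset_right
      (fun q hq => ne_of_lt hq.1)
    have hδ2 : |-(δ / 2)| < δ := by rw [abs_neg, abs_of_pos (by linarith)]; linarith
    have hpos := (hδ₁' (-(δ / 2)) (hδ2.trans_le (min_le_left _ _))).2 (by linarith)
    by_contra hneg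
    exact h2 (h1.Icc_subset ⟨(-(δ / 2), 0), ⟨by simp; linarith, hmem _ hδ2⟩, rfl⟩
      ⟨q, ⟨hq1, hq⟩, rfl⟩ ⟨hpos.le, not_lt.mp hneg⟩)

/-- Such a germ preserves both families of opposite quadrants. -/
theorem quadrants_of_axes {T : ℝ × ℝ → ℝ × ℝ} {N : Set (ℝ × ℝ)} (hN : N ∈ 𝓝 (0 : ℝ × ℝ))
    (hc : ContinuousOn T N) (hi : InjOn T N) (h0 : T 0 = 0)
    (hr : RunsRight fun u => T (u, 0)) (hu : RunsUp fun u => T (0, u)) :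
    ∀ᶠ q in 𝓝 (0 : ℝ × ℝ), (q ∈ evenQuadrants → T q ∈ evenQuadrants) ∧
      (q ∈ oddQuadrants → T q ∈ oddQuadrants) := by
  have hs : Tendsto (Prod.swap : ℝ × ℝ → ℝ × ℝ) (𝓝 0) (𝓝 0) := continuous_swap.tendsto 0
  have h1 := sign_fst_of_axes hN hc hi h0 hr hu
  -- Conjugation by the exchange of coordinates gives the statement for the second coordinate.
  have h2 := sign_fst_of_axes (T := fun q => (T q.swap).swap) (N := Prod.swap ⁻¹' N) (hs hN)
    (continuous_swap.comp_continuousOn (hc.comp continuous_swap.continuousOn fun _ h => h))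
    (fun a ha b hb h => Prod.swap_injective (hi ha hb (Prod.swap_injective h)))
    (by simp [h0]) hu.swap hr.swap
  filter_upwards [h1, hs.eventually h2] with q ⟨ha, hb⟩ ⟨hc, hd⟩
  simp only [Prod.swap_swap, Prod.fst_swap] at hc hd
  constructor
  · intro hq
    rcases pos_and_pos_or_neg_and_neg_of_mul_pos (show 0 < q.1 * q.2 from hq) with ⟨h, h'⟩ | ⟨h, h'⟩
    · exact mul_pos (ha h) (hc h')
    · exact mul_pos_of_neg_of_neg (hb h) (hd h')
  · intro hq
    rcases mul_neg_iff.mp (show q.1 * q.2 < 0 from hq) with ⟨h, h'⟩ | ⟨h, h'⟩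
    · exact mul_neg_of_pos_of_neg (ha h) (hd h')
    · exact mul_neg_of_neg_of_pos (hb h) (hc h')

/-! ### Signs of crossings -/

/-- The path `α'` follows the path `α` near time `0`, up to reparametrization. -/
structure Follows {Y : Type*} (α' α : ℝ → Y) : Prop where
  zero : α' 0 = α 0
  right : Tendsto α' (𝓝[>] 0) (map α (𝓝[>] 0))
  left : Tendsto α' (𝓝[<] 0) (map α (𝓝[<] 0))

theorem Follows.comp_left {Y Z : Type*} {α' α : ℝ → Y} (h : Follows α' α) (f : Y → Z) :
    Follows (fun u => f (α' u)) fun u => f (α u) where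
  zero := congrArg f h.zero
  right := by
    have := (tendsto_map (f := f)).comp h.right
    rwa [map_map] at this
  left := by
    have := (tendsto_map (f := f)).comp h.left
    rwa [map_map] at this

theorem Follows.of_comp {Y : Type*} {α' α : ℝ → Y} (h : ℝ → ℝ) (h0 : h 0 = 0)
    (hr : Tendsto h (𝓝[>] 0) (𝓝[>] 0)) (hl : Tendsto h (𝓝[<] 0) (𝓝[<] 0))
    (he : ∀ᶠ u in 𝓝 0, α' u = α (h u)) : Follows α' α where
  zero := by rw [he.self_of_nhds, h0]
  right := (tendsto_map.comp hr).congr'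
    ((he.filter_mono nhdsWithin_le_nhds).mono fun _ h => h.symm)
  left := (tendsto_map.comp hl).congr'
    ((he.filter_mono nhdsWithin_le_nhds).mono fun _ h => h.symm)

theorem tendsto_nhds_sides_of_strictMono {h : ℝ → ℝ} (hm : StrictMono h) (hc : ContinuousAt h 0)
    (h0 : h 0 = 0) : Tendsto h (𝓝[>] 0) (𝓝[>] 0) ∧ Tendsto h (𝓝[<] 0) (𝓝[<] 0) := by
  have hc' : Tendsto h (𝓝 0) (𝓝 0) := by simpa [ContinuousAt, h0] using hc
  constructor
  · refine tendsto_nhdsWithin_of_tendsto_nhds_of_eventually_within _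
      (hc'.mono_left nhdsWithin_le_nhds) ?_
    filter_upwards [self_mem_nhdsWithin] with u hu
    simpa [h0] using hm hu
  · refine tendsto_nhdsWithin_of_tendsto_nhds_of_eventually_within _
      (hc'.mono_left nhdsWithin_le_nhds) ?_
    filter_upwards [self_mem_nhdsWithin] with u hu
    simpa [h0] using hm hu

theorem Follows.of_strictMono {Y : Type*} {α' α : ℝ → Y} {h : ℝ → ℝ} (hm : StrictMono h)
    (hc : ContinuousAt h 0) (h0 : h 0 = 0) (he : ∀ᶠ u in 𝓝 0, α' u = α (h u)) :
    Follows α' α :=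
  .of_comp h h0 (tendsto_nhds_sides_of_strictMono hm hc h0).1
    (tendsto_nhds_sides_of_strictMono hm hc h0).2 he

theorem Follows.of_eventuallyEq {Y : Type*} {α' α : ℝ → Y} (he : α' =ᶠ[𝓝 0] α) :
    Follows α' α :=
  .of_strictMono strictMono_id continuousAt_id rfl he

/-- Convergence to the filter `map α (𝓝[>] 0)` says precisely that whatever holds along `α` just
after time `0` holds along `α'`. No reparametrization has to be exhibited, which suits
`IsCrossingChart.symm_follows`, where the matching times come from the intermediate value theorem.
-/
theorem Follows.eventually_right {Y : Type*} {α' α : ℝ → Y} (h : Follows α' α) {p : Y → Prop}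
    (hp : ∀ᶠ u in 𝓝[>] 0, p (α u)) : ∀ᶠ u in 𝓝[>] 0, p (α' u) :=
  h.right.eventually (eventually_map.mpr hp)

theorem Follows.eventually_left {Y : Type*} {α' α : ℝ → Y} (h : Follows α' α) {p : Y → Prop}
    (hp : ∀ᶠ u in 𝓝[<] 0, p (α u)) : ∀ᶠ u in 𝓝[<] 0, p (α' u) :=
  h.left.eventually (eventually_map.mpr hp)

theorem Follows.runsRight {g' g : ℝ → ℝ × ℝ} (h : Follows g' g) (hg : RunsRight g) :
    RunsRight g' :=
  ⟨h.eventually_right (p := fun q => 0 < q.1 ∧ q.2 = 0) hg.1,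
    h.eventually_left (p := fun q => q.1 < 0 ∧ q.2 = 0) hg.2⟩

theorem Follows.runsUp {g' g : ℝ → ℝ × ℝ} (h : Follows g' g) (hg : RunsUp g) : RunsUp g' :=
  ⟨h.eventually_right (p := fun q => q.1 = 0 ∧ 0 < q.2) hg.1,
    h.eventually_left (p := fun q => q.1 = 0 ∧ q.2 < 0) hg.2⟩

theorem IsCrossingChart.of_follows {φ : OpenPartialHomeomorph X (ℝ × ℝ)} {α β α' β' : ℝ → X}
    (h : IsCrossingChart φ α β) (hα : Follows α' α) (hβ : Follows β' β) :
    IsCrossingChart φ α' β' where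
  mem_source := hα.zero ▸ h.mem_source
  eq_center := hα.zero.trans (h.eq_center.trans hβ.zero.symm)
  map_center := hα.zero ▸ h.map_center
  right := (hα.comp_left φ).runsRight h.right
  up := (hβ.comp_left φ).runsUp h.up

/-- Exchanging the coordinates exchanges the roles of the two branches. -/
theorem IsCrossingChart.swap {φ : OpenPartialHomeomorph X (ℝ × ℝ)} {α β : ℝ → X}
    (h : IsCrossingChart φ α β) :
    IsCrossingChart (φ.transHomeomorph (Homeomorph.prodComm ℝ ℝ)) β α where
  mem_source := by simpa [← h.eq_center] using h.mem_source
  eq_center := h.eq_center.symm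
  map_center := by simpa [← h.eq_center] using congrArg Prod.swap h.map_center
  right := h.up.swap
  up := h.right.swap

/-- The inverse of a crossing chart draws the axes along the two branches. -/
theorem IsCrossingChart.symm_follows {φ : OpenPartialHomeomorph X (ℝ × ℝ)} {α β : ℝ → X}
    (h : IsCrossingChart φ α β) (hα : Continuous α) :
    Follows (fun u => φ.symm (u, 0)) α := by
  have hs : ∀ᶠ u in 𝓝 (0 : ℝ), α u ∈ φ.source :=
    hα.continuousAt.eventually (φ.open_source.mem_nhds h.mem_source)
  have hc : ∀ᶠ u in 𝓝 (0 : ℝ), ContinuousAt (fun u => φ (α u)) u := hs.mono fun u hu =>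
    ContinuousAt.comp (g := φ) (φ.continuousAt hu) hα.continuousAt
  refine ⟨?_, ?_, ?_⟩
  · have : φ.symm (φ (α 0)) = α 0 := φ.left_inv h.mem_source
    rwa [h.map_center] at this
  · intro S hS
    rw [mem_map]
    -- A point `(x, 0)` of the half-axis is `φ (α u)` for a time `u` that can be required to satisfy
    -- any property valid for small positive times, in particular `α u ∈ S`.
    filter_upwards [h.right.covers h.map_center hc
      ((hs.filter_mono nhdsWithin_le_nhds).and (mem_map.mp hS))] with x ⟨u, _, ⟨h1, h2⟩, he⟩
    rw [mem_preimage, ← he, φ.left_inv h1]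
    exact h2
  · intro S hS
    rw [mem_map]
    filter_upwards [h.right.covers_left h.map_center hc
      ((hs.filter_mono nhdsWithin_le_nhds).and (mem_map.mp hS))] with x ⟨u, _, ⟨h1, h2⟩, he⟩
    rw [mem_preimage, ← he, φ.left_inv h1]
    exact h2

/-! ### The sign of a crossing in a link -/

namespace OrientedLink

theorem branch_continuous (L : OrientedLink X n) (P : Fin n × AddCircle (1 : ℝ)) :
    Continuous (L.branch P) :=
  (L.curve P.1).continuous.comp (continuous_const.add (AddCircle.continuous_mk' 1))

@[simp]
theorem branch_zero (L : OrientedLink X n) (P : Fin n × AddCircle (1 : ℝ)) :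
    L.branch P 0 = L.pt P := by
  simp [branch, pt]

/-- The definition of `sign` consults only the set of charts that straighten the two branches and
the germ of the dotted set at the crossing. -/
theorem sign_eq_of_charts {m : ℕ} {L : OrientedLink X n} {L' : OrientedLink X m}
    {P Q : Fin n × AddCircle (1 : ℝ)} {P' Q' : Fin m × AddCircle (1 : ℝ)}
    (h : ∀ φ : OpenPartialHomeomorph X (ℝ × ℝ),
      IsCrossingChart φ (L.branch P) (L.branch Q) ↔ IsCrossingChart φ (L'.branch P') (L'.branch Q'))
    (hpt : L.pt P = L'.pt P') (hd : SameGerm (L.pt P) L'.dotted L.dotted) :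
    L'.sign P' Q' = L.sign P Q := by
  have : ∀ A, SameGerm (L'.pt P') L'.dotted A ↔ SameGerm (L.pt P) L.dotted A := by
    intro A
    rw [← hpt]
    constructor
    · intro h'
      filter_upwards [h', hd] with y h1 h2
      rw [← h1, h2]
    · intro h'
      filter_upwards [h', hd] with y h1 h2
      rw [← h1, h2]
  unfold sign
  congr 1
  simp only [h, this]

theorem sign_eq_of_follows {m : ℕ} {L : OrientedLink X n} {L' : OrientedLink X m}
    {P Q : Fin n × AddCircle (1 : ℝ)} {P' Q' : Fin m × AddCircle (1 : ℝ)}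
    (h₁ : Follows (L.branch P) (L'.branch P')) (h₂ : Follows (L'.branch P') (L.branch P))
    (h₃ : Follows (L.branch Q) (L'.branch Q')) (h₄ : Follows (L'.branch Q') (L.branch Q))
    (hd : SameGerm (L.pt P) L'.dotted L.dotted) :
    L'.sign P' Q' = L.sign P Q :=
  sign_eq_of_charts (fun _ => ⟨fun h => h.of_follows h₂ h₄, fun h => h.of_follows h₁ h₃⟩)
    (by simpa using h₁.zero) hd

theorem sign_eq_one_or (L : OrientedLink X n) (P Q : Fin n × AddCircle (1 : ℝ)) :
    L.sign P Q = 1 ∨ L.sign P Q = -1 := by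
  unfold sign
  split_ifs <;> simp

/-- If `E` draws the axes of the plane along the branches of a crossing, then the position of the
dots can be read off from any points of the quadrants close to the origin. -/
theorem sign_of_parametrization (L : OrientedLink X n) {P Q : Fin n × AddCircle (1 : ℝ)}
    (hPQ : P ≠ Q) {E : ℝ × ℝ → X} {N : Set (ℝ × ℝ)}
    (hN : N ∈ 𝓝 (0 : ℝ × ℝ)) (hc : ContinuousOn E N) (hi : InjOn E N)
    (h₁ : Follows (fun u => E (u, 0)) (L.branch P)) (h₂ : Follows (fun u => E (0, u)) (L.branch Q)) :
    ((∃ᶠ q in 𝓝 0, q ∈ evenQuadrants ∧ E q ∈ L.dotted) → L.sign P Q = 1) ∧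
      ((∃ᶠ q in 𝓝 0, q ∈ oddQuadrants ∧ E q ∈ L.dotted) → L.sign P Q = -1) := by
  have hE0 : E 0 = L.pt P := h₁.zero.trans (L.branch_zero P)
  have hE0' : E 0 = L.pt Q := h₂.zero.trans (L.branch_zero Q)
  have hcE : ContinuousAt E 0 := hc.continuousAt hN
  -- For every crossing chart `φ`, the composite `φ ∘ E` is a germ preserving the oriented axes, so
  -- `E` sees the quadrants as `φ` does.
  have key : ∀ φ : OpenPartialHomeomorph X (ℝ × ℝ),
      IsCrossingChart φ (L.branch P) (L.branch Q) →
      ∀ᶠ q in 𝓝 0, (q ∈ evenQuadrants → φ (E q) ∈ evenQuadrants) ∧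
        (q ∈ oddQuadrants → φ (E q) ∈ oddQuadrants) := by
    intro φ hφ
    have hs : L.pt P ∈ φ.source := by simpa using hφ.mem_source
    have hm : E ⁻¹' φ.source ∈ 𝓝 (0 : ℝ × ℝ) :=
      hcE (φ.open_source.mem_nhds (hE0 ▸ hs))
    refine quadrants_of_axes (inter_mem hN hm) ?_ ?_ ?_ ((h₁.comp_left φ).runsRight hφ.right)
      ((h₂.comp_left φ).runsUp hφ.up)
    · exact φ.continuousOn.comp (hc.mono inter_subset_left) fun _ h => h.2
    · exact fun a ha b hb h => hi ha.1 hb.1 (φ.injOn ha.2 hb.2 h)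
    · simpa [hE0] using hφ.map_center
  have hdisj : ∀ p : ℝ × ℝ, p ∈ evenQuadrants → p ∈ oddQuadrants → False := by
    intro p h1 h2
    exact lt_asymm (show 0 < p.1 * p.2 from h1) h2
  have hgerm : ∀ A, SameGerm (L.pt P) L.dotted A → ∀ᶠ q in 𝓝 0, (E q ∈ L.dotted ↔ E q ∈ A) := by
    intro A hA
    have : Tendsto E (𝓝 0) (𝓝 (L.pt P)) := hE0 ▸ hcE
    exact this.eventually hA
  obtain ⟨φ, hφ, hd⟩ := L.crossing P Q hPQ (hE0.symm.trans hE0')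
  constructor
  · intro hf
    rcases hd with hd | hd
    · exact if_pos ⟨φ, hφ, hd⟩
    · obtain ⟨q, ⟨h1, h2⟩, h3, h4⟩ := (hf.and_eventually ((key φ hφ).and (hgerm _ hd))).exists
      exact (hdisj _ (h3.1 h1) (h4.mp h2)).elim
  · intro hf
    -- The value `-1` requires that all charts fail, so an arbitrary chart `ψ` with dots in the even
    -- quadrants has to be refuted.
    refine if_neg ?_
    rintro ⟨ψ, hψ, hd⟩
    obtain ⟨q, ⟨h1, h2⟩, h3, h4⟩ := (hf.and_eventually ((key ψ hψ).and (hgerm _ hd))).exists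
    exact hdisj _ (h4.mp h2) (h3.2 h1)

/-- A point with a neighborhood missing one family of quadrants lies in the other family, and the
origin lies in neither. -/
theorem frequently_quadrants :
    (∃ᶠ q in 𝓝 (0 : ℝ × ℝ), q ∈ evenQuadrants) ∧ ∃ᶠ q in 𝓝 (0 : ℝ × ℝ), q ∈ oddQuadrants := by
  constructor
  · intro h
    have := (forall_notMem_even_iff 0).mp h
    simp [oddQuadrants] at this
  · intro h
    have := (forall_notMem_odd_iff 0).mp h
    simp [evenQuadrants] at this

/-- Since `-1` is the default value of `sign`, one chart with dots in the odd quadrants is not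
enough by definition: another chart might see them in the even ones. The inverse of `φ` is a
parametrization along the branches, and `sign_of_parametrization` excludes this. -/
theorem sign_eq_neg_one {L : OrientedLink X n} {P Q : Fin n × AddCircle (1 : ℝ)} (hPQ : P ≠ Q)
    {φ : OpenPartialHomeomorph X (ℝ × ℝ)} (hφ : IsCrossingChart φ (L.branch P) (L.branch Q))
    (hd : SameGerm (L.pt P) L.dotted (φ ⁻¹' oddQuadrants)) : L.sign P Q = -1 := by
  have hs : L.pt P ∈ φ.source := by simpa using hφ.mem_source
  have h0 : φ (L.pt P) = 0 := by simpa using hφ.map_center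
  have ht : (0 : ℝ × ℝ) ∈ φ.target := h0 ▸ φ.map_source hs
  have h0' : φ.symm 0 = L.pt P := by rw [← h0, φ.left_inv hs]
  refine (L.sign_of_parametrization hPQ (φ.open_target.mem_nhds ht) φ.symm.continuousOn
    φ.symm.injOn (hφ.symm_follows (L.branch_continuous P))
    (hφ.swap.symm_follows (L.branch_continuous Q))).2 ?_
  have hcs : Tendsto φ.symm (𝓝 0) (𝓝 (L.pt P)) := h0' ▸ φ.symm.continuousAt ht
  refine (frequently_quadrants.2.and_eventually
    ((hcs.eventually hd).and (φ.open_target.mem_nhds ht))).mono ?_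
  rintro q ⟨h1, h2, h3⟩
  refine ⟨h1, h2.mpr ?_⟩
  rwa [mem_preimage, φ.right_inv h3]

/-- Exchanging the coordinates of a chart exchanges the branches and fixes the product of the
coordinates, hence the even quadrants. As only two values occur, it suffices to transport the value
`1` both ways. -/
theorem sign_comm (L : OrientedLink X n) (P Q : Fin n × AddCircle (1 : ℝ)) :
    L.sign P Q = L.sign Q P := by
  have : ∀ P Q, L.sign P Q = 1 → L.sign Q P = 1 := by
    intro P Q h
    have hex : ∃ φ : OpenPartialHomeomorph X (ℝ × ℝ), IsCrossingChart φ (L.branch P) (L.branch Q) ∧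
        SameGerm (L.pt P) L.dotted (φ ⁻¹' evenQuadrants) := by
      by_contra hn
      rw [sign, if_neg hn] at h
      norm_num at h
    obtain ⟨φ, hφ, hd⟩ := hex
    refine if_pos ⟨_, hφ.swap, ?_⟩
    have : L.pt P = L.pt Q := by simpa using hφ.eq_center
    rw [← this]
    filter_upwards [hd] with y hy
    rw [hy]
    simp [evenQuadrants, mul_comm]
  rcases L.sign_eq_one_or P Q with h | h <;> rcases L.sign_eq_one_or Q P with h' | h'
  · rw [h, h']
  · have := this _ _ h; omega
  · have := this _ _ h'; omega
  · rw [h, h']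

theorem mem_crossingPoints {L : OrientedLink X n} {P Q : Fin n × AddCircle (1 : ℝ)} (hPQ : P ≠ Q)
    (h : L.pt P = L.pt Q) : L.pt P ∈ L.crossingPoints := ⟨P, Q, hPQ, rfl, h.symm⟩

/-! ### Parity, mirror image, reversal -/

theorem lk_modEq_ncard (L : OrientedLink X 2) :
    L.lk ≡ (L.mixedCrossings.ncard : ℤ) [ZMOD 2] := by
  rw [Set.ncard_eq_toFinset_card _ L.finite_mixedCrossings, lk, Finset.card_eq_sum_ones]
  push_cast
  refine Int.ModEq.sum fun c _ => ?_
  rcases L.sign_eq_one_or (0, c.1) (1, c.2) with h | h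
  · rw [h]
  · rw [h]; decide

/-- The branches are unchanged, so the same chart serves both links; passing to the interior of the
complement exchanges the two families of quadrants. -/
theorem lk_mirror (L : OrientedLink X 2) : L.mirror.lk = -L.lk := by
  have hm : L.mirror.finite_mixedCrossings.toFinset = L.finite_mixedCrossings.toFinset := by
    ext c; simp [mixedCrossings, mirror, pt]
  rw [lk, lk, hm, ← Finset.sum_neg_distrib]
  refine Finset.sum_congr rfl fun c hc => ?_
  have hne : ((0 : Fin 2), c.1) ≠ ((1 : Fin 2), c.2) := by simp
  have hpt : L.pt (0, c.1) = L.pt (1, c.2) := by simpa [mixedCrossings] using hc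
  obtain ⟨φ, hφ, hd⟩ := L.crossing _ _ hne hpt
  have hs : L.pt (0, c.1) ∈ φ.source := by simpa [pt] using hφ.mem_source
  rcases hd with hd | hd
  · have h1 : L.sign (0, c.1) (1, c.2) = 1 := if_pos ⟨φ, hφ, hd⟩
    have h2 : L.mirror.sign (0, c.1) (1, c.2) = -1 := sign_eq_neg_one hne (φ := φ) hφ
      (sameGerm_interior_compl hs forall_notMem_even_iff hd)
    rw [h1, h2]
  · have h1 : L.sign (0, c.1) (1, c.2) = -1 := sign_eq_neg_one hne hφ hd
    have h2 : L.mirror.sign (0, c.1) (1, c.2) = 1 := if_pos ⟨φ, hφ,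
      sameGerm_interior_compl hs forall_notMem_odd_iff hd⟩
    rw [h1, h2, neg_neg]

theorem reverse_branch (L : OrientedLink X n) (P : Fin n × AddCircle (1 : ℝ)) :
    L.reverse.branch P = fun u => L.branch (negParam P) (-u) := by
  funext u
  simp [branch, reverse, negParam, add_comm]

/-- The chart `-φ` straightens the reversed branches, and a half turn maps each pair of opposite
quadrants to itself. -/
theorem sign_reverse (L : OrientedLink X n) {P Q : Fin n × AddCircle (1 : ℝ)} (hPQ : P ≠ Q)
    (h : L.pt (negParam P) = L.pt (negParam Q)) :
    L.reverse.sign P Q = L.sign (negParam P) (negParam Q) := by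
  have hne : negParam P ≠ negParam Q := fun h => hPQ (negParam_injective h)
  obtain ⟨φ, hφ, hd⟩ := L.crossing _ _ hne h
  have hφ' := IsCrossingChart.reverse hφ
  have hr : IsCrossingChart (φ.transHomeomorph (Homeomorph.neg (ℝ × ℝ))) (L.reverse.branch P)
      (L.reverse.branch Q) := by
    rw [reverse_branch, reverse_branch]; exact hφ'
  rcases hd with hd | hd
  · have h1 : L.sign (negParam P) (negParam Q) = 1 := if_pos ⟨φ, hφ, hd⟩
    rw [h1]
    refine if_pos ⟨_, hr, ?_⟩
    filter_upwards [hd] with y hy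
    rw [show L.reverse.dotted = L.dotted from rfl, hy]
    simp [evenQuadrants]
  · have h1 : L.sign (negParam P) (negParam Q) = -1 := sign_eq_neg_one hne hφ hd
    rw [h1]
    refine sign_eq_neg_one hPQ hr ?_
    filter_upwards [hd] with y hy
    rw [show L.reverse.dotted = L.dotted from rfl, hy]
    simp [oddQuadrants]

theorem lk_reverse (L : OrientedLink X 2) : L.reverse.lk = L.lk := by
  refine Finset.sum_nbij' (fun c => (-c.1, -c.2)) (fun c => (-c.1, -c.2)) ?_ ?_ ?_ ?_ ?_
  · intro c hc
    simpa [mixedCrossings, pt, reverse] using hc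
  · intro c hc
    simpa [mixedCrossings, pt, reverse] using hc
  · simp
  · simp
  · intro c hc
    have hpt : L.pt (negParam (0, c.1)) = L.pt (negParam (1, c.2)) := by
      simpa [mixedCrossings, pt, reverse, negParam] using hc
    exact L.sign_reverse (by simp) hpt

end OrientedLink

/-! ### Reparametrizations and ambient isotopies -/

/-- The self-map of the circle induced by an increasing homeomorphism of the line that commutes
with the unit translation. -/
def circleMap (h : ℝ ≃o ℝ) (hh : ∀ u, h (u + 1) = h u + 1) :
    AddCircle (1 : ℝ) → AddCircle (1 : ℝ) :=
  Function.Periodic.lift (f := fun u => ((h u : ℝ) : AddCircle (1 : ℝ))) (c := 1) fun u => by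
    simp only [hh, AddCircle.coe_add, AddCircle.coe_period, add_zero]

theorem circleMap_coe (h : ℝ ≃o ℝ) (hh : ∀ u, h (u + 1) = h u + 1) (u : ℝ) :
    circleMap h hh (u : AddCircle (1 : ℝ)) = (h u : ℝ) := rfl

theorem symm_add_one {h : ℝ ≃o ℝ} (hh : ∀ u, h (u + 1) = h u + 1) (u : ℝ) :
    h.symm (u + 1) = h.symm u + 1 := by
  rw [OrderIso.symm_apply_eq, hh, OrderIso.apply_symm_apply]

theorem circleMap_symm_circleMap (h : ℝ ≃o ℝ) (hh : ∀ u, h (u + 1) = h u + 1)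
    (p : AddCircle (1 : ℝ)) : circleMap h.symm (symm_add_one hh) (circleMap h hh p) = p := by
  induction p using QuotientAddGroup.induction_on with
  | H u =>
    rw [circleMap_coe, circleMap_coe, OrderIso.symm_apply_apply]

theorem circleMap_circleMap_symm (h : ℝ ≃o ℝ) (hh : ∀ u, h (u + 1) = h u + 1)
    (p : AddCircle (1 : ℝ)) : circleMap h hh (circleMap h.symm (symm_add_one hh) p) = p := by
  induction p using QuotientAddGroup.induction_on with
  | H u =>
    rw [circleMap_coe, circleMap_coe, OrderIso.apply_symm_apply]

namespace OrientedLink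

/-- Near the parameter `x` the change of time, recentered at `0`, is `u ↦ h (x + u) - h x`. -/
theorem follows_of_reparametrization {L L' : OrientedLink X n} {i j : Fin n} {h : ℝ ≃o ℝ}
    (hh : ∀ u, h (u + 1) = h u + 1)
    (he : ∀ u : ℝ, L'.curve j (u : AddCircle (1 : ℝ)) = L.curve i (h u : ℝ))
    (p : AddCircle (1 : ℝ)) :
    Follows (L'.branch (j, p)) (L.branch (i, circleMap h hh p)) := by
  induction p using QuotientAddGroup.induction_on with
  | H x =>
    refine .of_strictMono (h := fun u => h (x + u) - h x) (fun a b hab => ?_) ?_ (by simp)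
      (.of_forall fun u => ?_)
    · have := h.strictMono (add_lt_add_right hab x)
      linarith
    · have : Continuous fun u => h (x + u) - h x :=
        (h.continuous.comp (continuous_const.add continuous_id)).sub continuous_const
      exact this.continuousAt
    · change L'.curve j ((x : AddCircle (1 : ℝ)) + (u : AddCircle (1 : ℝ))) =
        L.curve i (circleMap h hh (x : AddCircle (1 : ℝ)) + ((h (x + u) - h x : ℝ) : AddCircle (1 : ℝ)))
      rw [← AddCircle.coe_add, he, circleMap_coe, ← AddCircle.coe_add, add_sub_cancel]

/-- The reparametrizations give a bijection between the mixed crossings that preserves signs. The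
permutation `σ` of two components is the identity or the exchange; in the latter case symmetry of
the sign is used as well. -/
theorem lk_eq_of_sameLink {L L' : OrientedLink X 2} (h : SameLink L L') : L'.lk = L.lk := by
  obtain ⟨⟨σ, H, hH, he⟩, hd⟩ := h
  have hpt : ∀ i p, L'.pt (σ i, p) = L.pt (i, circleMap (H i) (hH i) p) := by
    intro i p
    have := (follows_of_reparametrization (hH i) (he i) p).zero
    simpa using this
  have hfol := fun i => follows_of_reparametrization (L := L) (L' := L') (hH i) (he i)
  -- Both directions are needed, since the two pairs of branches must have the same crossing charts.
  -- This one comes from the inverse reparametrization.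
  have hfol' : ∀ i p, Follows (L.branch (i, circleMap (H i) (hH i) p)) (L'.branch (σ i, p)) := by
    intro i p
    have := follows_of_reparametrization (L := L') (L' := L) (i := σ i) (j := i)
      (symm_add_one (hH i)) (fun u => by rw [he, OrderIso.apply_symm_apply])
      (circleMap (H i) (hH i) p)
    rwa [circleMap_symm_circleMap] at this
  have hsign : ∀ i j p q, i ≠ j → L'.pt (σ i, p) = L'.pt (σ j, q) →
      L'.sign (σ i, p) (σ j, q) =
        L.sign (i, circleMap (H i) (hH i) p) (j, circleMap (H j) (hH j) q) := by
    intro i j p q hij hpq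
    refine sign_eq_of_follows (hfol' i p) (hfol i p) (hfol' j q) (hfol j q) (hd _ ?_)
    exact mem_crossingPoints (Q := (j, circleMap (H j) (hH j) q)) (by simp [hij]) (by rw [← hpt, ← hpt, hpq])
  have h01 : (0 : Fin 2) ≠ 1 := by decide
  have hσ : (σ 0 = 0 ∧ σ 1 = 1) ∨ (σ 0 = 1 ∧ σ 1 = 0) := by
    have := σ.injective.ne h01
    omega
  rcases hσ with ⟨h0, h1⟩ | ⟨h0, h1⟩
  · refine Finset.sum_nbij'
      (fun c => (circleMap (H 0) (hH 0) c.1, circleMap (H 1) (hH 1) c.2))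
      (fun c => (circleMap (H 0).symm (symm_add_one (hH 0)) c.1,
        circleMap (H 1).symm (symm_add_one (hH 1)) c.2)) ?_ ?_ ?_ ?_ ?_
    · intro c hc
      have hc' : L'.pt (0, c.1) = L'.pt (1, c.2) := by simpa [mixedCrossings] using hc
      have a := hpt 0 c.1
      have b := hpt 1 c.2
      rw [h0] at a
      rw [h1] at b
      simp [mixedCrossings, ← a, ← b, hc']
    · intro c hc
      have hc' : L.pt (0, c.1) = L.pt (1, c.2) := by simpa [mixedCrossings] using hc
      have a := hpt 0 (circleMap (H 0).symm (symm_add_one (hH 0)) c.1)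
      have b := hpt 1 (circleMap (H 1).symm (symm_add_one (hH 1)) c.2)
      rw [h0, circleMap_circleMap_symm] at a
      rw [h1, circleMap_circleMap_symm] at b
      simp [mixedCrossings, a, b, hc']
    · simp [circleMap_symm_circleMap]
    · simp [circleMap_circleMap_symm]
    · intro c hc
      have hc' : L'.pt (0, c.1) = L'.pt (1, c.2) := by simpa [mixedCrossings] using hc
      have := hsign 0 1 c.1 c.2 h01
      rw [h0, h1] at this
      exact this hc'
  -- Here `σ` exchanges the components, so the two entries of a crossing change places.
  · refine Finset.sum_nbij'
      (fun c => (circleMap (H 0) (hH 0) c.2, circleMap (H 1) (hH 1) c.1))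
      (fun c => (circleMap (H 1).symm (symm_add_one (hH 1)) c.2,
        circleMap (H 0).symm (symm_add_one (hH 0)) c.1)) ?_ ?_ ?_ ?_ ?_
    · intro c hc
      have hc' : L'.pt (0, c.1) = L'.pt (1, c.2) := by simpa [mixedCrossings] using hc
      have a := hpt 0 c.2
      have b := hpt 1 c.1
      rw [h0] at a
      rw [h1] at b
      simp [mixedCrossings, ← a, ← b, hc']
    · intro c hc
      have hc' : L.pt (0, c.1) = L.pt (1, c.2) := by simpa [mixedCrossings] using hc
      have a := hpt 0 (circleMap (H 0).symm (symm_add_one (hH 0)) c.1)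
      have b := hpt 1 (circleMap (H 1).symm (symm_add_one (hH 1)) c.2)
      rw [h0, circleMap_circleMap_symm] at a
      rw [h1, circleMap_circleMap_symm] at b
      simp [mixedCrossings, a, b, hc']
    · simp [circleMap_symm_circleMap]
    · simp [circleMap_circleMap_symm]
    · intro c hc
      have hc' : L'.pt (0, c.1) = L'.pt (1, c.2) := by simpa [mixedCrossings] using hc
      have := hsign 0 1 c.2 c.1 h01
      rw [h0, h1] at this
      rw [L'.sign_comm]
      exact this hc'.symm

/-- Only the final homeomorphism `g` matters: it carries crossings to crossings, and `φ ∘ g⁻¹` is a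
crossing chart that sees the new dots where `φ` sees the old ones. The sign refers to no orientation
of `X` that `g` would have to respect. -/
theorem lk_eq_of_ambientIsotopic {L L' : OrientedLink X 2} (h : AmbientIsotopic L L') :
    L'.lk = L.lk := by
  obtain ⟨H, -, -, he, hd⟩ := h
  set g := H 1
  have hpt : ∀ P, L'.pt P = g (L.pt P) := fun P => he P.1 P.2
  have hm : L'.mixedCrossings = L.mixedCrossings := by
    ext c
    simp [mixedCrossings, hpt]
  refine Finset.sum_congr (by simp [hm]) fun c hc => ?_
  have hne : ((0 : Fin 2), c.1) ≠ ((1 : Fin 2), c.2) := by simp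
  have hc' : L.pt (0, c.1) = L.pt (1, c.2) :=
    L.finite_mixedCrossings.mem_toFinset.mp hc
  obtain ⟨φ, hφ, hφd⟩ := L.crossing _ _ hne hc'
  have hb : ∀ P, L'.branch P = fun u => g (L.branch P u) := fun P => funext fun u => he _ _
  have hchart : IsCrossingChart (g.symm.transOpenPartialHomeomorph φ) (L'.branch (0, c.1))
      (L'.branch (1, c.2)) := by
    rw [hb, hb]
    exact ⟨by simpa [branch] using hφ.mem_source, congrArg g hφ.eq_center,
      by simpa [branch] using hφ.map_center, by simpa [branch] using hφ.right,
      by simpa [branch] using hφ.up⟩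
  have hgerm : ∀ A : Set (ℝ × ℝ), SameGerm (L.pt (0, c.1)) L.dotted (φ ⁻¹' A) →
      SameGerm (L'.pt (0, c.1)) L'.dotted (g.symm.transOpenPartialHomeomorph φ ⁻¹' A) := by
    intro A hA
    have h1 := hd _ (mem_crossingPoints hne (by rw [hpt, hpt, hc']))
    have h2 : Tendsto g.symm (𝓝 (L'.pt (0, c.1))) (𝓝 (L.pt (0, c.1))) := by
      have := g.symm.continuous.tendsto (L'.pt (0, c.1))
      rwa [hpt, g.symm_apply_apply, ← hpt] at this
    filter_upwards [h1, h2.eventually hA] with y hy1 hy2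
    rw [hy1, mem_preimage, Homeomorph.transOpenPartialHomeomorph_apply, Function.comp_apply,
      ← mem_preimage (f := φ), ← hy2]
    constructor
    · rintro ⟨x, hx, rfl⟩
      simpa using hx
    · intro h
      exact ⟨_, h, g.apply_symm_apply y⟩
  rcases hφd with hφd | hφd
  · have h1 : L.sign (0, c.1) (1, c.2) = 1 := if_pos ⟨φ, hφ, hφd⟩
    rw [h1]
    exact if_pos ⟨_, hchart, hgerm _ hφd⟩
  · rw [sign_eq_neg_one hne hφ hφd]
    exact sign_eq_neg_one hne hchart (hgerm _ hφd)

/-! ### Links that agree outside a set of parameters -/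

open Classical in
/-- The contribution to the linking number of the crossings with parameter in `A` on the first
component. -/
def lkOn (L : OrientedLink X 2) (A : Set (Fin 2 × AddCircle (1 : ℝ))) : ℤ :=
  ∑ c ∈ L.finite_mixedCrossings.toFinset with (0, c.1) ∈ A, L.sign (0, c.1) (1, c.2)

/-- No crossing of the two components has a parameter in `A` and the other one outside `A`. -/
def Separates (L : OrientedLink X 2) (A : Set (Fin 2 × AddCircle (1 : ℝ))) : Prop :=
  ∀ P Q, P ∈ A → L.pt P = L.pt Q → Q ∈ A

/-- Closedness of `A` turns equality of points into equality of germs: the parameters close to `P`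
avoid `A` too. -/
theorem branch_eventuallyEq {L L' : OrientedLink X n} {A : Set (Fin n × AddCircle (1 : ℝ))}
    (hA : IsClosed A) (hpt : ∀ P, P ∉ A → L'.pt P = L.pt P) {P : Fin n × AddCircle (1 : ℝ)}
    (hP : P ∉ A) : L'.branch P =ᶠ[𝓝 0] L.branch P := by
  have hc : Continuous fun u : ℝ => ((P.1, P.2 + (u : AddCircle (1 : ℝ))) :
      Fin n × AddCircle (1 : ℝ)) :=
    continuous_const.prodMk (continuous_const.add (AddCircle.continuous_mk' 1))
  have h0 : ((P.1, P.2 + ((0 : ℝ) : AddCircle (1 : ℝ))) : Fin n × AddCircle (1 : ℝ)) ∈ Aᶜ := by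
    simpa using hP
  filter_upwards [hc.continuousAt.eventually (hA.isOpen_compl.mem_nhds h0)] with u hu
  exact hpt _ hu

/-- The localization principle. At a crossing whose parameter on component `0` lies outside `A`,
separation forces the other parameter outside as well; there the two links have the same germs of
branches and of dots, so these terms cancel. -/
theorem lk_sub_lk_eq {L L' : OrientedLink X 2} {A : Set (Fin 2 × AddCircle (1 : ℝ))}
    (hA : IsClosed A) (hpt : ∀ P, P ∉ A → L'.pt P = L.pt P)
    (hL : L.Separates A) (hL' : L'.Separates A)
    (hd : ∀ P, P ∉ A → L.pt P ∈ L.crossingPoints → SameGerm (L.pt P) L'.dotted L.dotted) :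
    L'.lk - L.lk = L'.lkOn A - L.lkOn A := by
  classical
  have hsplit : ∀ L : OrientedLink X 2, L.lk = L.lkOn A +
      ∑ c ∈ L.finite_mixedCrossings.toFinset with (0, c.1) ∉ A, L.sign (0, c.1) (1, c.2) :=
    fun L => (Finset.sum_filter_add_sum_filter_not _ _ _).symm
  have hout : ∑ c ∈ L'.finite_mixedCrossings.toFinset with (0, c.1) ∉ A,
        L'.sign (0, c.1) (1, c.2) =
      ∑ c ∈ L.finite_mixedCrossings.toFinset with (0, c.1) ∉ A, L.sign (0, c.1) (1, c.2) := by
    refine Finset.sum_congr ?_ ?_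
    · ext c
      simp only [Finset.mem_filter, Finite.mem_toFinset]
      refine and_congr_left fun hc => ?_
      change L'.pt _ = L'.pt _ ↔ L.pt _ = L.pt _
      constructor
      · intro h
        have : (1, c.2) ∉ A := fun h' => hc (hL' _ _ h' h.symm)
        rw [← hpt _ hc, ← hpt _ this, h]
      · intro h
        have : (1, c.2) ∉ A := fun h' => hc (hL _ _ h' h.symm)
        rw [hpt _ hc, hpt _ this, h]
    · intro c hc
      simp only [Finset.mem_filter, Finite.mem_toFinset] at hc
      obtain ⟨hc, h0⟩ := hc
      have hc : L.pt (0, c.1) = L.pt (1, c.2) := hc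
      have h1 : (1, c.2) ∉ A := fun h' => h0 (hL _ _ h' hc.symm)
      have e0 := branch_eventuallyEq hA hpt h0
      have e1 := branch_eventuallyEq hA hpt h1
      exact sign_eq_of_follows (.of_eventuallyEq e0.symm) (.of_eventuallyEq e0)
        (.of_eventuallyEq e1.symm) (.of_eventuallyEq e1)
        (hd _ h0 (mem_crossingPoints (by simp) hc))
  rw [hsplit L, hsplit L', hout]
  ring

theorem lkOn_eq_zero {L : OrientedLink X 2} {A : Set (Fin 2 × AddCircle (1 : ℝ))}
    (h : ∀ p q, (0, p) ∈ A → L.pt (0, p) = L.pt (1, q) → False) : L.lkOn A = 0 := by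
  refine Finset.sum_eq_zero fun c hc => ?_
  simp only [Finset.mem_filter, Finite.mem_toFinset] at hc
  exact (h _ _ hc.2 hc.1).elim

/-- Whether a parameter belongs to the arc depends only on whether its point lies in the disc. So a
crossing with one parameter on the arc has both on it, hence on one component, and does not count.
-/
theorem lk_eq_of_moveM7 {L L' : OrientedLink X 2} (h : MoveM7 L L') : L'.lk = L.lk := by
  obtain ⟨x, -, Γ, h, j, i, a, b, -, -, hab, hL, hL', hpt, hd⟩ := h
  set A : Set (Fin 2 × AddCircle (1 : ℝ)) := {P | ∃ u ∈ Icc a b, P = (i, (u : AddCircle (1 : ℝ)))}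
  have hA : IsClosed A := by
    have hc : Continuous fun u : ℝ => ((i, (u : AddCircle (1 : ℝ))) : Fin 2 × AddCircle (1 : ℝ)) :=
      continuous_const.prodMk (AddCircle.continuous_mk' 1)
    have := ((isCompact_Icc (a := a) (b := b)).image hc).isClosed
    convert this using 1
    ext P
    simp [A, eq_comm]
  have hfst : ∀ P ∈ A, P.1 = i := by
    rintro P ⟨u, -, rfl⟩
    rfl
  have key : ∀ L : OrientedLink X 2,
      MeetsAlongArc (coneDisc h j) (coneDiscBoundary h j) i a b L →
      L.Separates A ∧ L.lkOn A = 0 := by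
    intro L hL
    have hsep : L.Separates A := fun P Q hP hPQ =>
      (hL.1 Q).mp (hPQ ▸ (hL.1 P).mpr hP)
    refine ⟨hsep, lkOn_eq_zero fun p q hp hpq => ?_⟩
    have h1 := hfst _ hp
    have h2 := hfst _ (hsep _ _ hp hpq)
    exact absurd (h1.trans h2.symm) (by simp)
  -- The link changes only over the open interval; the closed one is taken as `A` because `A` has to
  -- be closed.
  have := lk_sub_lk_eq hA (fun P hP => hpt P fun ⟨u, hu, he⟩ => hP ⟨u, Ioo_subset_Icc_self hu, he⟩)
    (key L hL).1 (key L' hL').1 (fun P _ hP => hd _ hP)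
  rw [(key L hL).2, (key L' hL').2] at this
  omega

end OrientedLink

/-! ### Moves that replace a picture -/

/-- `e` is an injective continuous drawing of the model, and the strands `s` have disjoint parameter
intervals and are parametrized affinely. -/
structure IsDrawing {M : Type} [TopologicalSpace M] {k : ℕ} (e : M → X) (i : Fin k → Fin n)
    (a : Fin k → AddCircle (1 : ℝ)) (r : Fin k → ℝ)
    (s : Fin k → ℝ → Fin n × AddCircle (1 : ℝ)) : Prop where
  continuous : Continuous e
  injective : Function.Injective e
  eq : ∀ j τ, s j τ = (i j, a j + ((r j * τ : ℝ) : AddCircle (1 : ℝ)))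
  inj : ∀ j, ∀ τ ∈ Icc (-1 : ℝ) 1, ∀ j', ∀ τ' ∈ Icc (-1 : ℝ) 1, s j τ = s j' τ' → j = j' ∧ τ = τ'

namespace IsDrawing

variable {M : Type} [TopologicalSpace M] {k : ℕ} {e : M → X} {i : Fin k → Fin n}
  {a : Fin k → AddCircle (1 : ℝ)} {r : Fin k → ℝ} {s : Fin k → ℝ → Fin n × AddCircle (1 : ℝ)}

/-- The parameters of the points on the strands. -/
def strands (s : Fin k → ℝ → Fin n × AddCircle (1 : ℝ)) : Set (Fin n × AddCircle (1 : ℝ)) :=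
  {P | ∃ j, ∃ τ ∈ Icc (-1 : ℝ) 1, P = s j τ}

theorem ne_zero (h : IsDrawing e i a r s) (j : Fin k) : r j ≠ 0 := by
  intro hr
  have := (h.inj j 0 (by norm_num) j 1 (by norm_num) (by simp [h.eq, hr])).2
  norm_num at this

theorem isClosed_strands (h : IsDrawing e i a r s) : IsClosed (strands s) := by
  have : strands s = ⋃ j, s j '' Icc (-1 : ℝ) 1 := by
    ext P
    simp [strands, eq_comm]
  rw [this]
  refine isClosed_iUnion_of_finite fun j => (isCompact_Icc.image ?_).isClosed
  have : s j = fun τ => (i j, a j + ((r j * τ : ℝ) : AddCircle (1 : ℝ))) := funext (h.eq j)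
  rw [this]
  exact continuous_const.prodMk (continuous_const.add
    ((AddCircle.continuous_mk' 1).comp (continuous_const.mul continuous_id)))

/-- Conversion between link time and arc time: the link runs along the arc with speed `1 / r j`,
backwards if `r j` is negative. -/
theorem add_div (h : IsDrawing e i a r s) (j : Fin k) (τ u : ℝ) :
    s j (τ + u / r j) = ((s j τ).1, (s j τ).2 + (u : AddCircle (1 : ℝ))) := by
  rw [h.eq, h.eq, mul_add, mul_div_cancel₀ _ (h.ne_zero j), AddCircle.coe_add, add_assoc]

end IsDrawing

namespace PicturedBy

variable {M : Type} [TopologicalSpace M] {k : ℕ} {e : M → X} {K : Set M} {T : Picture M k}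
  {i : Fin k → Fin n} {a : Fin k → AddCircle (1 : ℝ)} {r : Fin k → ℝ}
  {s : Fin k → ℝ → Fin n × AddCircle (1 : ℝ)} {L : OrientedLink X n}

/-- Lying on a strand becomes a condition on the point of `X` alone, so two parameters of the same
point satisfy it together. This is how `Separates` is obtained for the strands. -/
theorem mem_strands_iff (hp : PicturedBy e K T s L) (hT : ∀ j, ∀ τ ∈ Icc (-1 : ℝ) 1, T.arc j τ ∈ K)
    (P : Fin n × AddCircle (1 : ℝ)) : P ∈ IsDrawing.strands s ↔ L.pt P ∈ e '' K := by
  constructor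
  · rintro ⟨j, τ, hτ, rfl⟩
    exact ⟨_, hT j τ hτ, (hp.pt_eq j τ hτ).symm⟩
  · exact hp.mem P

/-- The sign of a crossing of two strands that are straight in an affine coordinate system. -/
theorem sign_eq (hp : PicturedBy e K T s L) (hs : IsDrawing e i a r s) {A : ℝ × ℝ → M}
    (hAc : Continuous A) (hAi : Function.Injective A) {j j' : Fin k} (hj : j ≠ j') {τ τ' : ℝ}
    (hτ : τ ∈ Ioo (-1 : ℝ) 1) (hτ' : τ' ∈ Ioo (-1 : ℝ) 1) {p v w : ℝ × ℝ} {κ : ℝ}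
    (hK : A p ∈ K) (h₁ : ∀ᶠ u : ℝ in 𝓝 0, T.arc j (τ + u) = A (p + u • v))
    (h₂ : ∀ᶠ u : ℝ in 𝓝 0, T.arc j' (τ' + u) = A (p + u • w)) (hκ : κ ≠ 0) (hvw : det2 v w ≠ 0)
    (hd : ∀ᶠ q : ℝ × ℝ in 𝓝 0, 0 < κ * (det2 v q * det2 q w) → A (p + q) ∈ T.dotted) :
    L.sign (s j τ) (s j' τ') = if 0 < κ * (r j * r j') then 1 else -1 := by
  have hr := hs.ne_zero j
  have hr' := hs.ne_zero j'
  have hne : s j τ ≠ s j' τ' := fun h =>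
    hj (hs.inj _ _ (Ioo_subset_Icc_self hτ) _ _ (Ioo_subset_Icc_self hτ') h).1
  have hpt : L.pt (s j τ) = e (A p) := by
    rw [hp.pt_eq _ _ (Ioo_subset_Icc_self hτ)]
    simpa using congrArg e h₁.self_of_nhds
  have hpt' : L.pt (s j' τ') = e (A p) := by
    rw [hp.pt_eq _ _ (Ioo_subset_Icc_self hτ')]
    simpa using congrArg e h₂.self_of_nhds
  -- Linear coordinates whose axes are the two strands run in link time; dividing by `r j` and `r
  -- j'` takes care of the orientations.
  set B : ℝ × ℝ → ℝ × ℝ := fun q => (q.1 / r j) • v + (q.2 / r j') • w with hB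
  have hBc : Continuous B := by fun_prop
  have hB0 : B 0 = 0 := by simp [hB]
  have hBv : ∀ q, det2 v (B q) = q.2 / r j' * det2 v w := fun q => by
    simp [hB, det2]; ring
  have hBw : ∀ q, det2 (B q) w = q.1 / r j * det2 v w := fun q => by
    simp [hB, det2]; ring
  have hBi : Function.Injective B := by
    intro q q' h
    have e1 := hBv q
    have e2 := hBw q
    rw [h, hBv] at e1
    rw [h, hBw] at e2
    have e1 := mul_right_cancel₀ hvw e1
    have e2 := mul_right_cancel₀ hvw e2
    rw [div_left_inj' hr'] at e1
    rw [div_left_inj' hr] at e2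
    exact Prod.ext e2.symm e1.symm
  have hfol : ∀ (l : Fin k) (σ : ℝ) (x : ℝ × ℝ), σ ∈ Ioo (-1 : ℝ) 1 →
      (∀ᶠ u : ℝ in 𝓝 0, T.arc l (σ + u) = A (p + u • x)) →
      Follows (fun u => e (A (p + (u / r l) • x))) (L.branch (s l σ)) := by
    intro l σ x hσ hx
    refine .of_eventuallyEq ?_
    have ht : Tendsto (fun u => u / r l) (𝓝 0) (𝓝 0) := by
      have : Continuous fun u => u / r l := continuous_id.div_const _
      simpa using this.tendsto 0
    have ht' : Tendsto (fun u => σ + u / r l) (𝓝 0) (𝓝 σ) := by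
      simpa using ht.const_add σ
    filter_upwards [ht.eventually hx, ht'.eventually (Ioo_mem_nhds hσ.1 hσ.2)] with u hu hu'
    have := hp.pt_eq l _ (Ioo_subset_Icc_self hu')
    rw [hs.add_div, hu] at this
    exact this.symm
  have hpar := L.sign_of_parametrization hne (E := fun q => e (A (p + B q))) univ_mem
    (hs.continuous.comp (hAc.comp (continuous_const.add hBc))).continuousOn
    (fun q _ q' _ h => hBi (add_left_cancel (hAi (hs.injective h))))
    (by simpa [hB] using hfol j τ v hτ h₁) (by simpa [hB] using hfol j' τ' w hτ' h₂)
  have hBt : Tendsto B (𝓝 0) (𝓝 0) := by simpa [hB0] using hBc.tendsto 0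
  have hpBt : Tendsto (fun q => A (p + B q)) (𝓝 0) (𝓝 (A p)) := by
    have : Continuous fun q => A (p + B q) := hAc.comp (continuous_const.add hBc)
    simpa [hB0] using this.tendsto 0
  -- For `q = x • v + y • w` the product `det2 v q * det2 q w` is `x * y * det2 v w ^ 2`. So `κ > 0`
  -- means dots between `v` and `w` and between `-v` and `-w`, and in link time the decisive sign is
  -- that of `κ * (r j * r j')`. The square makes the orientation of the model plane irrelevant.
  have hdot : ∀ᶠ q in 𝓝 0, 0 < κ * (r j * r j') * (q.1 * q.2) → e (A (p + B q)) ∈ L.dotted := by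
    have h3 := hp.dotted (A p) hK (hpt ▸ OrientedLink.mem_crossingPoints hne (hpt.trans hpt'.symm))
    filter_upwards [hpBt.eventually h3, hBt.eventually hd] with q hq hq' hpos
    refine hq.mpr (hq' ?_)
    rw [hBv, hBw]
    have : κ * (q.2 / r j' * det2 v w * (q.1 / r j * det2 v w)) =
        κ * (r j * r j') * (q.1 * q.2) * (det2 v w / (r j * r j')) ^ 2 := by
      field_simp
    rw [this]
    exact mul_pos hpos (by positivity)
  split_ifs with hpos
  · exact hpar.1 ((OrientedLink.frequently_quadrants.1.and_eventually hdot).mono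
      fun q h => ⟨h.1, h.2 (mul_pos hpos h.1)⟩)
  · have hneg : κ * (r j * r j') < 0 :=
      lt_of_le_of_ne (not_lt.mp hpos) (mul_ne_zero hκ (mul_ne_zero hr hr'))
    exact hpar.2 ((OrientedLink.frequently_quadrants.2.and_eventually hdot).mono
      fun q h => ⟨h.1, h.2 (mul_pos_of_neg_of_neg hneg h.1)⟩)

end PicturedBy

/-! ### Comparing the contributions of two pictures -/

section

variable {M : Type} [TopologicalSpace M] {k : ℕ} {e : M → X} {K : Set M} {T T' : Picture M k}
  {i : Fin k → Fin 2} {a : Fin k → AddCircle (1 : ℝ)} {r : Fin k → ℝ}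
  {s : Fin k → ℝ → Fin 2 × AddCircle (1 : ℝ)} {L L' : OrientedLink X 2}

/-- `C j j'` is the set of the crossings of the `j`-th and the `j'`-th arc. -/
def Picture.HasCrossings (T : Picture M k) (C : Fin k → Fin k → Finset (ℝ × ℝ)) : Prop :=
  ∀ j j', j ≠ j' → ∀ z, z ∈ C j j' ↔
    z.1 ∈ Icc (-1 : ℝ) 1 ∧ z.2 ∈ Icc (-1 : ℝ) 1 ∧ T.arc j z.1 = T.arc j' z.2

/-- A mixed crossing with one parameter on a strand has both on strands, and so determines a pair of
arcs and a pair of times. Conversely, the disjointness of the parameter intervals makes the crossing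
determine these data. -/
theorem PicturedBy.lkOn_strands (hp : PicturedBy e K T s L) (hs : IsDrawing e i a r s)
    (hT : ∀ j, ∀ τ ∈ Icc (-1 : ℝ) 1, T.arc j τ ∈ K) {C : Fin k → Fin k → Finset (ℝ × ℝ)}
    (hC : T.HasCrossings C) :
    L.lkOn (IsDrawing.strands s) = ∑ b : Fin k × Fin k with i b.1 = 0 ∧ i b.2 = 1,
      ∑ z ∈ C b.1 b.2, L.sign (s b.1 z.1) (s b.2 z.2) := by
  classical
  have hfst : ∀ j τ, (s j τ).1 = i j := fun j τ => by rw [hs.eq]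
  have hbne : ∀ b : Fin k × Fin k, i b.1 = 0 ∧ i b.2 = 1 → b.1 ≠ b.2 := by
    rintro b ⟨h1, h2⟩ h
    rw [h, h2] at h1
    exact absurd h1 (by decide)
  rw [Finset.sum_sigma']
  symm
  refine Finset.sum_bij (fun x _ => ((s x.1.1 x.2.1).2, (s x.1.2 x.2.2).2)) ?_ ?_ ?_ ?_
  · rintro ⟨b, z⟩ hx
    simp only [Finset.mem_sigma, Finset.mem_filter, Finset.mem_univ, true_and] at hx
    obtain ⟨hb, hz⟩ := hx
    obtain ⟨h1, h2, h3⟩ := (hC _ _ (hbne b hb) z).mp hz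
    have e1 : ((0 : Fin 2), (s b.1 z.1).2) = s b.1 z.1 := Prod.ext (by rw [hfst, hb.1]) rfl
    have e2 : ((1 : Fin 2), (s b.2 z.2).2) = s b.2 z.2 := Prod.ext (by rw [hfst, hb.2]) rfl
    simp only [Finset.mem_filter, Finite.mem_toFinset]
    refine ⟨?_, ?_⟩
    · change L.pt (0, (s b.1 z.1).2) = L.pt (1, (s b.2 z.2).2)
      rw [e1, e2, hp.pt_eq _ _ h1, hp.pt_eq _ _ h2, h3]
    · rw [e1]
      exact ⟨_, _, h1, rfl⟩
  · rintro ⟨⟨b1, b2⟩, z1, z2⟩ hx ⟨⟨c1, c2⟩, y1, y2⟩ hy h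
    simp only [Finset.mem_sigma, Finset.mem_filter, Finset.mem_univ, true_and] at hx hy
    obtain ⟨hb, hz⟩ := hx
    obtain ⟨hc, hy⟩ := hy
    obtain ⟨h1, h2, -⟩ := (hC _ _ (hbne (b1, b2) hb) _).mp hz
    obtain ⟨h1', h2', -⟩ := (hC _ _ (hbne (c1, c2) hc) _).mp hy
    simp only [Prod.mk.injEq] at h
    obtain ⟨rfl, hz1⟩ := hs.inj _ _ h1 _ _ h1' (Prod.ext (by rw [hfst, hfst, hb.1, hc.1]) h.1)
    obtain ⟨rfl, hz2⟩ := hs.inj _ _ h2 _ _ h2' (Prod.ext (by rw [hfst, hfst, hb.2, hc.2]) h.2)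
    simp only at hz1 hz2
    rw [hz1, hz2]
  · intro c hc
    simp only [Finset.mem_filter, Finite.mem_toFinset] at hc
    obtain ⟨hc, h0⟩ := hc
    have hc : L.pt (0, c.1) = L.pt (1, c.2) := hc
    have h1 : (1, c.2) ∈ IsDrawing.strands s :=
      (hp.mem_strands_iff hT _).mpr (hc ▸ (hp.mem_strands_iff hT _).mp h0)
    obtain ⟨j, τ, hτ, hj⟩ := h0
    obtain ⟨j', τ', hτ', hj'⟩ := h1
    have hij : i j = 0 := by rw [← hfst j τ, ← hj]
    have hij' : i j' = 1 := by rw [← hfst j' τ', ← hj']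
    refine ⟨⟨(j, j'), (τ, τ')⟩, ?_, ?_⟩
    · simp only [Finset.mem_sigma, Finset.mem_filter, Finset.mem_univ, true_and]
      refine ⟨⟨hij, hij'⟩, (hC _ _ (hbne (j, j') ⟨hij, hij'⟩) _).mpr ⟨hτ, hτ', hs.injective ?_⟩⟩
      rw [← hp.pt_eq _ _ hτ, ← hp.pt_eq _ _ hτ', ← hj, ← hj', hc]
    · simp only [← hj, ← hj']
  · rintro ⟨b, z⟩ hx
    simp only [Finset.mem_sigma, Finset.mem_filter, Finset.mem_univ, true_and] at hx
    have e1 : ((0 : Fin 2), (s b.1 z.1).2) = s b.1 z.1 := Prod.ext (by rw [hfst, hx.1.1]) rfl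
    have e2 : ((1 : Fin 2), (s b.2 z.2).2) = s b.2 z.2 := Prod.ext (by rw [hfst, hx.1.2]) rfl
    rw [e1, e2]

/-- Replacing a picture does not change the linking number if, for any two arcs, the signs of
their crossings have the same sum before and after. -/
theorem Replaces.lk_eq (h : Replaces e K T T' L L') (hec : Continuous e)
    (hei : Function.Injective e)
    (hT : ∀ j, ∀ τ ∈ Icc (-1 : ℝ) 1, T.arc j τ ∈ K) (hT' : ∀ j, ∀ τ ∈ Icc (-1 : ℝ) 1, T'.arc j τ ∈ K)
    {C C' : Fin k → Fin k → Finset (ℝ × ℝ)} (hC : T.HasCrossings C) (hC' : T'.HasCrossings C')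
    (hsum : ∀ (i : Fin k → Fin 2) (a : Fin k → AddCircle (1 : ℝ)) (r : Fin k → ℝ)
      (s : Fin k → ℝ → Fin 2 × AddCircle (1 : ℝ)), IsDrawing e i a r s → PicturedBy e K T s L →
      PicturedBy e K T' s L' → ∀ j j', j ≠ j' →
      ∑ z ∈ C' j j', L'.sign (s j z.1) (s j' z.2) = ∑ z ∈ C j j', L.sign (s j z.1) (s j' z.2)) :
    L'.lk = L.lk := by
  obtain ⟨i, a, r, s, hs, hinj, hL, hL', hpt, hd⟩ := h
  have hD : IsDrawing e i a r s := ⟨hec, hei, hs, hinj⟩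
  have hsep : L.Separates (IsDrawing.strands s) := fun P Q hP hPQ =>
    (hL.mem_strands_iff hT Q).mpr (hPQ ▸ (hL.mem_strands_iff hT P).mp hP)
  have hsep' : L'.Separates (IsDrawing.strands s) := fun P Q hP hPQ =>
    (hL'.mem_strands_iff hT' Q).mpr (hPQ ▸ (hL'.mem_strands_iff hT' P).mp hP)
  have key := OrientedLink.lk_sub_lk_eq hD.isClosed_strands hpt hsep hsep'
    (fun P hP hc => hd _ hc fun h => hP ((hL.mem_strands_iff hT P).mpr h))
  have : L'.lkOn (IsDrawing.strands s) = L.lkOn (IsDrawing.strands s) := by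
    rw [hL.lkOn_strands hD hT hC, hL'.lkOn_strands hD hT' hC']
    refine Finset.sum_congr rfl fun b hb => hsum i a r s hD hL hL' _ _ ?_
    -- The two arcs belong to different components and are therefore different, so self-crossings of
    -- an arc play no role.
    simp only [Finset.mem_filter, Finset.mem_univ, true_and] at hb
    intro h
    rw [h, hb.2] at hb
    exact absurd hb.1 (by decide)
  omega

/-- Replacing a picture with a single arc does not change the linking number. -/
theorem Replaces.lk_eq_of_single {T T' : Picture M 1} (h : Replaces e K T T' L L')
    (hec : Continuous e) (hei : Function.Injective e)
    (hT : ∀ j, ∀ τ ∈ Icc (-1 : ℝ) 1, T.arc j τ ∈ K)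
    (hT' : ∀ j, ∀ τ ∈ Icc (-1 : ℝ) 1, T'.arc j τ ∈ K) : L'.lk = L.lk :=
  h.lk_eq hec hei hT hT' (C := fun _ _ => ∅) (C' := fun _ _ => ∅)
    (fun _ _ hj => (hj (Subsingleton.elim _ _)).elim)
    (fun _ _ hj => (hj (Subsingleton.elim _ _)).elim) (fun _ _ _ _ _ _ _ _ _ _ => rfl)

end

/-! ### Invariance under the basic moves -/

theorem eventually_abs_lt {ε : ℝ} (hε : 0 < ε) : ∀ᶠ u : ℝ in 𝓝 0, |u| < ε := by
  filter_upwards [Metric.ball_mem_nhds (0 : ℝ) hε] with u hu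
  simpa using hu

theorem eventually_abs_fst_lt {ε : ℝ} (hε : 0 < ε) : ∀ᶠ q : ℝ × ℝ in 𝓝 0, |q.1| < ε :=
  (continuous_fst.tendsto (0 : ℝ × ℝ)).eventually (eventually_abs_lt hε)

theorem mem_square {p : ℝ × ℝ} (h₁ : |p.1| ≤ 1) (h₂ : |p.2| ≤ 1) :
    p ∈ Icc ((-1, -1) : ℝ × ℝ) (1, 1) :=
  ⟨⟨(abs_le.mp h₁).1, (abs_le.mp h₂).1⟩, ⟨(abs_le.mp h₁).2, (abs_le.mp h₂).2⟩⟩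

/-- The crossing of the kink is one of a component with itself, whatever its sign. It remains to
check that both arcs stay in the square. -/
theorem lk_eq_of_moveM1 {b : Bool} {L L' : OrientedLink X 2} (h : MoveM1 b L L') :
    L'.lk = L.lk := by
  obtain ⟨e, ⟨he, -⟩, hr⟩ := h
  refine hr.lk_eq_of_single he.continuous he.injective ?_ ?_
  · intro j τ hτ
    have : |τ| ≤ 1 := abs_le.mpr hτ
    refine mem_square this ?_
    simp only [pictureM1, abs_neg, abs_pow]
    exact pow_le_one₀ (abs_nonneg _) this
  · intro j τ hτ
    have h1 : |τ| ≤ 1 := abs_le.mpr hτ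
    have h2 : |1 - 2 * τ ^ 2| ≤ 1 := by
      rw [abs_le]
      constructor <;> nlinarith [hτ.1, hτ.2]
    refine mem_square ?_ h2
    simp only [pictureM1', abs_mul]
    rw [abs_sub_comm] at h2
    exact mul_le_one₀ h1 (abs_nonneg _) h2

/-- The crossings of the arcs of the bigon. -/
def bigonCrossings (j j' : Fin 2) : Finset (ℝ × ℝ) :=
  if j = j' then ∅ else {(1 / 2, 1 / 2), (-(1 / 2), -(1 / 2))}

theorem pictureM2_hasCrossings : pictureM2.HasCrossings fun _ _ => ∅ := by
  intro j j' hj z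
  fin_cases j <;> fin_cases j' <;> simp [pictureM2] at hj ⊢

/-- Both arcs are graphs parametrized by the abscissa, so the two times of a crossing agree and
equal `±1/2`. -/
theorem pictureM2'_hasCrossings : pictureM2'.HasCrossings bigonCrossings := by
  have key : ∀ x y : ℝ, (x = 1 / 2 ∧ y = 1 / 2) ∨ (x = -(1 / 2) ∧ y = -(1 / 2)) ↔
      x ∈ Icc (-1 : ℝ) 1 ∧ y ∈ Icc (-1 : ℝ) 1 ∧ x = y ∧ 0 = |y| - 1 / 2 := by
    intro x y
    constructor
    · rintro (⟨rfl, rfl⟩ | ⟨rfl, rfl⟩) <;> norm_num [abs_of_pos]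
    · rintro ⟨-, -, rfl, h⟩
      have : |x| = 1 / 2 := by linarith
      rcases (abs_eq (by norm_num)).mp this with h | h <;> simp [h]
  have key' : ∀ x y : ℝ, pictureM2'.arc 0 x = pictureM2'.arc 1 y ↔ x = y ∧ 0 = |y| - 1 / 2 :=
    fun x y => Prod.ext_iff
  rintro j j' hj ⟨x, y⟩
  simp only [bigonCrossings, if_neg hj, Finset.mem_insert, Finset.mem_singleton, Prod.mk.injEq]
  fin_cases j <;> fin_cases j'
  · simp at hj
  · rw [key]
    exact and_congr_right fun _ => and_congr_right fun _ => (key' x y).symm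
  · rw [and_comm (a := x = _), and_comm (a := x = _), key y x, ← key', and_left_comm]
    exact and_congr_right fun _ => and_congr_right fun _ => eq_comm
  · simp at hj

/-- The bigon is a sector between `v` and `w` at its left vertex, and the sector between `-v` and
`-w` at its right vertex. It is dotted only at the left one, so `κ` is `1` there and `-1` at the
right vertex: the two signs cancel for every orientation of the strands. -/
theorem lk_eq_of_moveM2 {L L' : OrientedLink X 2} (h : MoveM2 L L') : L'.lk = L.lk := by
  obtain ⟨e, ⟨he, -⟩, hr⟩ := h
  refine hr.lk_eq he.continuous he.injective ?_ ?_ pictureM2_hasCrossings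
    pictureM2'_hasCrossings ?_
  · intro j τ hτ
    have : |τ| ≤ 1 := abs_le.mpr hτ
    fin_cases j
    · exact mem_square this (by simp [pictureM2])
    · exact mem_square this (by norm_num [pictureM2, abs_of_pos])
  · intro j τ hτ
    have : |τ| ≤ 1 := abs_le.mpr hτ
    fin_cases j
    · exact mem_square this (by simp [pictureM2'])
    · refine mem_square this ?_
      simp only [pictureM2']
      change |(|τ| - 1 / 2)| ≤ 1
      rw [abs_le]
      constructor <;> linarith [abs_nonneg τ]
  · intro i a r s hs hL hL'
    have h01 : ∑ z ∈ bigonCrossings 0 1, L'.sign (s 0 z.1) (s 1 z.2) = 0 := by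
      have hne : ((1 / 2, 1 / 2) : ℝ × ℝ) ≠ (-(1 / 2), -(1 / 2)) := by norm_num
      rw [bigonCrossings, if_neg (by decide), Finset.sum_pair hne]
      have h1 := hL'.sign_eq hs continuous_id Function.injective_id (j := 0) (j' := 1) (by decide)
        (τ := 1 / 2) (τ' := 1 / 2) (by norm_num) (by norm_num) (p := (1 / 2, 0)) (v := (1, 0))
        (w := (1, 1)) (κ := -1) (mem_square (by norm_num [abs_of_pos]) (by norm_num))
        (.of_forall fun u => by simp [pictureM2'])
        (by
          filter_upwards [eventually_abs_lt (ε := 1 / 2) (by norm_num)] with u hu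
          have := abs_lt.mp hu
          simp [pictureM2', abs_of_pos (show 0 < 2⁻¹ + u by linarith)])
        (by norm_num) (by norm_num [det2])
        (by
          filter_upwards [eventually_abs_fst_lt (ε := 1 / 2) (by norm_num)] with q hq h
          have := abs_lt.mp hq
          have hpos : 0 < 1 / 2 + q.1 := by linarith
          simp only [det2] at h
          change 0 < (1 / 2 + q.1) * (0 + q.2) * (0 + q.2 - |1 / 2 + q.1| + 1 / 2)
          rw [abs_of_pos hpos]
          have := mul_pos hpos h
          nlinarith)
      have h2 := hL'.sign_eq hs continuous_id Function.injective_id (j := 0) (j' := 1) (by decide)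
        (τ := -(1 / 2)) (τ' := -(1 / 2)) (by norm_num) (by norm_num) (p := (-(1 / 2), 0))
        (v := (1, 0))
        (w := (1, -1)) (κ := 1) (mem_square (by norm_num [abs_of_pos]) (by norm_num))
        (.of_forall fun u => by simp [pictureM2'])
        (by
          filter_upwards [eventually_abs_lt (ε := 1 / 2) (by norm_num)] with u hu
          have := abs_lt.mp hu
          simp [pictureM2', abs_of_neg (show -2⁻¹ + u < 0 by linarith)])
        (by norm_num) (by norm_num [det2])
        (by
          filter_upwards [eventually_abs_fst_lt (ε := 1 / 2) (by norm_num)] with q hq h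
          have := abs_lt.mp hq
          have hneg : -(1 / 2) + q.1 < 0 := by linarith
          simp only [det2] at h
          change 0 < (-(1 / 2) + q.1) * (0 + q.2) * (0 + q.2 - |-(1 / 2) + q.1| + 1 / 2)
          rw [abs_of_neg hneg]
          have := mul_pos (neg_pos.mpr hneg) h
          nlinarith)
      rw [h1, h2]
      have := mul_ne_zero (hs.ne_zero 0) (hs.ne_zero 1)
      rcases lt_or_gt_of_ne this with h | h
      · rw [if_pos (by linarith), if_neg (by linarith)]; norm_num
      · rw [if_neg (by linarith), if_pos (by linarith)]; norm_num
    intro j j' hj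
    rw [Finset.sum_empty]
    fin_cases j <;> fin_cases j'
    · simp at hj
    · exact h01
    · rw [← h01]
      have hne : ((1 / 2, 1 / 2) : ℝ × ℝ) ≠ (-(1 / 2), -(1 / 2)) := by norm_num
      simp only [bigonCrossings]
      rw [if_neg (by decide), if_neg (by decide), Finset.sum_pair hne, Finset.sum_pair hne]
      exact congrArg₂ _ (L'.sign_comm _ _) (L'.sign_comm _ _)
    · simp at hj

/-- The common parameter of the `j`-th and the `j'`-th arc at their crossing in the third move. -/
def triangleVertex (κ : ℝ) : Fin 3 → Fin 3 → ℝ :=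
  ![![0, κ / 3, -κ / 3], ![κ / 3, 0, 0], ![-κ / 3, 0, 0]]

/-- All three arcs are graphs over the time, so the times at a crossing agree. For the bent arc,
each side of `0` gives one linear equation, and the solution for one of the sides lies on the wrong
side. -/
theorem pictureM3_hasCrossings {κ : ℝ} (hκ : κ = 1 ∨ κ = -1) (a b c : ℝ) :
    (pictureM3 κ a b c).HasCrossings
      fun j j' => {(triangleVertex κ j j', triangleVertex κ j j')} := by
  have h01 : ∀ x y : ℝ, (x = κ / 3 ∧ y = κ / 3) ↔
      x ∈ Icc (-1 : ℝ) 1 ∧ y ∈ Icc (-1 : ℝ) 1 ∧ x = y ∧ κ * (1 - |x|) / 2 = y := by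
    intro x y
    constructor
    · rintro ⟨rfl, rfl⟩
      rcases hκ with rfl | rfl <;> norm_num [abs_of_pos, abs_of_neg]
    · rintro ⟨⟨h1, h2⟩, -, rfl, h⟩
      rcases hκ with rfl | rfl <;> rcases abs_cases x with ⟨h', _⟩ | ⟨h', _⟩ <;> rw [h'] at h <;>
        constructor <;> linarith
  have h02 : ∀ x y : ℝ, (x = -κ / 3 ∧ y = -κ / 3) ↔
      x ∈ Icc (-1 : ℝ) 1 ∧ y ∈ Icc (-1 : ℝ) 1 ∧ x = y ∧ κ * (1 - |x|) / 2 = -y := by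
    intro x y
    constructor
    · rintro ⟨rfl, rfl⟩
      rcases hκ with rfl | rfl <;> norm_num [abs_of_pos, abs_of_neg]
    · rintro ⟨⟨h1, h2⟩, -, rfl, h⟩
      rcases hκ with rfl | rfl <;> rcases abs_cases x with ⟨h', _⟩ | ⟨h', _⟩ <;> rw [h'] at h <;>
        constructor <;> linarith
  have h12 : ∀ x y : ℝ, (x = 0 ∧ y = 0) ↔
      x ∈ Icc (-1 : ℝ) 1 ∧ y ∈ Icc (-1 : ℝ) 1 ∧ x = y ∧ x = -y := by
    intro x y
    constructor
    · rintro ⟨rfl, rfl⟩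
      norm_num
    · rintro ⟨-, -, rfl, h⟩
      constructor <;> linarith
  have hsymm : ∀ j j' t, (∀ x y : ℝ, (x = t ∧ y = t) ↔ x ∈ Icc (-1 : ℝ) 1 ∧ y ∈ Icc (-1 : ℝ) 1 ∧
      (pictureM3 κ a b c).arc j x = (pictureM3 κ a b c).arc j' y) →
      ∀ x y : ℝ, (x = t ∧ y = t) ↔ x ∈ Icc (-1 : ℝ) 1 ∧ y ∈ Icc (-1 : ℝ) 1 ∧
      (pictureM3 κ a b c).arc j' x = (pictureM3 κ a b c).arc j y := by
    intro j j' t h x y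
    rw [and_comm, h y x]
    tauto
  have k01 : ∀ x y : ℝ, (x = κ / 3 ∧ y = κ / 3) ↔ x ∈ Icc (-1 : ℝ) 1 ∧ y ∈ Icc (-1 : ℝ) 1 ∧
      (pictureM3 κ a b c).arc 0 x = (pictureM3 κ a b c).arc 1 y := by
    intro x y
    rw [h01]
    simp [pictureM3, Prod.ext_iff]
  have k02 : ∀ x y : ℝ, (x = -κ / 3 ∧ y = -κ / 3) ↔ x ∈ Icc (-1 : ℝ) 1 ∧ y ∈ Icc (-1 : ℝ) 1 ∧
      (pictureM3 κ a b c).arc 0 x = (pictureM3 κ a b c).arc 2 y := by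
    intro x y
    rw [h02]
    simp [pictureM3, Prod.ext_iff]
  have k12 : ∀ x y : ℝ, (x = 0 ∧ y = 0) ↔ x ∈ Icc (-1 : ℝ) 1 ∧ y ∈ Icc (-1 : ℝ) 1 ∧
      (pictureM3 κ a b c).arc 1 x = (pictureM3 κ a b c).arc 2 y := by
    intro x y
    rw [h12]
    simp [pictureM3, Prod.ext_iff]
  rintro j j' hj ⟨x, y⟩
  rw [Finset.mem_singleton, Prod.mk.injEq]
  fin_cases j <;> fin_cases j'
  · simp at hj
  · exact k01 x y
  · exact k02 x y
  · exact hsymm _ _ _ k01 x y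
  · simp at hj
  · exact k12 x y
  · exact hsymm _ _ _ k02 x y
  · exact hsymm _ _ _ k12 x y
  · simp at hj

theorem pictureM3_mem {κ : ℝ} (hκ : κ = 1 ∨ κ = -1) (a b c : ℝ) (j : Fin 3) {τ : ℝ}
    (hτ : τ ∈ Icc (-1 : ℝ) 1) : (pictureM3 κ a b c).arc j τ ∈ Icc ((-1, -1) : ℝ × ℝ) (1, 1) := by
  have h1 : |τ| ≤ 1 := abs_le.mpr hτ
  have h0 := abs_nonneg τ
  fin_cases j
  · refine mem_square h1 ?_
    change |κ * (1 - |τ|) / 2| ≤ 1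
    rw [abs_le]
    rcases hκ with rfl | rfl <;> constructor <;> linarith
  · exact mem_square h1 h1
  · exact mem_square h1 (by simpa [pictureM3] using h1)

/-- The signs of the crossings in the third move do not depend on `κ`. -/
theorem PicturedBy.sign_pictureM3 {e : ℝ × ℝ → X} {i : Fin 3 → Fin 2}
    {a : Fin 3 → AddCircle (1 : ℝ)} {r : Fin 3 → ℝ} {s : Fin 3 → ℝ → Fin 2 × AddCircle (1 : ℝ)}
    {L : OrientedLink X 2} {κ A B C : ℝ} (hκ : κ = 1 ∨ κ = -1) (hA : A ≠ 0) (hB : B ≠ 0)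
    (hC : C ≠ 0)
    (hL : PicturedBy e (Icc (-1, -1) (1, 1)) (pictureM3 κ A B C) s L)
    (hs : IsDrawing e i a r s) :
    L.sign (s 0 (κ / 3)) (s 1 (κ / 3)) = (if 0 < -A * (r 0 * r 1) then 1 else -1) ∧
    L.sign (s 0 (-κ / 3)) (s 2 (-κ / 3)) = (if 0 < -B * (r 0 * r 2) then 1 else -1) ∧
    L.sign (s 1 0) (s 2 0) = (if 0 < -C * (r 1 * r 2) then 1 else -1) := by
  refine ⟨?_, ?_, ?_⟩
  -- The bent arc has slope `-1/2` at `x = κ / 3` for both values of `κ`, and likewise slope `1/2`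
  -- at `x = -κ / 3`. The directions at the crossings are thus the same before and after the move.
  · refine hL.sign_eq hs continuous_id Function.injective_id (by decide) ?_ ?_ (p := (κ / 3, κ / 3))
      (v := (1, -1 / 2)) (w := (1, 1)) (mem_square ?_ ?_) ?_ (.of_forall fun u => ?_)
      (neg_ne_zero.mpr hA) (by norm_num [det2]) ?_
    · rcases hκ with rfl | rfl <;> norm_num
    · rcases hκ with rfl | rfl <;> norm_num
    · rcases hκ with rfl | rfl <;> norm_num [abs_of_pos, abs_of_neg]
    · rcases hκ with rfl | rfl <;> norm_num [abs_of_pos, abs_of_neg]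
    · filter_upwards [eventually_abs_lt (ε := 1 / 3) (by norm_num)] with u hu
      have := abs_lt.mp hu
      refine Prod.ext (by simp [pictureM3]) ?_
      change κ * (1 - |κ / 3 + u|) / 2 = κ / 3 + u * (-1 / 2)
      rcases hκ with rfl | rfl
      · rw [abs_of_pos (by linarith)]; ring
      · rw [abs_of_neg (by linarith)]; ring
    · simp [pictureM3]
    -- Within distance `1/6` of `κ / 3` the abscissa satisfies `κ * x > 1/6`, which selects the
    -- first clause of the dotted set.
    · filter_upwards [eventually_abs_fst_lt (ε := 1 / 6) (by norm_num)] with q hq h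
      have := abs_lt.mp hq
      simp only [det2] at h
      left
      change 1 / 6 < κ * (κ / 3 + q.1) ∧ 0 < A * ((κ / 3 + q.2 - κ * (1 - |κ / 3 + q.1|) / 2) *
        (κ / 3 + q.2 - (κ / 3 + q.1)))
      rcases hκ with rfl | rfl
      · rw [abs_of_pos (by linarith)]
        exact ⟨by linarith, by linarith⟩
      · rw [abs_of_neg (by linarith)]
        exact ⟨by linarith, by linarith⟩
  · refine hL.sign_eq hs continuous_id Function.injective_id (by decide) ?_ ?_
      (p := (-κ / 3, κ / 3))
      (v := (1, 1 / 2)) (w := (1, -1)) (mem_square ?_ ?_) ?_ (.of_forall fun u => ?_)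
      (neg_ne_zero.mpr hB) (by norm_num [det2]) ?_
    · rcases hκ with rfl | rfl <;> norm_num
    · rcases hκ with rfl | rfl <;> norm_num
    · rcases hκ with rfl | rfl <;> norm_num [abs_of_pos, abs_of_neg]
    · rcases hκ with rfl | rfl <;> norm_num [abs_of_pos, abs_of_neg]
    · filter_upwards [eventually_abs_lt (ε := 1 / 3) (by norm_num)] with u hu
      have := abs_lt.mp hu
      refine Prod.ext (by simp [pictureM3]) ?_
      change κ * (1 - |-κ / 3 + u|) / 2 = κ / 3 + u * (1 / 2)
      rcases hκ with rfl | rfl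
      · rw [abs_of_neg (by linarith)]; ring
      · rw [abs_of_pos (by linarith)]; ring
    · refine Prod.ext (by simp [pictureM3]) ?_
      change -(-κ / 3 + u) = κ / 3 + u * (-1)
      ring
    · filter_upwards [eventually_abs_fst_lt (ε := 1 / 6) (by norm_num)] with q hq h
      have := abs_lt.mp hq
      simp only [det2] at h
      right
      left
      change κ * (-κ / 3 + q.1) < -(1 / 6) ∧
        0 < B * ((κ / 3 + q.2 - κ * (1 - |-κ / 3 + q.1|) / 2) * (κ / 3 + q.2 + (-κ / 3 + q.1)))
      rcases hκ with rfl | rfl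
      · rw [abs_of_neg (by linarith)]
        exact ⟨by linarith, by linarith⟩
      · rw [abs_of_pos (by linarith)]
        exact ⟨by linarith, by linarith⟩
  · refine hL.sign_eq hs continuous_id Function.injective_id (by decide) (by norm_num)
      (by norm_num) (p := (0, 0)) (v := (1, 1)) (w := (1, -1)) (mem_square (by simp) (by simp))
      (.of_forall fun u => by simp [pictureM3]) (.of_forall fun u => by simp [pictureM3])
      (neg_ne_zero.mpr hC) (by norm_num [det2]) ?_
    filter_upwards [eventually_abs_fst_lt (ε := 1 / 6) (by norm_num)] with q hq h
    simp only [det2] at h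
    right
    right
    change |0 + q.1| < 1 / 6 ∧ 0 < C * ((0 + q.2 - (0 + q.1)) * (0 + q.2 + (0 + q.1)))
    rw [zero_add, zero_add]
    exact ⟨hq, by linarith⟩

/-- Nothing cancels here: for each pair of arcs the single crossing keeps its sign, since the
formulas of `sign_pictureM3` do not contain `κ`. -/
theorem lk_eq_of_moveM3 {L L' : OrientedLink X 2} (h : MoveM3 L L') : L'.lk = L.lk := by
  obtain ⟨e, a, b, c, ⟨he, -⟩, ha, hb, hc, hr⟩ := h
  have ha0 : a ≠ 0 := by rcases ha with rfl | rfl <;> norm_num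
  have hb0 : b ≠ 0 := by rcases hb with rfl | rfl <;> norm_num
  have hc0 : c ≠ 0 := by rcases hc with rfl | rfl <;> assumption
  have hp : (1 : ℝ) = 1 ∨ (1 : ℝ) = -1 := Or.inl rfl
  have hn : (-1 : ℝ) = 1 ∨ (-1 : ℝ) = -1 := Or.inr rfl
  refine hr.lk_eq he.continuous he.injective (fun j τ hτ => pictureM3_mem hp a b c j hτ)
    (fun j τ hτ => pictureM3_mem hn a b c j hτ) (pictureM3_hasCrossings hp a b c)
    (pictureM3_hasCrossings hn a b c) ?_
  intro i x r s hs hL hL'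
  obtain ⟨h1, h2, h3⟩ := hL.sign_pictureM3 hp ha0 hb0 hc0 hs
  obtain ⟨h1', h2', h3'⟩ := hL'.sign_pictureM3 hn ha0 hb0 hc0 hs
  have e1 := h1'.trans h1.symm
  have e2 := h2'.trans h2.symm
  have e3 := h3'.trans h3.symm
  intro j j' hj
  rw [Finset.sum_singleton, Finset.sum_singleton]
  fin_cases j <;> fin_cases j'
  · simp at hj
  · exact e1
  · exact e2
  · rw [L.sign_comm, L'.sign_comm]
    exact e1
  · simp at hj
  · exact e3
  · rw [L.sign_comm, L'.sign_comm]
    exact e2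
  · rw [L.sign_comm, L'.sign_comm]
    exact e3
  · simp at hj

/-! ### Plane and detour inside a book; the moves at the ridge -/

namespace Book

theorem plane_continuous (k : ℕ) : Continuous (plane k) := by
  refine Continuous.subtype_mk (continuous_fst.prodMk (continuous_pi fun i => ?_)) _
  split_ifs <;> fun_prop

theorem plane_dist_zero (k : ℕ) (p : ℝ × ℝ) : (plane k p).dist 0 = max p.2 0 := rfl

theorem plane_dist_one (k : ℕ) (p : ℝ × ℝ) : (plane k p).dist 1 = max (-p.2) 0 := rfl

theorem plane_injective (k : ℕ) : Function.Injective (plane k) := by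
  intro p q h
  have h0 := plane_dist_zero k p
  have h1 := plane_dist_one k p
  rw [h, plane_dist_zero] at h0
  rw [h, plane_dist_one] at h1
  refine Prod.ext (congrArg Book.pos h) ?_
  rw [← max_zero_sub_max_neg_zero_eq_self p.2, ← max_zero_sub_max_neg_zero_eq_self q.2,
    ← h0, ← h1]

theorem plane_mem_box (k : ℕ) {p : ℝ × ℝ} (h₁ : |p.1| ≤ 1) (h₂ : |p.2| ≤ 1) :
    plane k p ∈ box (m := k + 3) {0, 1} := by
  have := abs_le.mp h₂
  refine ⟨h₁, fun i => ?_, fun i hi => ?_⟩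
  · change (if i = 0 then max p.2 0 else if i = 1 then max (-p.2) 0 else 0) ≤ 1
    split_ifs
    · exact max_le this.2 zero_le_one
    · exact max_le (by linarith) zero_le_one
    · exact zero_le_one
  · simp only [mem_insert_iff, mem_singleton_iff, not_or] at hi
    change (if i = 0 then max p.2 0 else if i = 1 then max (-p.2) 0 else 0) = 0
    rw [if_neg hi.1, if_neg hi.2]

theorem detour_mem_box (k : ℕ) {τ : ℝ} (h : |τ| ≤ 1) :
    detour k τ ∈ box (m := k + 3) {0, 1, 2} := by
  have h' := abs_le.mp h
  have h0 := abs_nonneg τ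
  refine ⟨h, fun i => ?_, fun i hi => ?_⟩
  · change (if i = 0 then max (-τ - 1 / 2) 0 else if i = 1 then max (τ - 1 / 2) 0
      else if i = 2 then max (1 / 2 - |τ|) 0 else 0) ≤ 1
    split_ifs
    · exact max_le (by linarith) zero_le_one
    · exact max_le (by linarith) zero_le_one
    · exact max_le (by linarith) zero_le_one
    · exact zero_le_one
  · simp only [mem_insert_iff, mem_singleton_iff, not_or] at hi
    change (if i = 0 then max (-τ - 1 / 2) 0 else if i = 1 then max (τ - 1 / 2) 0
      else if i = 2 then max (1 / 2 - |τ|) 0 else 0) = 0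
    rw [if_neg hi.1, if_neg hi.2.1, if_neg hi.2.2]

theorem box_mono {m : ℕ} {s t : Set (Fin m)} (h : s ⊆ t) : box s ⊆ box t :=
  fun _ hq => ⟨hq.1, hq.2.1, fun i hi => hq.2.2 i fun hi' => hi (h hi')⟩

end Book

/-- A single strand has no crossing with another component inside the box; only the confinement of
both arcs to the box needs proof. -/
theorem lk_eq_of_moveM4 {L L' : OrientedLink X 2} (h : MoveM4 L L') : L'.lk = L.lk := by
  obtain ⟨k, e, he, hr⟩ := h
  refine hr.lk_eq_of_single he.continuous he.injective ?_ ?_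
  · intro _ τ hτ
    exact Book.plane_mem_box k (abs_le.mpr hτ) (by norm_num [abs_of_pos])
  · intro _ τ hτ
    have : |τ| ≤ 1 := abs_le.mpr hτ
    refine Book.plane_mem_box k this ?_
    rw [abs_le]
    constructor <;> linarith [abs_nonneg τ]

theorem lk_eq_of_moveM6 {L L' : OrientedLink X 2} (h : MoveM6 L L') : L'.lk = L.lk := by
  obtain ⟨k, e, he, hr⟩ := h
  refine hr.lk_eq_of_single he.continuous he.injective ?_ ?_
  · intro _ τ hτ
    -- The old arc uses only the half-planes `0` and `1`, so it already lies in a smaller box.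
    refine Book.box_mono ?_ (Book.plane_mem_box k (abs_le.mpr hτ) ?_)
    · exact insert_subset_insert (singleton_subset_iff.mpr (mem_insert _ _))
    · rw [abs_le]
      constructor <;> linarith [hτ.1, hτ.2]
  · intro _ τ hτ
    exact Book.detour_mem_box k (abs_le.mpr hτ)

theorem pictureM5_hasCrossings (k : ℕ) {κ : ℝ} (hκ : κ = 1 ∨ κ = -1) (side : Bool) :
    (pictureM5 k κ side).HasCrossings fun _ _ => {(κ / 3, κ / 3)} := by
  have key : ∀ x y : ℝ, (x = κ / 3 ∧ y = κ / 3) ↔ x ∈ Icc (-1 : ℝ) 1 ∧ y ∈ Icc (-1 : ℝ) 1 ∧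
      (pictureM5 k κ side).arc 0 x = (pictureM5 k κ side).arc 1 y := by
    intro x y
    have : (pictureM5 k κ side).arc 0 x = (pictureM5 k κ side).arc 1 y ↔
        x - κ * (1 - |x|) / 2 = -(y - κ * (1 - |y|) / 2) ∧ x = y := by
      change Book.plane k _ = Book.plane k _ ↔ _
      rw [(Book.plane_injective k).eq_iff, Prod.mk.injEq]
    rw [this]
    constructor
    · rintro ⟨rfl, rfl⟩
      rcases hκ with rfl | rfl <;> norm_num [abs_of_pos, abs_of_neg]
    · rintro ⟨⟨h1, h2⟩, -, h, rfl⟩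
      rcases hκ with rfl | rfl <;> rcases abs_cases x with ⟨h', _⟩ | ⟨h', _⟩ <;> rw [h'] at h <;>
        constructor <;> linarith
  rintro j j' hj ⟨x, y⟩
  rw [Finset.mem_singleton, Prod.mk.injEq]
  fin_cases j <;> fin_cases j'
  · simp at hj
  · exact key x y
  · rw [and_comm, key y x]
    tauto
  · simp at hj

theorem pictureM5_mem (k : ℕ) {κ : ℝ} (hκ : κ = 1 ∨ κ = -1) (side : Bool) (j : Fin 2) {τ : ℝ}
    (hτ : τ ∈ Icc (-1 : ℝ) 1) : (pictureM5 k κ side).arc j τ ∈ Book.box (m := k + 3) {0, 1} := by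
  have h1 : |τ| ≤ 1 := abs_le.mpr hτ
  have h2 : |τ - κ * (1 - |τ|) / 2| ≤ 1 := by
    obtain ⟨h3, h4⟩ := hτ
    rw [abs_le]
    rcases hκ with rfl | rfl <;> rcases abs_cases τ with ⟨h', _⟩ | ⟨h', _⟩ <;> rw [h'] <;>
      constructor <;> linarith
  fin_cases j
  · exact Book.plane_mem_box k h2 h1
  · exact Book.plane_mem_box k (by rwa [abs_neg]) h1

theorem PicturedBy.sign_pictureM5 {k : ℕ} {e : Book (k + 3) → X} {i : Fin 2 → Fin 2}
    {a : Fin 2 → AddCircle (1 : ℝ)} {r : Fin 2 → ℝ} {s : Fin 2 → ℝ → Fin 2 × AddCircle (1 : ℝ)}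
    {L : OrientedLink X 2} {κ : ℝ} {side : Bool} (hκ : κ = 1 ∨ κ = -1)
    (hL : PicturedBy e (Book.box {0, 1}) (pictureM5 k κ side) s L) (hs : IsDrawing e i a r s) :
    L.sign (s 0 (κ / 3)) (s 1 (κ / 3)) =
      (if 0 < (if side then -1 else 1) * (r 0 * r 1) then 1 else -1) := by
  -- Near the ordinate `κ / 3` the bent function is linear with slope `3/2`, for both values of `κ`.
  -- This is why the sign is the same on the two sides of the ridge.
  have hy : ∀ᶠ u : ℝ in 𝓝 0, κ / 3 + u - κ * (1 - |κ / 3 + u|) / 2 = u * (3 / 2) := by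
    filter_upwards [eventually_abs_lt (ε := 1 / 3) (by norm_num)] with u hu
    have := abs_lt.mp hu
    rcases hκ with rfl | rfl
    · rw [abs_of_pos (by linarith)]; ring
    · rw [abs_of_neg (by linarith)]; ring
  -- For these `v` and `w` the product `det2 v q * det2 q w` is `(3/2 * q.2)² - q.1²`. It is
  -- negative exactly to the left and to the right of the crossing, whence `κ = -1` for `side =
  -- true`.
  refine hL.sign_eq hs (Book.plane_continuous k) (Book.plane_injective k) (by decide) ?_ ?_
    (p := (0, κ / 3)) (v := (3 / 2, 1)) (w := (-3 / 2, 1))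
    (Book.plane_mem_box k (by simp) ?_) ?_ ?_ (by split_ifs <;> norm_num) (by norm_num [det2]) ?_
  · rcases hκ with rfl | rfl <;> norm_num
  · rcases hκ with rfl | rfl <;> norm_num
  · rcases hκ with rfl | rfl <;> norm_num [abs_of_pos, abs_of_neg]
  · filter_upwards [hy] with u hu
    refine congrArg (Book.plane k) (Prod.ext ?_ ?_)
    · change κ / 3 + u - κ * (1 - |κ / 3 + u|) / 2 = 0 + u * (3 / 2)
      rw [hu, zero_add]
    · change κ / 3 + u = κ / 3 + u * 1
      ring
  · filter_upwards [hy] with u hu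
    refine congrArg (Book.plane k) (Prod.ext ?_ ?_)
    · change -(κ / 3 + u - κ * (1 - |κ / 3 + u|) / 2) = 0 + u * (-3 / 2)
      rw [hu]
      ring
    · change κ / 3 + u = κ / 3 + u * 1
      ring
  · have hy' := (continuous_snd.tendsto (0 : ℝ × ℝ)).eventually hy
    filter_upwards [hy'] with q hq h
    refine mem_image_of_mem _ ?_
    simp only [det2] at h
    cases side
    · change |0 + q.1| < |κ / 3 + q.2 - κ * (1 - |κ / 3 + q.2|) / 2|
      rw [hq, zero_add]
      refine sq_lt_sq.mp ?_
      simp only [Bool.false_eq_true, if_false] at h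
      linarith
    · change |κ / 3 + q.2 - κ * (1 - |κ / 3 + q.2|) / 2| < |0 + q.1|
      rw [hq, zero_add]
      refine sq_lt_sq.mp ?_
      simp only [if_true] at h
      linarith

/-- The crossing moves from half-plane `0` to half-plane `1` and keeps its sign, for either position
of the dots. -/
theorem lk_eq_of_moveM5 {side : Bool} {L L' : OrientedLink X 2} (h : MoveM5 side L L') :
    L'.lk = L.lk := by
  obtain ⟨k, e, he, hr⟩ := h
  have hp : (1 : ℝ) = 1 ∨ (1 : ℝ) = -1 := Or.inl rfl
  have hn : (-1 : ℝ) = 1 ∨ (-1 : ℝ) = -1 := Or.inr rfl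
  refine hr.lk_eq he.continuous he.injective (fun j τ hτ => pictureM5_mem k hp side j hτ)
    (fun j τ hτ => pictureM5_mem k hn side j hτ) (pictureM5_hasCrossings k hp side)
    (pictureM5_hasCrossings k hn side) ?_
  intro i x r s hs hL hL'
  have e1 := (hL'.sign_pictureM5 hn hs).trans (hL.sign_pictureM5 hp hs).symm
  intro j j' hj
  rw [Finset.sum_singleton, Finset.sum_singleton]
  fin_cases j <;> fin_cases j'
  · simp at hj
  · exact e1
  · rw [L.sign_comm, L'.sign_comm]
    exact e1
  · simp at hj

theorem lk_eq_of_basicMove {L L' : OrientedLink X 2} (h : BasicMove L L') : L'.lk = L.lk := by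
  cases h with
  | M1_pos h => exact lk_eq_of_moveM1 h
  | M1_neg h => exact lk_eq_of_moveM1 h
  | M2 h => exact lk_eq_of_moveM2 h
  | M3 h => exact lk_eq_of_moveM3 h
  | M4 h => exact lk_eq_of_moveM4 h
  | M5_pos h => exact lk_eq_of_moveM5 h
  | M5_neg h => exact lk_eq_of_moveM5 h
  | M6 h => exact lk_eq_of_moveM6 h
  | M7 h => exact OrientedLink.lk_eq_of_moveM7 h

theorem lk_eq_of_isotopic {L L' : OrientedLink X 2} (h : Isotopic L L') : L'.lk = L.lk := by
  induction h with
  | rel L L' h =>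
    rcases h with h | h | h
    · exact OrientedLink.lk_eq_of_sameLink h
    · exact OrientedLink.lk_eq_of_ambientIsotopic h
    · exact lk_eq_of_basicMove h
  | refl L => rfl
  | symm L L' _ ih => exact ih.symm
  | trans L L' L'' _ _ ih ih' => exact ih'.trans ih

section

/-! ### The algebraic intersection number of two closed plane curves -/

open MeasureTheory

theorem setIntegral_deriv_eq_zero {u u' : ℝ → ℝ} {b : ℝ} (hu : ∀ t, HasDerivAt u (u' t) t)
    (hc : Continuous u') (hb : u (b + 1) = u b) : ∫ t in Icc b (b + 1), u' t = 0 := by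
  rw [integral_Icc_eq_integral_Ioc, ← intervalIntegral.integral_of_le (by linarith),
    intervalIntegral.integral_eq_sub_of_hasDerivAt (fun t _ => hu t) (hc.intervalIntegrable _ _),
    hb, sub_self]

/-- The pullback of an exact form of compact support under the difference of two closed curves has
integral zero. -/
theorem integral_mul_det2_eq_zero {g h : ℝ → ℝ × ℝ} (hg : ContDiff ℝ 1 g) (hh : ContDiff ℝ 1 h)
    (pg : ∀ s, g (s + 1) = g s) (ph : ∀ t, h (t + 1) = h t) {β : ℝ → ℝ} (hβ : ContDiff ℝ 1 β)
    (a b : ℝ) :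
    ∫ z in Icc a (a + 1) ×ˢ Icc b (b + 1), β ((g z.1).1 - (h z.2).1) * β ((g z.1).2 - (h z.2).2) *
      det2 (deriv g z.1) (deriv h z.2) = 0 := by
  -- With `B' = β`, the form `β(x) β(y) dx ∧ dy` is the differential of `B(x) β(y) dy`.
  set B : ℝ → ℝ := fun x => ∫ y in (0 : ℝ)..x, β y with hBdef
  have hβc : Continuous β := hβ.continuous
  have hB : ∀ x, HasDerivAt B (β x) x := fun x =>
    intervalIntegral.integral_hasDerivAt_right (hβc.intervalIntegrable _ _)
      (hβc.stronglyMeasurableAtFilter _ _) hβc.continuousAt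
  have hBc : Continuous B := continuous_iff_continuousAt.mpr fun x => (hB x).continuousAt
  have hβd : ∀ x, HasDerivAt β (deriv β x) x := fun x =>
    (hβ.differentiable one_ne_zero x).hasDerivAt
  have hβ'c : Continuous (deriv β) := hβ.continuous_deriv le_rfl
  have hgd : ∀ s, HasDerivAt g (deriv g s) s := fun s =>
    (hg.differentiable one_ne_zero s).hasDerivAt
  have hhd : ∀ s, HasDerivAt h (deriv h s) s := fun s =>
    (hh.differentiable one_ne_zero s).hasDerivAt
  have hg'c : Continuous (deriv g) := hg.continuous_deriv le_rfl
  have hh'c : Continuous (deriv h) := hh.continuous_deriv le_rfl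
  have hgc := hg.continuous
  have hhc := hh.continuous
  have hg1 : ∀ s, HasDerivAt (fun s => (g s).1) (deriv g s).1 s := fun s => (hgd s).fst
  have hg2 : ∀ s, HasDerivAt (fun s => (g s).2) (deriv g s).2 s := fun s => (hgd s).snd
  have hh1 : ∀ s, HasDerivAt (fun s => (h s).1) (deriv h s).1 s := fun s => (hhd s).fst
  have hh2 : ∀ s, HasDerivAt (fun s => (h s).2) (deriv h s).2 s := fun s => (hhd s).snd
  -- `F₁` is the derivative in `s` of `h₂'(t) B β` and `F₂` the derivative in `t` of `g₂'(s) B β`;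
  -- in the sum the terms with `deriv β` cancel. Each factor `h₂'`, `g₂'` is constant in the
  -- variable of differentiation, so curves of class C¹ suffice.
  set F₁ : ℝ × ℝ → ℝ := fun z => (deriv h z.2).2 *
    (β ((g z.1).1 - (h z.2).1) * (deriv g z.1).1 * β ((g z.1).2 - (h z.2).2) +
      B ((g z.1).1 - (h z.2).1) * (deriv β ((g z.1).2 - (h z.2).2) * (deriv g z.1).2)) with hF₁
  set F₂ : ℝ × ℝ → ℝ := fun z => (deriv g z.1).2 *
    (β ((g z.1).1 - (h z.2).1) * (-(deriv h z.2).1) * β ((g z.1).2 - (h z.2).2) +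
      B ((g z.1).1 - (h z.2).1) * (deriv β ((g z.1).2 - (h z.2).2) * (-(deriv h z.2).2))) with hF₂
  have hF₁c : Continuous F₁ := by fun_prop
  have hF₂c : Continuous F₂ := by fun_prop
  have hI₁ : ∀ s t : ℝ, IntegrableOn F₁ (Icc s (s + 1) ×ˢ Icc t (t + 1)) (volume.prod volume) :=
    fun s t => hF₁c.continuousOn.integrableOn_compact (isCompact_Icc.prod isCompact_Icc)
  have hI₂ : ∀ s t : ℝ, IntegrableOn F₂ (Icc s (s + 1) ×ˢ Icc t (t + 1)) (volume.prod volume) :=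
    fun s t => hF₂c.continuousOn.integrableOn_compact (isCompact_Icc.prod isCompact_Icc)
  have hsum : ∀ z : ℝ × ℝ, β ((g z.1).1 - (h z.2).1) * β ((g z.1).2 - (h z.2).2) *
      det2 (deriv g z.1) (deriv h z.2) = F₁ z + F₂ z := by
    intro z
    simp only [hF₁, hF₂, det2]
    ring
  simp_rw [hsum]
  -- By Fubini, `F₁` is integrated over `s` first and `F₂` over `t` first; each inner integral is
  -- that of the derivative of a periodic function.
  rw [Measure.volume_eq_prod, integral_add (hI₁ a b) (hI₂ a b), setIntegral_prod _ (hI₂ a b),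
    ← setIntegral_prod_swap, setIntegral_prod]
  · have e₁ : ∀ t, ∫ s in Icc a (a + 1), F₁ (s, t) = 0 := by
      intro t
      refine setIntegral_deriv_eq_zero (u := fun s => (deriv h t).2 *
        (B ((g s).1 - (h t).1) * β ((g s).2 - (h t).2))) (fun s => ?_)
        (hF₁c.comp (by fun_prop)) (by simp only [pg])
      exact (((hB _).comp s ((hg1 s).sub_const _)).mul
        ((hβd _).comp s ((hg2 s).sub_const _))).const_mul _
    have e₂ : ∀ s, ∫ t in Icc b (b + 1), F₂ (s, t) = 0 := by
      intro s
      refine setIntegral_deriv_eq_zero (u := fun t => (deriv g s).2 *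
        (B ((g s).1 - (h t).1) * β ((g s).2 - (h t).2))) (fun t => ?_)
        (hF₂c.comp (by fun_prop)) (by simp only [ph])
      exact (((hB _).comp t ((hh1 t).const_sub _)).mul
        ((hβd _).comp t ((hh2 t).const_sub _))).const_mul _
    simp only [Prod.swap_prod_mk, e₁, e₂, integral_zero, add_zero]
  · exact (hF₁c.comp continuous_swap).continuousOn.integrableOn_compact
      (isCompact_Icc.prod isCompact_Icc)

/-- The linear map of the plane with columns `v` and `w`. -/
def columns (v w : ℝ × ℝ) : ℝ × ℝ →L[ℝ] ℝ × ℝ :=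
  (ContinuousLinearMap.fst ℝ ℝ ℝ).smulRight v + (ContinuousLinearMap.snd ℝ ℝ ℝ).smulRight w

theorem columns_apply (v w q : ℝ × ℝ) : columns v w q = q.1 • v + q.2 • w := rfl

theorem det_columns (v w : ℝ × ℝ) : (columns v w).det = det2 v w := by
  rw [ContinuousLinearMap.det, ← LinearMap.det_toMatrix (Module.Basis.finTwoProd ℝ),
    Matrix.det_fin_two]
  simp [LinearMap.toMatrix_apply, columns_apply, det2]
  ring

/-- The invertible linear map of the plane with columns `v` and `w`. -/
def columnsEquiv {v w : ℝ × ℝ} (h : det2 v w ≠ 0) : (ℝ × ℝ) ≃L[ℝ] ℝ × ℝ :=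
  (columns v w).toContinuousLinearEquivOfDetNeZero (by rwa [det_columns])

/-- Used twice: for the difference of two closed curves, and for the map spanned by the two branches
at a crossing of a local link. -/
theorem hasStrictFDerivAt_columns {g h : ℝ → ℝ × ℝ} {v w : ℝ × ℝ} {z : ℝ × ℝ}
    (hg : HasStrictDerivAt g v z.1) (hh : HasStrictDerivAt h w z.2) :
    HasStrictFDerivAt (fun q : ℝ × ℝ => g q.1 + h q.2) (columns v w) z := by
  have h1 := hg.hasStrictFDerivAt.comp z (hasStrictFDerivAt_fst (p := z))
  have h2 := hh.hasStrictFDerivAt.comp z (hasStrictFDerivAt_snd (p := z))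
  have he : columns v w =
      ContinuousLinearMap.toSpanSingleton ℝ v ∘SL ContinuousLinearMap.fst ℝ ℝ ℝ +
        ContinuousLinearMap.toSpanSingleton ℝ w ∘SL ContinuousLinearMap.snd ℝ ℝ ℝ := by
    ext <;> simp [columns_apply]
  rw [he]
  exact h1.add h2

/-- The intersections of two transversal closed curves in the plane, counted with sign, cancel. -/
theorem sum_sign_intersections_eq_zero {g h : ℝ → ℝ × ℝ} (hg : ContDiff ℝ 1 g)
    (hh : ContDiff ℝ 1 h) (pg : ∀ s, g (s + 1) = g s) (ph : ∀ t, h (t + 1) = h t) {a b : ℝ}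
    {Z : Finset (ℝ × ℝ)} (hZ : ∀ z ∈ Z, z ∈ Ioo a (a + 1) ×ˢ Ioo b (b + 1))
    (hZe : ∀ z ∈ Z, g z.1 = h z.2)
    (hZall : ∀ z ∈ Icc a (a + 1) ×ˢ Icc b (b + 1), g z.1 = h z.2 → z ∈ Z)
    (ht : ∀ z ∈ Z, det2 (deriv g z.1) (deriv h z.2) ≠ 0) :
    ∑ z ∈ Z, (SignType.sign (det2 (deriv g z.1) (deriv h z.2)) : ℤ) = 0 := by
  set Q : Set (ℝ × ℝ) := Icc a (a + 1) ×ˢ Icc b (b + 1) with hQ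
  set D : ℝ × ℝ → ℝ := fun z => det2 (deriv g z.1) (deriv h z.2) with hD
  set G : ℝ × ℝ → ℝ × ℝ := fun z => g z.1 + -h z.2 with hG
  have hg'c : Continuous (deriv g) := hg.continuous_deriv le_rfl
  have hh'c : Continuous (deriv h) := hh.continuous_deriv le_rfl
  have hGc : Continuous G := by
    have := hg.continuous
    have := hh.continuous
    fun_prop
  have hDc : Continuous D := by
    simp only [hD, det2]
    fun_prop
  have hstrict : ∀ z : ℝ × ℝ, HasStrictFDerivAt G (columns (deriv g z.1) (-deriv h z.2)) z :=
    fun z => hasStrictFDerivAt_columns (hg.contDiffAt.hasStrictDerivAt one_ne_zero)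
      (hh.contDiffAt.hasStrictDerivAt one_ne_zero).neg
  have hdet : ∀ z : ℝ × ℝ, (columns (deriv g z.1) (-deriv h z.2)).det = -D z := fun z => by
    rw [det_columns]
    simp [hD, det2]
    ring
  obtain ⟨U, hU, hUd⟩ := Z.finite_toSet.t2_separation
  -- Around each zero `z` of `G`, the inverse function theorem gives an open set on which `G` is
  -- injective, with image a neighborhood of `0`. It is shrunk so that the sign of `D` is constant,
  -- so that it lies in the square, and so that the sets for different zeros are disjoint.
  have hV : ∀ z ∈ Z, ∃ V : Set (ℝ × ℝ), IsOpen V ∧ z ∈ V ∧ V ⊆ Q ∧ V ⊆ U z ∧ InjOn G V ∧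
      (∀ q ∈ V, SignType.sign (D q) = SignType.sign (D z)) ∧ G '' V ∈ 𝓝 0 := by
    intro z hz
    have hne : det2 (deriv g z.1) (-deriv h z.2) ≠ 0 := by
      rw [← det_columns, hdet]
      exact neg_ne_zero.mpr (ht z hz)
    have hs : HasStrictFDerivAt G (columnsEquiv hne : ℝ × ℝ →L[ℝ] ℝ × ℝ) z := hstrict z
    have hsgn : ∀ᶠ q in 𝓝 z, SignType.sign (D q) = SignType.sign (D z) := by
      rcases lt_or_gt_of_ne (ht z hz) with h | h
      · filter_upwards [hDc.continuousAt.eventually (gt_mem_nhds h)] with q hq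
        rw [sign_neg hq, sign_neg h]
      · filter_upwards [hDc.continuousAt.eventually (lt_mem_nhds h)] with q hq
        rw [sign_pos hq, sign_pos h]
    have hQz : Q ∈ 𝓝 z := prod_mem_nhds (Icc_mem_nhds (hZ z hz).1.1 (hZ z hz).1.2)
      (Icc_mem_nhds (hZ z hz).2.1 (hZ z hz).2.2)
    have hinj : (hs.toOpenPartialHomeomorph G).source ∈ 𝓝 z :=
      (hs.toOpenPartialHomeomorph G).open_source.mem_nhds hs.mem_toOpenPartialHomeomorph_source
    obtain ⟨V, hVs, hVo, hzV⟩ := mem_nhds_iff.mp (inter_mem (inter_mem hinj hQz)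
      (inter_mem ((hU z).2.mem_nhds (hU z).1) hsgn))
    refine ⟨V, hVo, hzV, fun q hq => (hVs hq).1.2, fun q hq => (hVs hq).2.1, ?_,
      fun q hq => (hVs hq).2.2, ?_⟩
    · exact (hs.toOpenPartialHomeomorph G).injOn.mono fun q hq => (hVs hq).1.1
    · have : G '' V ∈ map G (𝓝 z) := image_mem_map (hVo.mem_nhds hzV)
      rw [hs.map_nhds_eq_of_equiv] at this
      simpa [hG, hZe z hz] using this
  choose! V hVo hzV hVQ hVU hVinj hVsgn hVimg using hV
  -- The rest of the square is compact and contains no zero of `G`, so its image stays away from a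
  -- neighborhood of `0`.
  set K : Set (ℝ × ℝ) := Q \ ⋃ z ∈ Z, V z
  have hKc : IsCompact K := (isCompact_Icc.prod isCompact_Icc).diff
    (isOpen_biUnion fun z hz => hVo z hz)
  have hK0 : (0 : ℝ × ℝ) ∉ G '' K := by
    rintro ⟨q, hq, h0⟩
    have hqZ : q ∈ Z := hZall q hq.1 (add_neg_eq_zero.mp h0)
    exact hq.2 (mem_biUnion hqZ (hzV q hqZ))
  have hO : (⋂ z ∈ Z, G '' V z) ∩ (G '' K)ᶜ ∈ 𝓝 (0 : ℝ × ℝ) :=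
    inter_mem ((biInter_finset_mem Z).mpr hVimg)
      ((hKc.image hGc).isClosed.isOpen_compl.mem_nhds hK0)
  obtain ⟨ε, hε, hεO⟩ := Metric.mem_nhds_iff.mp hO
  -- The support of the bump is so small that `ρ ∘ G` vanishes on `K`, while every `G '' V z`
  -- contains the whole support of `ρ`.
  let β : ContDiffBump (0 : ℝ) := ⟨ε / 2, ε, by linarith, by linarith⟩
  set ρ : ℝ × ℝ → ℝ := fun q => β q.1 * β q.2 with hρ
  have hρsupp : ∀ q, q ∉ Metric.ball (0 : ℝ × ℝ) ε → ρ q = 0 := by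
    intro q hq
    by_contra hne
    have h1 : q.1 ∈ Function.support β := left_ne_zero_of_mul hne
    have h2 : q.2 ∈ Function.support β := right_ne_zero_of_mul hne
    rw [β.support_eq] at h1 h2
    refine hq ?_
    rw [← Prod.mk_zero_zero, ← ball_prod_same]
    exact ⟨h1, h2⟩
  have hρint : 0 < ∫ q, ρ q := by
    rw [hρ, Measure.volume_eq_prod, integral_prod_mul (fun x => β x) (fun x => β x)]
    exact mul_pos β.integral_pos β.integral_pos
  have hβc : Continuous β := β.continuous
  have hcont : Continuous fun z => ρ (G z) * D z := by fun_prop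
  have hJ : ∫ z in Q, ρ (G z) * D z = 0 := by
    have := integral_mul_det2_eq_zero hg hh pg ph (β := β) β.contDiff a b
    simpa [hρ, hG, hD, hQ, sub_eq_add_neg] using this
  have hunion : ∫ z in Q, ρ (G z) * D z = ∫ z in ⋃ z ∈ Z, V z, ρ (G z) * D z := by
    refine setIntegral_eq_of_subset_of_forall_sdiff_eq_zero
      (measurableSet_Icc.prod measurableSet_Icc) (iUnion₂_subset hVQ) fun q hq => ?_
    rw [hρsupp (G q) fun hb => (hεO hb).2 ⟨q, hq, rfl⟩, zero_mul]
  -- Change of variables along `G`: its Jacobian determinant is `-D`, and `D` is its absolute value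
  -- times the constant sign. Each zero therefore contributes its sign times the same positive
  -- number.
  have hint : ∀ z ∈ Z, ∫ q in V z, ρ (G q) * D q =
      (SignType.sign (D z) : ℝ) * ∫ q, ρ q := by
    intro z hz
    have himg : ∫ q in G '' V z, ρ q = ∫ q, ρ q :=
      setIntegral_eq_integral_of_forall_compl_eq_zero fun q hq =>
        hρsupp q fun hb => hq (mem_iInter₂.mp (hεO hb).1 z hz)
    rw [← himg, integral_image_eq_integral_abs_det_fderiv_smul volume (hVo z hz).measurableSet
      (fun q _ => (hstrict q).hasFDerivAt.hasFDerivWithinAt) (hVinj z hz), ← integral_const_mul]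
    refine setIntegral_congr_fun (hVo z hz).measurableSet fun q hq => ?_
    simp only [smul_eq_mul]
    rw [hdet, abs_neg, ← hVsgn z hz q hq, ← mul_assoc, sign_mul_abs, mul_comm]
  have hsum : ∑ z ∈ Z, (SignType.sign (D z) : ℝ) * ∫ q, ρ q = 0 := by
    rw [← hJ, hunion, integral_biUnion_finset Z (fun z hz => (hVo z hz).measurableSet)]
    · exact Finset.sum_congr rfl fun z hz => (hint z hz).symm
    · exact fun z hz z' hz' hne => (hUd hz hz' hne).mono (hVU z hz) (hVU z' hz')
    · exact fun z hz => (hcont.continuousOn.integrableOn_compact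
        (isCompact_Icc.prod isCompact_Icc)).mono_set (hVQ z hz)
  rw [← Finset.sum_mul] at hsum
  have := (mul_eq_zero.mp hsum).resolve_right hρint.ne'
  have hcast : ∀ x : SignType, ((x : ℤ) : ℝ) = (x : ℝ) := by
    intro x
    cases x <;> simp
  refine Int.cast_injective (α := ℝ) ?_
  rw [Int.cast_sum, Int.cast_zero, ← this]
  exact Finset.sum_congr rfl fun z _ => hcast _

end

/-! ### Local links -/

namespace ClassicalLink

/-- The projection to the plane of the `i`-th component, as a periodic function. -/
def planeCurve (ℓ : ClassicalLink n) (i : Fin n) (u : ℝ) : ℝ × ℝ :=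
  (ℓ.curve i (u : AddCircle (1 : ℝ))).1

theorem planeCurve_contDiff (ℓ : ClassicalLink n) (i : Fin n) :
    ContDiff ℝ 1 (ℓ.planeCurve i) := (ℓ.smooth i).fst

theorem planeCurve_add_one (ℓ : ClassicalLink n) (i : Fin n) (u : ℝ) :
    ℓ.planeCurve i (u + 1) = ℓ.planeCurve i u := by
  simp [planeCurve]

theorem velocity_coe (ℓ : ClassicalLink n) (i : Fin n) (u : ℝ) :
    ℓ.velocity (i, (u : AddCircle (1 : ℝ))) = deriv (ℓ.planeCurve i) u := by
  have h : (fun x : ℝ => (ℓ.curve i ((u : AddCircle (1 : ℝ)) + (x : AddCircle (1 : ℝ)))).1) =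
      fun x => ℓ.planeCurve i (u + x) := by
    funext x
    rw [planeCurve, AddCircle.coe_add]
  rw [velocity, planeVelocity, h, deriv_comp_const_add, add_zero]

theorem hasStrictDerivAt (ℓ : ClassicalLink n) (P : Fin n × AddCircle (1 : ℝ)) :
    HasStrictDerivAt (fun u : ℝ => (ℓ.curve P.1 (P.2 + (u : AddCircle (1 : ℝ)))).1)
      (ℓ.velocity P) 0 := by
  obtain ⟨i, p⟩ := P
  induction p using QuotientAddGroup.induction_on with
  | H x =>
    have hc : ContDiff ℝ 1 fun u : ℝ => ℓ.planeCurve i (x + u) :=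
      (ℓ.planeCurve_contDiff i).comp (contDiff_const.add contDiff_id)
    have h : (fun u : ℝ => (ℓ.curve i ((x : AddCircle (1 : ℝ)) + (u : AddCircle (1 : ℝ)))).1) =
        fun u => ℓ.planeCurve i (x + u) := by
      funext u
      rw [planeCurve, AddCircle.coe_add]
    have hd := hc.contDiffAt.hasStrictDerivAt (x := 0) one_ne_zero
    rw [← h] at hd
    exact hd

theorem finite_plane_crossings (ℓ : ClassicalLink 2) :
    {c : AddCircle (1 : ℝ) × AddCircle (1 : ℝ) |
      (ℓ.curve 0 c.1).1 = (ℓ.curve 1 c.2).1}.Finite := by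
  refine Set.Finite.of_finite_image (f := fun c => (((0 : Fin 2), c.1), ((1 : Fin 2), c.2)))
    (ℓ.finite_crossings.subset ?_) ?_
  · rintro _ ⟨c, hc, rfl⟩
    exact ⟨by simp, hc⟩
  · rintro ⟨a, b⟩ _ ⟨c, d⟩ _ h
    simpa using h

/-- Serves to cut each circle at a parameter that belongs to no crossing, so that all crossings lie
in the interior of a period square. -/
theorem exists_coe_notMem {S : Set (AddCircle (1 : ℝ))} (hS : S.Finite) :
    ∃ a : ℝ, (a : AddCircle (1 : ℝ)) ∉ S := by
  have hinj : InjOn (fun x : ℝ => (x : AddCircle (1 : ℝ))) (Ico 0 1) := by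
    intro x hx y hy h
    exact (AddCircle.coe_eq_coe_iff_of_mem_Ico (p := 1) (a := 0) (by simpa using hx)
      (by simpa using hy)).mp h
  obtain ⟨x, hx, hxS⟩ := ((Ico_infinite (zero_lt_one (α := ℝ))).image hinj).exists_notMem_finite hS
  obtain ⟨a, -, rfl⟩ := hx
  exact ⟨a, hxS⟩

/-- The projections of the two components intersect algebraically zero times. -/
theorem sum_sign_plane_crossings (ℓ : ClassicalLink 2) :
    ∑ c ∈ ℓ.finite_plane_crossings.toFinset,
      (SignType.sign (det2 (ℓ.velocity (0, c.1)) (ℓ.velocity (1, c.2))) : ℤ) = 0 := by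
  classical
  obtain ⟨a, ha⟩ := exists_coe_notMem (ℓ.finite_plane_crossings.image Prod.fst)
  obtain ⟨b, hb⟩ := exists_coe_notMem (ℓ.finite_plane_crossings.image Prod.snd)
  set lift : AddCircle (1 : ℝ) × AddCircle (1 : ℝ) → ℝ × ℝ := fun c =>
    ((AddCircle.equivIco 1 a c.1 : ℝ), (AddCircle.equivIco 1 b c.2 : ℝ)) with hlift
  have hproj : ∀ c, (((lift c).1 : AddCircle (1 : ℝ)), ((lift c).2 : AddCircle (1 : ℝ))) = c :=
    fun c => Prod.ext AddCircle.coe_equivIco AddCircle.coe_equivIco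
  have hinj : Function.Injective lift := fun c c' h => by rw [← hproj c, h, hproj]
  have hcross : ∀ c, c ∈ ℓ.finite_plane_crossings.toFinset ↔
      (ℓ.curve 0 c.1).1 = (ℓ.curve 1 c.2).1 := fun c => Finite.mem_toFinset _
  have hne : ∀ s t : ℝ, ℓ.planeCurve 0 s = ℓ.planeCurve 1 t →
      (s : AddCircle (1 : ℝ)) ≠ (a : AddCircle (1 : ℝ)) ∧
      (t : AddCircle (1 : ℝ)) ≠ (b : AddCircle (1 : ℝ)) := by
    intro s t hst
    constructor
    · intro h
      exact ha ⟨((s : AddCircle (1 : ℝ)), (t : AddCircle (1 : ℝ))), hst, h⟩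
    · intro h
      exact hb ⟨((s : AddCircle (1 : ℝ)), (t : AddCircle (1 : ℝ))), hst, h⟩
  have hlc : ∀ c, c ∈ ℓ.finite_plane_crossings.toFinset →
      ℓ.planeCurve 0 (lift c).1 = ℓ.planeCurve 1 (lift c).2 := by
    intro c hc
    have h1 := congrArg Prod.fst (hproj c)
    have h2 := congrArg Prod.snd (hproj c)
    simp only at h1 h2
    rw [planeCurve, planeCurve, h1, h2]
    exact (hcross c).mp hc
  have hIoo : ∀ x y : ℝ, x ∈ Icc y (y + 1) →
      (x : AddCircle (1 : ℝ)) ≠ (y : AddCircle (1 : ℝ)) → x ∈ Ioo y (y + 1) := by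
    intro x y hx h
    refine ⟨lt_of_le_of_ne hx.1 fun h' => h (by rw [h']), lt_of_le_of_ne hx.2 fun h' => h ?_⟩
    rw [h']
    simp
  have key := sum_sign_intersections_eq_zero (ℓ.planeCurve_contDiff 0) (ℓ.planeCurve_contDiff 1)
    (ℓ.planeCurve_add_one 0) (ℓ.planeCurve_add_one 1) (a := a) (b := b)
    (Z := ℓ.finite_plane_crossings.toFinset.image lift) ?_ ?_ ?_ ?_
  · rw [Finset.sum_image fun c _ c' _ h => hinj h] at key
    rw [← key]
    refine Finset.sum_congr rfl fun c _ => ?_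
    have h1 := congrArg Prod.fst (hproj c)
    have h2 := congrArg Prod.snd (hproj c)
    simp only at h1 h2
    rw [← velocity_coe, ← velocity_coe, h1, h2]
  · intro z hz
    obtain ⟨c, hc, rfl⟩ := Finset.mem_image.mp hz
    have h := hne _ _ (hlc c hc)
    exact ⟨hIoo _ _ (Ico_subset_Icc_self (AddCircle.equivIco 1 a c.1).2) h.1,
      hIoo _ _ (Ico_subset_Icc_self (AddCircle.equivIco 1 b c.2).2) h.2⟩
  · intro z hz
    obtain ⟨c, hc, rfl⟩ := Finset.mem_image.mp hz
    exact hlc c hc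
  · rintro ⟨s, t⟩ ⟨hs, ht⟩ hst
    have h := hne _ _ hst
    refine Finset.mem_image.mpr
      ⟨((s : AddCircle (1 : ℝ)), (t : AddCircle (1 : ℝ))), (hcross _).mpr hst, ?_⟩
    exact Prod.ext (AddCircle.equivIco_coe_of_mem (Ioo_subset_Ico_self (hIoo _ _ hs h.1)))
      (AddCircle.equivIco_coe_of_mem (Ioo_subset_Ico_self (hIoo _ _ ht h.2)))
  · intro z hz
    obtain ⟨c, hc, rfl⟩ := Finset.mem_image.mp hz
    rw [← velocity_coe, ← velocity_coe]
    exact ℓ.transversal (0, _) (1, _) (by simp) (hlc c hc)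

/-- Points of an embedded curve with the same projection have different heights. -/
theorem over_or_over (ℓ : ClassicalLink n) {P Q : Fin n × AddCircle (1 : ℝ)} (hPQ : P ≠ Q)
    (h : (ℓ.curve P.1 P.2).1 = (ℓ.curve Q.1 Q.2).1) : ℓ.Over P Q ∨ ℓ.Over Q P := by
  have hne : (ℓ.curve P.1 P.2).2 ≠ (ℓ.curve Q.1 Q.2).2 := fun h' =>
    hPQ (ℓ.embedded P Q (Prod.ext h h'))
  rcases lt_or_gt_of_ne hne with h' | h'
  · exact Or.inr ⟨h.symm, h'⟩
  · exact Or.inl ⟨h, h'⟩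

theorem Over.not_over {ℓ : ClassicalLink n} {P Q : Fin n × AddCircle (1 : ℝ)} (h : ℓ.Over P Q) :
    ¬ ℓ.Over Q P := fun h' => lt_asymm h.2 h'.2

theorem det2_swap (v w : ℝ × ℝ) : det2 w v = -det2 v w := by
  simp only [det2]
  ring

/-- A sum over the crossings of the two components splits into the sum over those where the first
one is the upper one and the sum over those where it is the lower one. -/
theorem sum_plane_crossings (ℓ : ClassicalLink 2)
    (F : AddCircle (1 : ℝ) × AddCircle (1 : ℝ) → ℤ) :
    ∑ c ∈ ℓ.finite_plane_crossings.toFinset, F c =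
      ∑ c ∈ (ℓ.finite_over 0 1).toFinset, F c + ∑ c ∈ (ℓ.finite_over 1 0).toFinset, F c.swap := by
  classical
  rw [← Finset.sum_filter_add_sum_filter_not _ fun c => ℓ.Over (0, c.1) (1, c.2)]
  congr 1
  · refine Finset.sum_congr ?_ fun _ _ => rfl
    ext c
    simp only [Finset.mem_filter, Finite.mem_toFinset]
    exact ⟨fun h => h.2, fun h => ⟨h.1, h⟩⟩
  · refine Finset.sum_nbij' Prod.swap Prod.swap ?_ ?_ (by simp) (by simp) (by simp)
    · intro c hc
      simp only [Finset.mem_filter, Finite.mem_toFinset] at hc ⊢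
      exact (ℓ.over_or_over (P := (0, c.1)) (Q := (1, c.2)) (by simp) hc.1).resolve_left hc.2
    · intro c hc
      simp only [Finset.mem_filter, Finite.mem_toFinset] at hc ⊢
      have hc : ℓ.Over (1, c.1) (0, c.2) := hc
      exact ⟨hc.1.symm, hc.not_over⟩

/-- In the vanishing sum over all plane crossings the determinant has the velocity of component `0`
first. Where component `0` is above, this gives `lk 0 1`; where it is below, antisymmetry of the
determinant gives `-lk 1 0`. -/
theorem lk_comm (ℓ : ClassicalLink 2) : ℓ.lk 0 1 = ℓ.lk 1 0 := by
  have h := ℓ.sum_sign_plane_crossings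
  rw [sum_plane_crossings] at h
  have h' : ∑ c ∈ (ℓ.finite_over 1 0).toFinset,
      (SignType.sign (det2 (ℓ.velocity (0, c.swap.1)) (ℓ.velocity (1, c.swap.2))) : ℤ) =
      -ℓ.lk 1 0 := by
    rw [lk, ← Finset.sum_neg_distrib]
    refine Finset.sum_congr rfl fun c _ => ?_
    rw [det2_swap, Left.sign_neg]
    simp
  rw [h'] at h
  change ℓ.lk 0 1 + _ = 0 at h
  omega

end ClassicalLink

/-! ### Crossing signs and parity for local links -/

theorem det2_columns_left (v w q : ℝ × ℝ) : det2 v (columns v w q) = q.2 * det2 v w := by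
  simp only [columns_apply, det2, Prod.fst_add, Prod.snd_add, Prod.smul_fst, Prod.smul_snd,
    smul_eq_mul]
  ring

theorem det2_columns_right (v w q : ℝ × ℝ) : det2 (columns v w q) w = q.1 * det2 v w := by
  simp only [columns_apply, det2, Prod.fst_add, Prod.snd_add, Prod.smul_fst, Prod.smul_snd,
    smul_eq_mul]
  ring

theorem eventually_pos_of_hasDerivAt {u : ℝ → ℝ} {d : ℝ} (hu : HasDerivAt u d 0) (h0 : u 0 = 0)
    (hd : 0 < d) : ∀ᶠ ε in 𝓝[>] (0 : ℝ), 0 < u ε := by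
  have h := hu.tendsto_slope.mono_left (nhdsWithin_mono (0 : ℝ) fun x hx => ne_of_gt hx)
  filter_upwards [h.eventually (lt_mem_nhds hd), self_mem_nhdsWithin] with ε hε hpos
  rw [slope_def_field, h0, sub_zero, sub_zero] at hε
  exact (div_pos_iff_of_pos_right hpos).mp hε

/-- The sign of a crossing of a local link is the classical sign. -/
theorem IsLocalLinkModeledOn.sign_eq {L : OrientedLink X n} {ℓ : ClassicalLink n} {f : ℝ × ℝ → X}
    (h : IsLocalLinkModeledOn L ℓ f) {P Q : Fin n × AddCircle (1 : ℝ)} (hPQ : ℓ.Over P Q) :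
    L.sign P Q = (SignType.sign (det2 (ℓ.velocity P) (ℓ.velocity Q)) : ℤ) := by
  have hne : P ≠ Q := by
    rintro rfl
    exact lt_irrefl _ hPQ.2
  set v := ℓ.velocity P
  set w := ℓ.velocity Q
  have hD : det2 v w ≠ 0 := ℓ.transversal P Q hne hPQ.1
  set c := (ℓ.curve P.1 P.2).1 with hc
  -- `F` carries the two coordinate axes along the two branches and is a local homeomorphism at `0`,
  -- since its derivative has determinant `det2 v w ≠ 0`.
  set F : ℝ × ℝ → ℝ × ℝ := fun q => (ℓ.curve P.1 (P.2 + (q.1 : AddCircle (1 : ℝ)))).1 +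
    ((ℓ.curve Q.1 (Q.2 + (q.2 : AddCircle (1 : ℝ)))).1 - c) with hF
  have hQd : HasStrictDerivAt
      (fun u : ℝ => (ℓ.curve Q.1 (Q.2 + (u : AddCircle (1 : ℝ)))).1 - c) w 0 :=
    (ℓ.hasStrictDerivAt Q).sub_const c
  have hFc : HasStrictFDerivAt F (columns v w) 0 :=
    hasStrictFDerivAt_columns (z := 0) (ℓ.hasStrictDerivAt P) hQd
  have hFs : HasStrictFDerivAt F (columnsEquiv hD : ℝ × ℝ →L[ℝ] ℝ × ℝ) 0 := hFc
  have hF0 : F 0 = c := by simp [hF, hc, hPQ.1]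
  have hE := L.sign_of_parametrization hne (E := fun q => f (F q))
    ((hFs.toOpenPartialHomeomorph F).open_source.mem_nhds hFs.mem_toOpenPartialHomeomorph_source)
    (h.embedding.continuous.comp_continuousOn (hFs.toOpenPartialHomeomorph F).continuousOn)
    (fun q hq q' hq' he => (hFs.toOpenPartialHomeomorph F).injOn hq hq' (h.embedding.injective he))
    (.of_eventuallyEq (.of_forall fun u => by
      simp [hF, hc, hPQ.1, OrientedLink.branch, h.curve_eq]))
    (.of_eventuallyEq (.of_forall fun u => by
      simp [hF, hc, OrientedLink.branch, h.curve_eq]))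
  -- The direction `v + σ • w` with `σ` of the sign of `det2 v w` points into an area swept by the
  -- counterclockwise rotation of the upper line to the lower one, so there are dots in the
  -- corresponding quadrant.
  have key : ∀ σ : ℝ, 0 < σ * det2 v w →
      ∃ᶠ q in 𝓝 (0 : ℝ × ℝ), (0 < q.1 ∧ 0 < σ * q.2) ∧ f (F q) ∈ L.dotted := by
    intro σ hσ
    set d : ℝ × ℝ := columns v w (1, σ) with hd
    set G := hFs.localInverse F _ _
    have hline : HasDerivAt (fun ε : ℝ => c + ε • d) d 0 := by
      simpa using ((hasDerivAt_id (0 : ℝ)).smul_const d).const_add c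
    -- The dots are given along a straight ray in the plane. In the coordinates of `F` it becomes a
    -- curve with velocity `(1, σ)`, which enters the quadrant of `(1, σ)`.
    have hGd : HasDerivAt (fun ε : ℝ => G (c + ε • d)) (1, σ) 0 := by
      have h1 : HasStrictFDerivAt G ((columnsEquiv hD).symm : ℝ × ℝ →L[ℝ] ℝ × ℝ) (F 0) :=
        hFs.to_localInverse
      rw [hF0] at h1
      have h2 : HasDerivAt (fun ε : ℝ => G (c + ε • d)) ((columnsEquiv hD).symm d) 0 := by
        have h1' : HasFDerivAt G ((columnsEquiv hD).symm : ℝ × ℝ →L[ℝ] ℝ × ℝ)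
            (c + (0 : ℝ) • d) := by simpa using h1.hasFDerivAt
        exact h1'.comp_hasDerivAt (0 : ℝ) hline
      have h3 : (columnsEquiv hD).symm d = (1, σ) := by
        rw [ContinuousLinearEquiv.symm_apply_eq]
        rfl
      rwa [h3] at h2
    have hG0 : G c = 0 := by
      have := hFs.localInverse_apply_image
      rwa [hF0] at this
    have hGt : Tendsto (fun ε : ℝ => G (c + ε • d)) (𝓝[>] 0) (𝓝 0) := by
      have := hGd.continuousAt.tendsto
      simp only [zero_smul, add_zero, hG0] at this
      exact this.mono_left nhdsWithin_le_nhds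
    refine hGt.frequently (Eventually.frequently ?_)
    have hGd1 : HasDerivAt (fun ε : ℝ => (G (c + ε • d)).1) 1 0 := hGd.fst
    have hGd2 : HasDerivAt (fun ε : ℝ => (G (c + ε • d)).2) σ 0 := hGd.snd
    have e1 := eventually_pos_of_hasDerivAt hGd1 (by simp [hG0]) one_pos
    have hσ0 : σ ≠ 0 := left_ne_zero_of_mul hσ.ne'
    have e2 := eventually_pos_of_hasDerivAt (hGd2.const_mul σ) (by simp [hG0])
      (mul_self_pos.mpr hσ0)
    have e3 := h.dotted P Q hPQ d (by
      rw [hd, det2_columns_left, det2_columns_right]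
      have : σ * det2 v w * (1 * det2 v w) * det2 v w = σ * det2 v w * det2 v w ^ 2 := by ring
      rw [this]
      positivity)
    have e4 : ∀ᶠ ε in 𝓝[>] (0 : ℝ), F (G (c + ε • d)) = c + ε • d := by
      have h1 := hFs.eventually_right_inverse
      rw [hF0] at h1
      have h2 : Tendsto (fun ε : ℝ => c + ε • d) (𝓝[>] 0) (𝓝 c) := by
        have := hline.continuousAt.tendsto
        simp only [zero_smul, add_zero] at this
        exact this.mono_left nhdsWithin_le_nhds
      exact h2.eventually h1
    filter_upwards [e1, e2, e3, e4] with ε h1 h2 h3 h4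
    refine ⟨⟨h1, h2⟩, ?_⟩
    rw [h4]
    exact h3
  -- `σ = -1` gives dots in the odd quadrants, `σ = 1` in the even ones.
  rcases lt_or_gt_of_ne hD with hlt | hgt
  · rw [sign_neg hlt]
    refine hE.2 ((key (-1) (by linarith)).mono fun q hq => ⟨?_, hq.2⟩)
    exact mul_neg_of_pos_of_neg hq.1.1 (by linarith [hq.1.2])
  · rw [sign_pos hgt]
    refine hE.1 ((key 1 (by linarith)).mono fun q hq => ⟨?_, hq.2⟩)
    exact mul_pos hq.1.1 (by linarith [hq.1.2])

theorem IsLocalLinkModeledOn.lk_eq {L : OrientedLink X 2} {ℓ : ClassicalLink 2} {f : ℝ × ℝ → X}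
    (h : IsLocalLinkModeledOn L ℓ f) : L.lk = ℓ.lk 0 1 + ℓ.lk 1 0 := by
  have hm : L.finite_mixedCrossings.toFinset = ℓ.finite_plane_crossings.toFinset := by
    ext c
    simp only [Finite.mem_toFinset]
    change L.curve 0 c.1 = L.curve 1 c.2 ↔ _
    rw [h.curve_eq, h.curve_eq, h.embedding.injective.eq_iff]
    rfl
  rw [OrientedLink.lk, hm, ClassicalLink.sum_plane_crossings]
  congr 1
  · refine Finset.sum_congr rfl fun c hc => h.sign_eq ?_
    exact (ℓ.finite_over 0 1).mem_toFinset.mp hc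
  · refine Finset.sum_congr rfl fun c hc => ?_
    rw [L.sign_comm]
    exact h.sign_eq ((ℓ.finite_over 1 0).mem_toFinset.mp hc)

theorem IsLocal.even_lk {L : OrientedLink X 2} (h : IsLocal L) : Even L.lk := by
  obtain ⟨ℓ, f, h⟩ := h
  rw [h.lk_eq, ℓ.lk_comm]
  exact ⟨_, rfl⟩

end TwoComplexLinks

end

/-! ### The theorem -/

open TwoComplexLinks in
theorem mainTheorem2 {X : Type*} [TopologicalSpace X] [IsTwoComplex X] :
    (∀ L L' : OrientedLink X 2, SameLink L L' → L'.lk = L.lk) ∧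
    (∀ L L' : OrientedLink X 2, AmbientIsotopic L L' → L'.lk = L.lk) ∧
    (∀ L L' : OrientedLink X 2, MoveM1 true L L' → L'.lk = L.lk) ∧
    (∀ L L' : OrientedLink X 2, MoveM1 false L L' → L'.lk = L.lk) ∧
    (∀ L L' : OrientedLink X 2, MoveM2 L L' → L'.lk = L.lk) ∧
    (∀ L L' : OrientedLink X 2, MoveM3 L L' → L'.lk = L.lk) ∧
    (∀ L L' : OrientedLink X 2, MoveM4 L L' → L'.lk = L.lk) ∧
    (∀ L L' : OrientedLink X 2, MoveM5 true L L' → L'.lk = L.lk) ∧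
    (∀ L L' : OrientedLink X 2, MoveM5 false L L' → L'.lk = L.lk) ∧
    (∀ L L' : OrientedLink X 2, MoveM6 L L' → L'.lk = L.lk) ∧
    (∀ L L' : OrientedLink X 2, MoveM7 L L' → L'.lk = L.lk) ∧
    (∀ L L' : OrientedLink X 2, Isotopic L L' → L'.lk = L.lk) ∧
    (∀ L : OrientedLink X 2, L.lk ≡ (L.mixedCrossings.ncard : ℤ) [ZMOD 2]) ∧
    (∀ L : OrientedLink X 2, L.mirror.lk = -L.lk) ∧
    (∀ L : OrientedLink X 2, L.reverse.lk = L.lk) ∧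
    (∀ (L : OrientedLink X 2) (ℓ : ClassicalLink 2) (f : ℝ × ℝ → X), IsLocalLinkModeledOn L ℓ f →
      L.lk = ℓ.lk 0 1 + ℓ.lk 1 0 ∧ L.lk = 2 * ℓ.lk 0 1 ∧ L.lk = 2 * ℓ.lk 1 0) ∧
    (∀ L : OrientedLink X 2, Odd L.lk → ¬ ∃ L' : OrientedLink X 2, IsLocal L' ∧ Isotopic L L') := by
  refine ⟨fun _ _ => OrientedLink.lk_eq_of_sameLink,
    fun _ _ => OrientedLink.lk_eq_of_ambientIsotopic, fun _ _ => lk_eq_of_moveM1,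
    fun _ _ => lk_eq_of_moveM1, fun _ _ => lk_eq_of_moveM2, fun _ _ => lk_eq_of_moveM3,
    fun _ _ => lk_eq_of_moveM4, fun _ _ => lk_eq_of_moveM5, fun _ _ => lk_eq_of_moveM5,
    fun _ _ => lk_eq_of_moveM6, fun _ _ => OrientedLink.lk_eq_of_moveM7,
    fun _ _ => lk_eq_of_isotopic, OrientedLink.lk_modEq_ncard, OrientedLink.lk_mirror,
    OrientedLink.lk_reverse, fun L ℓ f h => ?_, ?_⟩
  · have h1 := h.lk_eq
    have h2 := ℓ.lk_comm
    exact ⟨h1, by omega, by omega⟩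
  · rintro L hodd ⟨L', hloc, hiso⟩
    rw [← lk_eq_of_isotopic hiso] at hodd
    exact Int.not_even_iff_odd.mpr hodd hloc.even_lk
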